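/- Let $k$ be a non-archimedean local field whose residue field has characteristic different from $2$, let $V$ be an $n$-dimensional $k$-vector space, and let $q$ be a nondegenerate quadratic form on $V$. Assume that $\mathrm{char}(k)$ is $0$ or is larger than the largest Coxeter number $h$ of a component of the root system of the special orthogonal group in dimension $n$ (so $h=n-1$ for $n$ odd, $h=n-2$ for even $n\ge 2$, with $h=0$ if the root system is empty). Let $\mathrm{O}(q)$ and $\mathrm{SO}(q)$ be the orthogonal and special orthogonal groups of $q$, acting by conjugation on the orthogonal Lie algebra $\mathfrak{so}(q)\subset\mathrm{End}_k(V)$. Write $[q]$ for the class of $q$ in the Witt group of $k$ and $d$ for its anisotropic dimension, i.e. the dimension of the anisotropic kernel of $q$. Let $\Lambda(n)$ be the set of partitions of $n$ in which every even part occurs with even multiplicity, and let $\lambda\in\Lambda(n)$. Write $X_i$ for the number of distinct odd parts of $\lambda$ of multiplicity exactly $i$, and set $a=X_1$, $b=X_2$, $c=\sum_{i=3}^{n}X_i$. Let $\mathcal{O}_\lambda$ be the set of nilpotent elements with Jordan block sizes given by $\lambda$ in the orthogonal Lie algebra of $q$ over an algebraic closure $\bar k$; it is a single orbit of the orthogonal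 group of $q$ over $\bar k$. Let $\mathcal{O}_\lambda(k)$ be its set of $k$-rational points, i.e. the set of elements of $\mathfrak{so}(q)$ whose extension to $\bar k\otimes_k V$ lies in $\mathcal{O}_\lambda$. Let $\mathcal{Q}_\lambda$ be the set of tuples $\vec q=[q_j]_j$, indexed by the distinct odd parts $j$ of $\lambda$, in which $q_j$ is an isometry class of nondegenerate quadratic forms over $k$ of dimension equal to the multiplicity of $j$ in $\lambda$, and put $[\vec q]=\sum_j[q_j]$ in the Witt group (the empty tuple has class $0$). Then the number of $\mathrm{O}(q)$-orbits in $\mathcal{O}_\lambda(k)$ is finite and equal to $$\bigl|\{\vec q\in\mathcal{Q}_\lambda \mid [\vec q]=[q]\}\bigr| = N_{a,b,c}([q]),$$ where $$N_{a,b,c}([q])=\begin{cases} \frac18\, 4^{a}7^{b}8^{c} & \text{if } c\ge 1,\\ \frac18\, 4^{a}7^{b}+(2-d)\,2^{a-2} & \text{if } c=0,\ a>0,\\ \lfloor \frac18 7^{b}\rceil+\varepsilon_{d,b} & \text{if } a=c=0. \end{cases}$$ Here $\lfloor\cdot\rceil$ denotes the nearest integer, and $\varepsilon_{d,b}=(-1)^b$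 if either $d=0$ and $b$ is even, or $d=4$ and $b$ is odd, while $\varepsilon_{d,b}=0$ otherwise. Moreover, if $n\ge 1$, the number of $\mathrm{SO}(q)$-orbits in $\mathcal{O}_\lambda(k)$ is also $N_{a,b,c}([q])$, unless $a=b=c=d=0$, in which case there are exactly two. -/

import Mathlib

open ValuativeRel
open scoped TensorProduct

noncomputable section

/-! ### Quadratic forms and Witt equivalence -/

/-- The quadratic hyperbolic plane: the form `(x, y) ↦ x * y` on `F × F`. -/
def hyperbolicPlane (F : Type*) [Field F] : QuadraticForm F (F × F) :=
  QuadraticMap.linMulLin (LinearMap.fst F F F) (LinearMap.snd F F F)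

/-- The orthogonal sum of `r` hyperbolic planes. -/
def hyperbolicSum (F : Type*) [Field F] (r : ℕ) : QuadraticForm F (Fin r → F × F) :=
  QuadraticMap.pi fun _ : Fin r => hyperbolicPlane F

/-- Two (nondegenerate) quadratic forms have the same class in the Witt group if they become
isometric after adding hyperbolic planes to each of them. -/
def WittEquivalent {F : Type*} [Field F] {V W : Type*} [AddCommGroup V] [Module F V]
    [AddCommGroup W] [Module F W] (q : QuadraticForm F V) (q' : QuadraticForm F W) : Prop :=
  ∃ r s : ℕ, QuadraticMap.Equivalent
    (QuadraticMap.prod q (hyperbolicSum F r)) (QuadraticMap.prod q' (hyperbolicSum F s))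

/-- The anisotropic dimension of a quadratic form: the dimension of its anisotropic kernel, that
is, of an anisotropic form in its Witt class (this dimension is unique for nondegenerate forms). -/
def anisotropicDim {F : Type*} [Field F] {V : Type*} [AddCommGroup V] [Module F V]
    (q : QuadraticForm F V) : ℕ :=
  sInf {d : ℕ | ∃ q₀ : QuadraticForm F (Fin d → F), q₀.Anisotropic ∧ WittEquivalent q q₀}

/-- Nondegenerate quadratic forms of degree `m`. -/
def NondegForm (F : Type*) [Field F] (m : ℕ) : Type _ :=
  {Q : QuadraticForm F (Fin m → F) // Q.polarBilin.Nondegenerate}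

/-- Isometry of nondegenerate quadratic forms of degree `m`. -/
def isometrySetoid (F : Type*) [Field F] (m : ℕ) : Setoid (NondegForm F m) where
  r Q Q' := QuadraticMap.Equivalent Q.1 Q'.1
  iseqv := ⟨fun Q => QuadraticMap.Equivalent.refl Q.1, fun h => h.symm, fun h h' => h.trans h'⟩

/-- Isometry classes of nondegenerate quadratic forms of degree `m`. -/
def QuadFormClass (F : Type*) [Field F] (m : ℕ) : Type _ :=
  Quotient (isometrySetoid F m)

/-! ### Partitions -/

/-- The partitions of `n` in which even parts occur with even multiplicity. -/
def orthogonalPartitions (n : ℕ) : Set n.Partition :=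
  {lam | ∀ i ∈ lam.parts, Even i → Even (lam.parts.count i)}

/-- The finite set of distinct odd parts of a partition. -/
def oddParts {n : ℕ} (lam : n.Partition) : Finset ℕ :=
  lam.parts.toFinset.filter fun j => Odd j

/-- The number of distinct odd parts of multiplicity exactly `i`. -/
def numOddParts {n : ℕ} (lam : n.Partition) (i : ℕ) : ℕ :=
  ((oddParts lam).filter fun j => lam.parts.count j = i).card

/-- Isometry classes of tuples of nondegenerate quadratic forms, indexed by the distinct odd parts
of the partition, the degree of each form being the multiplicity of the part.  If there is no odd
part, the only member is the empty tuple, whose sum is the zero class. -/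
def FormTuples (F : Type*) [Field F] {n : ℕ} (lam : n.Partition) : Type _ :=
  (j : oddParts lam) → QuadFormClass F (lam.parts.count (j : ℕ))

/-- The tuples of quadratic forms whose orthogonal sum has the Witt class of `q`. -/
def representingTuples {F : Type*} [Field F] {V : Type*} [AddCommGroup V] [Module F V]
    (q : QuadraticForm F V) {n : ℕ} (lam : n.Partition) : Set (FormTuples F lam) :=
  {t | ∃ f : (j : oddParts lam) → NondegForm F (lam.parts.count (j : ℕ)),
    (∀ j, Quotient.mk (isometrySetoid F _) (f j) = t j) ∧
      WittEquivalent (QuadraticMap.pi fun j => (f j).1) q}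

/-! ### Orthogonal groups, adjoint orbits and Jordan types -/

/-- The isometry group of a bilinear form. -/
def orthGroup {F W : Type*} [Field F] [AddCommGroup W] [Module F W]
    (B : LinearMap.BilinForm F W) : Subgroup (W ≃ₗ[F] W) where
  carrier := {g | ∀ u v, B (g u) (g v) = B u v}
  one_mem' := fun _ _ => rfl
  mul_mem' := fun {g h} hg hh u v => (hg (h u) (h v)).trans (hh u v)
  inv_mem' := fun {g} hg u v => by
    have h := hg (g.symm u) (g.symm v)
    rw [LinearEquiv.apply_symm_apply, LinearEquiv.apply_symm_apply] at h
    exact h.symm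

/-- The isometries of determinant one. -/
def specialOrthGroup {F W : Type*} [Field F] [AddCommGroup W] [Module F W]
    (B : LinearMap.BilinForm F W) : Subgroup (W ≃ₗ[F] W) :=
  orthGroup B ⊓ (LinearEquiv.det : (W ≃ₗ[F] W) →* Fˣ).ker

/-- The adjoint orbit `{g X g⁻¹ | g ∈ G}`. -/
def adjointOrbit {F W : Type*} [Field F] [AddCommGroup W] [Module F W]
    (G : Subgroup (W ≃ₗ[F] W)) (X : Module.End F W) : Set (Module.End F W) :=
  {Y | ∃ g ∈ G, Y = g.conj X}

/-- The set of adjoint `G`-orbits of the elements of `S`. -/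
def adjointOrbits {F W : Type*} [Field F] [AddCommGroup W] [Module F W]
    (G : Subgroup (W ≃ₗ[F] W)) (S : Set (Module.End F W)) : Set (Set (Module.End F W)) :=
  adjointOrbit G '' S

/-- `X` is nilpotent with Jordan blocks of sizes the parts of `lam`: there is a basis that consists
of one string `w, X w, …, X ^ (i - 1) w`, with `X ^ i w = 0`, for each part `i` of `lam`, counted
with multiplicity. -/
def HasJordanType {F W : Type*} [Field F] [AddCommGroup W] [Module F W]
    (X : Module.End F W) {n : ℕ} (lam : n.Partition) : Prop :=
  ∃ b : Module.Basis ((p : lam.parts.ToType) × Fin p.1) F W,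
    ∀ (p : lam.parts.ToType) (j : Fin p.1),
      X (b ⟨p, j⟩) = if h : (j : ℕ) + 1 < p.1 then b ⟨p, ⟨(j : ℕ) + 1, h⟩⟩ else 0

/-- The extension of the bilinear form of `q` to the algebraic closure. -/
def geometricForm {k V : Type*} [Field k] [AddCommGroup V] [Module k V]
    (q : QuadraticForm k V) :
    LinearMap.BilinForm (AlgebraicClosure k) (AlgebraicClosure k ⊗[k] V) :=
  LinearMap.BilinForm.baseChange (AlgebraicClosure k) q.polarBilin

/-- The algebraic nilpotent adjoint orbit of the orthogonal group attached to `lam`: the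
nilpotent elements of Jordan type `lam` in the orthogonal Lie algebra over the algebraic closure. -/
def geometricOrbit {k V : Type*} [Field k] [AddCommGroup V] [Module k V]
    (q : QuadraticForm k V) {n : ℕ} (lam : n.Partition) :
    Set (Module.End (AlgebraicClosure k) (AlgebraicClosure k ⊗[k] V)) :=
  {Z | Z ∈ skewAdjointLieSubalgebra (geometricForm q) ∧ HasJordanType Z lam}

/-- The set of rational points of the algebraic orbit attached to `lam`. -/
def rationalPoints {k V : Type*} [Field k] [AddCommGroup V] [Module k V]
    (q : QuadraticForm k V) {n : ℕ} (lam : n.Partition) : Set (Module.End k V) :=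
  {X | X ∈ skewAdjointLieSubalgebra q.polarBilin ∧
    LinearMap.baseChange (AlgebraicClosure k) X ∈ geometricOrbit q lam}

/-- The largest Coxeter number of a component of the root system of the special orthogonal group
in dimension `n` (zero if the root system is empty). -/
def orthCoxeterNumber (n : ℕ) : ℕ := if Odd n then n - 1 else n - 2

/-! ### The counting function -/

/-- The correction term in the counting function. -/
def orbitEpsilon (d b : ℕ) : ℚ :=
  if (d = 0 ∧ Even b) ∨ (d = 4 ∧ Odd b) then (-1) ^ b else 0

/-- The number `N_{a,b,c}` attached to a Witt class of anisotropic dimension `d`. -/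
def orbitCount (a b c d : ℕ) : ℚ :=
  if 1 ≤ c then 1 / 8 * 4 ^ a * 7 ^ b * 8 ^ c
  else if 0 < a then 1 / 8 * 4 ^ a * 7 ^ b + (2 - (d : ℚ)) * 2 ^ ((a : ℤ) - 2)
  else (round ((1 / 8 : ℚ) * 7 ^ b) : ℚ) + orbitEpsilon d b

end

/-!
Nilpotent orbits of orthogonal groups over a local field are counted by reducing them to tuples of
quadratic forms, and the tuples by a computation in the Witt group.

*Strings.* Let `B` be the polar form of `q` and `X` a nilpotent skew-adjoint endomorphism. If the
characteristic is not `2`, the space is an orthogonal sum of subspaces on which `X` consists of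
strings `u, X u, …, X ^ (j - 1) u` of one length `j`, where only opposite members of the strings
pair nontrivially (`exists_stringDecomp`, `exists_stringFrame`). The heads are made orthogonal by
successive corrections in which only division by `2` occurs, so that no Jacobson-Morozov triple,
and hence no bound on the characteristic, is needed. The pairing `B u (X ^ (j - 1) v)` on the heads
is alternating for even `j`, so that all choices are isometric (`exists_isometry_of_skew`); for odd
`j` it is, up to sign, the polar form of the form `midForm` that `q` induces on the middles of the
strings. These forms are well defined up to isometry and classify the conjugacy classes of `X` of
given type under the orthogonal group (`StringFrame.exists_isometry_iff`).

*Which forms occur.* The halves of the strings above the middle span an isotropic subspace, and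
only the middles of the strings of odd length survive modulo it; so the Witt class of `q` is the
sum of the classes of the forms on the middles (`StringFrame.wittClass_eq_sum`). Conversely, any
tuple of forms is realized on the explicit space `StringSpace`, and if its sum is the Witt class of
`q`, then this space is isometric to that of `q` by Witt cancellation (`WittEquivalent.equivalent`,
`exists_stringFrame_of_equivalent`). Since the lengths of strings are determined by the ranks of
the powers of `X`, they survive extension of scalars, and the rational points are those `X` over
the base field with strings of the given type (`mem_rationalPoints_iff`). This gives the bijection
between orbits and tuples (`ncard_adjointOrbits`). Over the algebraic closure there is only one
tuple, so that a Jordan type is a single orbit (`exists_geometricOrbit_eq`).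

*Counting.* By Hensel's lemma every form over the local field with uniformizer `π` is a sum of
`Q` and `π Q'` for diagonal forms `Q`, `Q'` with unit coefficients, and such a sum is anisotropic
if the reductions of `Q` and `Q'` are. So the Witt group is the product of two copies of the Witt
group of the residue field, which is `ZMod 4` or `ZMod 2 × ZMod 2`
(`exists_isWittGroupOf_localField`). The classes containing a form of degree `1`, `2` or at least
`3` (and of given parity) number `4`, `7` and `8`; the number of ways of writing a class as a sum
of such classes depends only on its anisotropic dimension and is found by induction on the number
of summands (`tupleCount_eq_orbitCount`, `IsWittGroupOf.ncard_representingTuples`).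

*The special orthogonal group.* An orbit of the orthogonal group stays an orbit of the special
orthogonal group if some isometry of determinant `-1` commutes with `X`, and splits into two
otherwise. If there is a string of odd length, a reflection on the heads is such an isometry
(`StringFrame.exists_commuting_isometry`). If all lengths are even, there is none: a commuting
isometry `g` has determinant `(-1) ^ dim U`, for `U` its generalized eigenspace for `-1`, and `U`
has even dimension, as it is an `X`-stable direct summand and so again has strings of even length
only (`det_eq_one_of_even_strings`). In this case the form is hyperbolic as soon as an orbit
exists, and the single orbit splits (`ncard_adjointOrbits_specialOrthGroup_of_empty`).
-/

open ValuativeRel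
open scoped TensorProduct

noncomputable section


/-! ### Nondegenerate quadratic forms -/

section QuadraticForms

variable {F : Type*} [Field F] {V W V' W' : Type*} [AddCommGroup V] [Module F V]
  [AddCommGroup W] [Module F W] [AddCommGroup V'] [Module F V'] [AddCommGroup W'] [Module F W']

theorem nondegenerate_of_symm {B : LinearMap.BilinForm F V} (hs : ∀ x y, B x y = B y x)
    (h : ∀ x, (∀ y, B x y = 0) → x = 0) : B.Nondegenerate :=
  ⟨fun x hx => h x hx, fun x hx => h x fun y => (hs x y).trans (hx y)⟩

theorem QuadraticMap.nondegenerate_iff (Q : QuadraticForm F V) :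
    Q.polarBilin.Nondegenerate ↔ ∀ x, (∀ y, QuadraticMap.polar Q x y = 0) → x = 0 :=
  ⟨fun h x hx => h.1 x hx,
    nondegenerate_of_symm (B := Q.polarBilin) fun x y => QuadraticMap.polar_comm Q x y⟩

theorem polar_of_isometry {Q : QuadraticForm F V} {Q' : QuadraticForm F W} (f : V →ₗ[F] W)
    (h : ∀ x, Q' (f x) = Q x) (x y : V) :
    QuadraticMap.polar Q' (f x) (f y) = QuadraticMap.polar Q x y := by
  simp only [QuadraticMap.polar, ← map_add, h]

theorem QuadraticMap.Equivalent.nondegenerate {Q : QuadraticForm F V} {Q' : QuadraticForm F W}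
    (e : Q.Equivalent Q') (h : Q.polarBilin.Nondegenerate) : Q'.polarBilin.Nondegenerate := by
  obtain ⟨e⟩ := e
  rw [QuadraticMap.nondegenerate_iff] at h ⊢
  intro x hx
  have := h (e.symm x) fun y => by
    rw [← hx (e y), ← polar_of_isometry (Q' := Q') e.toLinearEquiv.toLinearMap e.map_app]
    congr 1
    exact e.apply_symm_apply x
  rw [← e.apply_symm_apply x, this]
  exact e.toLinearEquiv.map_zero

theorem QuadraticMap.Equivalent.finrank_eq {Q : QuadraticForm F V} {Q' : QuadraticForm F W}
    (e : Q.Equivalent Q') : Module.finrank F V = Module.finrank F W :=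
  e.elim fun e => e.toLinearEquiv.finrank_eq

theorem nondegenerate_prod_iff {Q : QuadraticForm F V} {Q' : QuadraticForm F W} :
    (QuadraticMap.prod Q Q').polarBilin.Nondegenerate ↔
      Q.polarBilin.Nondegenerate ∧ Q'.polarBilin.Nondegenerate := by
  simp only [QuadraticMap.nondegenerate_iff, QuadraticMap.polar_prod]
  constructor
  · intro h
    refine ⟨fun x hx => ?_, fun x hx => ?_⟩
    · have := h (x, 0) fun y => by simp [hx]
      simpa using this
    · have := h (0, x) fun y => by simp [hx]
      simpa using this
  · rintro ⟨h, h'⟩ ⟨x, x'⟩ hx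
    ext
    · exact h x fun y => by simpa using hx (y, 0)
    · exact h' x' fun y => by simpa using hx (0, y)

theorem nondegenerate_pi {ι : Type*} [Fintype ι] {M : ι → Type*} [∀ i, AddCommGroup (M i)]
    [∀ i, Module F (M i)] {Q : ∀ i, QuadraticForm F (M i)}
    (h : ∀ i, (Q i).polarBilin.Nondegenerate) : (QuadraticMap.pi Q).polarBilin.Nondegenerate := by
  classical
  simp only [QuadraticMap.nondegenerate_iff] at h ⊢
  intro x hx
  ext i
  refine h i (x i) fun y => ?_
  have := hx (Pi.single i y)
  rw [QuadraticMap.Ring.polar_pi, Finset.sum_eq_single i] at this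
  · simpa using this
  · intro j _ hj
    simp [Pi.single_eq_of_ne hj]
  · simp

theorem nondegenerate_neg {Q : QuadraticForm F V} (h : Q.polarBilin.Nondegenerate) :
    (-Q).polarBilin.Nondegenerate := by
  rw [QuadraticMap.nondegenerate_iff] at h ⊢
  intro x hx
  refine h x fun y => ?_
  have := hx y
  rw [FunLike.coe_neg, QuadraticMap.polar_neg] at this
  simpa using this

theorem nondegenerate_hyperbolicPlane : (hyperbolicPlane F).polarBilin.Nondegenerate := by
  rw [QuadraticMap.nondegenerate_iff]
  rintro ⟨x, y⟩ h
  have h1 := h (0, 1)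
  have h2 := h (1, 0)
  simp [hyperbolicPlane, QuadraticMap.polar] at h1 h2
  ring_nf at h1 h2
  simp [h1, h2]

theorem nondegenerate_hyperbolicSum (r : ℕ) : (hyperbolicSum F r).polarBilin.Nondegenerate :=
  nondegenerate_pi fun _ => nondegenerate_hyperbolicPlane

theorem hyperbolicSum_apply (r : ℕ) (x : Fin r → F × F) :
    hyperbolicSum F r x = ∑ i, (x i).1 * (x i).2 := by
  simp [hyperbolicSum, hyperbolicPlane]

/-- An isometric linear map out of a nondegenerate space is injective, hence bijective when the
dimensions agree. -/
theorem equivalent_of_isometry [FiniteDimensional F V] [FiniteDimensional F W]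
    {Q : QuadraticForm F V} {Q' : QuadraticForm F W} (hQ : Q.polarBilin.Nondegenerate)
    (hd : Module.finrank F V = Module.finrank F W) (f : V →ₗ[F] W) (h : ∀ x, Q' (f x) = Q x) :
    Q.Equivalent Q' := by
  have hinj : Function.Injective f := by
    rw [← LinearMap.ker_eq_bot, LinearMap.ker_eq_bot']
    intro x hx
    refine (QuadraticMap.nondegenerate_iff Q).1 hQ x fun y => ?_
    rw [← polar_of_isometry f h, hx, QuadraticMap.polar_zero_left]
  exact ⟨⟨LinearEquiv.ofInjectiveOfFinrankEq f hinj hd, h⟩⟩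

/-- A nondegenerate quadratic space with a totally isotropic subspace of half the dimension is
hyperbolic. -/
theorem equivalent_hyperbolicSum_of_lagrangian (h2 : (2 : F) ≠ 0) [FiniteDimensional F V]
    {Q : QuadraticForm F V} (hQ : Q.polarBilin.Nondegenerate) (L : Submodule F V)
    (hL : ∀ x ∈ L, Q x = 0) (hd : 2 * Module.finrank F L = Module.finrank F V) :
    Q.Equivalent (hyperbolicSum F (Module.finrank F L)) := by
  obtain ⟨C, hC⟩ := L.exists_isCompl
  have hLL : ∀ x ∈ L, ∀ y ∈ L, QuadraticMap.polar Q x y = 0 := fun x hx y hy => by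
    simp [QuadraticMap.polar, hL x hx, hL y hy, hL _ (L.add_mem hx hy)]
  have hCd : Module.finrank F C = Module.finrank F L := by
    have := Submodule.finrank_add_eq_of_isCompl hC
    omega
  -- the polar form puts `L` in duality with the complement `C`
  let φ : L →ₗ[F] Module.Dual F C := (Q.polarBilin.domRestrict₁₂ L C)
  have hφ : ∀ (l : L) (c : C), φ l c = QuadraticMap.polar Q l c := fun l c => rfl
  have hφi : Function.Injective φ := by
    rw [← LinearMap.ker_eq_bot, LinearMap.ker_eq_bot']
    intro l hl
    ext
    refine (QuadraticMap.nondegenerate_iff Q).1 hQ l fun y => ?_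
    obtain ⟨a, b, ha, hb, rfl⟩ := Submodule.codisjoint_iff_exists_add_eq.1 hC.codisjoint y
    rw [QuadraticMap.polar_add_right, hLL _ l.2 _ ha, ← hφ l ⟨b, hb⟩, hl]
    simp
  let e : L ≃ₗ[F] Module.Dual F C := LinearEquiv.ofInjectiveOfFinrankEq φ hφi
    (by rw [Subspace.dual_finrank_eq, hCd])
  have he : ∀ (l : Module.Dual F C) (c : C), QuadraticMap.polar Q (e.symm l) c = l c :=
    fun l c => by
      rw [← hφ]
      exact congrArg (fun f : Module.Dual F C => f c) (e.apply_symm_apply l)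
  -- shearing `C` along `L` makes it isotropic
  let s : C →ₗ[F] L := e.symm.toLinearMap ∘ₗ ((2 : F)⁻¹ • Q.polarBilin.domRestrict₁₂ C C)
  have hs : ∀ c c' : C, QuadraticMap.polar Q (s c) c' = 2⁻¹ * QuadraticMap.polar Q c c' :=
    fun c c' => he _ _
  have hy : ∀ c : C, Q ((c : V) - s c) = 0 := fun c => by
    rw [sub_eq_add_neg, QuadraticMap.map_add Q, QuadraticMap.map_neg, hL _ (s c).2,
      QuadraticMap.polar_neg_right, QuadraticMap.polar_comm, hs, QuadraticMap.polar_self]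
    simp [h2]
  let b := Module.finBasisOfFinrankEq F C hCd
  let f : (Fin (Module.finrank F L) → F × F) →ₗ[F] V :=
    (L.subtype ∘ₗ e.symm.toLinearMap ∘ₗ b.dualBasis.equivFun.symm.toLinearMap) ∘ₗ
        LinearMap.pi (fun i => LinearMap.fst F F F ∘ₗ LinearMap.proj i) +
      ((C.subtype - L.subtype ∘ₗ s) ∘ₗ b.equivFun.symm.toLinearMap) ∘ₗ
        LinearMap.pi (fun i => LinearMap.snd F F F ∘ₗ LinearMap.proj i)
  refine (equivalent_of_isometry (nondegenerate_hyperbolicSum _) ?_ f ?_).symm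
  · rw [← hd, Module.finrank_pi_fintype]
    simp [mul_comm]
  · intro x
    set l := b.dualBasis.equivFun.symm fun i => (x i).1 with hl
    set c := b.equivFun.symm fun i => (x i).2 with hc
    have hfx : f x = (e.symm l : V) + ((c : V) - s c) := rfl
    rw [hfx, QuadraticMap.map_add Q, hL _ (e.symm l).2, hy, QuadraticMap.polar_sub_right, he,
      hLL _ (e.symm l).2 _ (s c).2, hyperbolicSum_apply, hl, Module.Basis.equivFun_symm_apply]
    simp [hc, Finsupp.single_apply, mul_comm]

end QuadraticForms


/-! ### Witt cancellation and Witt equivalence -/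

section WittEquivalence

variable {F : Type*} [Field F] {V W V' W' : Type*} [AddCommGroup V] [Module F V]
  [AddCommGroup W] [Module F W] [AddCommGroup V'] [Module F V'] [AddCommGroup W'] [Module F W']

/-- The diagonal of `V × V` is a Lagrangian subspace for `Q ⊥ -Q`, so this form is hyperbolic. -/
theorem equivalent_prod_neg (h2 : (2 : F) ≠ 0) [FiniteDimensional F V] {Q : QuadraticForm F V}
    (hQ : Q.polarBilin.Nondegenerate) :
    (QuadraticMap.prod Q (-Q)).Equivalent (hyperbolicSum F (Module.finrank F V)) := by
  -- the diagonal is a Lagrangian subspace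
  have hd : Module.finrank F (LinearMap.range (LinearMap.id.prod LinearMap.id : V →ₗ[F] V × V)) =
      Module.finrank F V :=
    LinearMap.finrank_range_of_inj fun x y h => congrArg Prod.fst h
  have := equivalent_hyperbolicSum_of_lagrangian h2
    (nondegenerate_prod_iff.2 ⟨hQ, nondegenerate_neg hQ⟩) (LinearMap.range
      (LinearMap.id.prod LinearMap.id : V →ₗ[F] V × V)) (by rintro _ ⟨x, rfl⟩; simp)
      (by rw [hd, Module.finrank_prod, two_mul])
  rwa [hd] at this

/-- Isometries act transitively on the vectors of a given nonzero norm. -/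
theorem exists_isometryEquiv_apply_eq (h2 : (2 : F) ≠ 0) (Q : QuadraticForm F V) {x y : V}
    (hxy : Q x = Q y) (hx : Q x ≠ 0) : ∃ σ : Q.IsometryEquiv Q, σ x = y := by
  have key : ∀ v, Q v ≠ 0 → ∃ σ : Q.IsometryEquiv Q, ∀ z,
      σ z = z - (QuadraticMap.polar Q z v / Q v) • v := by
    intro v hv
    let τ : V →ₗ[F] V := LinearMap.id - (((Q v)⁻¹ • Q.polarBilin.flip v).smulRight v)
    have hτ : ∀ z, τ z = z - (QuadraticMap.polar Q z v / Q v) • v := fun z => by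
      simp [τ, div_eq_inv_mul]
    have hinv : Function.Involutive τ := fun z => by
      rw [hτ (τ z), hτ z, QuadraticMap.polar_sub_left, QuadraticMap.polar_smul_left,
        QuadraticMap.polar_self, sub_sub, ← add_smul]
      convert sub_zero z
      convert zero_smul F v
      simp only [smul_eq_mul, nsmul_eq_mul]
      field_simp
      ring
    refine ⟨⟨LinearEquiv.ofInvolutive τ hinv, fun z => ?_⟩, hτ⟩
    change Q (τ z) = Q z
    rw [hτ, sub_eq_add_neg, QuadraticMap.map_add Q, QuadraticMap.map_neg,
      QuadraticMap.polar_neg_right, QuadraticMap.polar_smul_right, QuadraticMap.map_smul]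
    simp only [smul_eq_mul]
    field_simp
    ring
  have hsub : Q (x - y) = 2 * Q x - QuadraticMap.polar Q x y := by
    rw [sub_eq_add_neg, QuadraticMap.map_add Q, QuadraticMap.map_neg,
      QuadraticMap.polar_neg_right, ← hxy]
    ring
  have hadd : Q (x + y) = 2 * Q x + QuadraticMap.polar Q x y := by
    rw [QuadraticMap.map_add Q, ← hxy]
    ring
  by_cases h : Q (x - y) = 0
  · have h4 : Q (x + y) ≠ 0 := by
      have : Q (x + y) = 2 * 2 * Q x := by linear_combination hadd + hsub - h
      rw [this]
      exact mul_ne_zero (mul_ne_zero h2 h2) hx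
    obtain ⟨σ, hσ⟩ := key _ h4
    refine ⟨σ.trans ⟨LinearEquiv.neg F, fun z => QuadraticMap.map_neg Q z⟩, ?_⟩
    change -(σ x) = y
    rw [hσ, QuadraticMap.polar_add_right, QuadraticMap.polar_self, two_nsmul, ← two_mul, ← hadd,
      div_self h4]
    simp
  · obtain ⟨σ, hσ⟩ := key _ h
    refine ⟨σ, ?_⟩
    rw [hσ, QuadraticMap.polar_sub_right, QuadraticMap.polar_self, two_nsmul, ← two_mul, ← hsub,
      div_self h]
    simp

/-- An isometry fixing the last basis vector preserves its orthogonal complement; this is the step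
from a transitive action of the isometry group to Witt cancellation. -/
theorem snd_eq_zero_of_isometry (h2 : (2 : F) ≠ 0) {a : F} (ha : a ≠ 0)
    {Q : QuadraticForm F V} {Q' : QuadraticForm F W}
    (e : (QuadraticMap.prod Q (a • QuadraticMap.sq (R := F))).IsometryEquiv
      (QuadraticMap.prod Q' (a • QuadraticMap.sq))) (he : e (0, 1) = (0, 1)) (v : V) :
    (e (v, 0)).2 = 0 := by
  have := polar_of_isometry e.toLinearEquiv.toLinearMap e.map_app (v, 0) (0, 1)
  change QuadraticMap.polar _ (e (v, 0)) (e (0, 1)) = _ at this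
  rw [he, QuadraticMap.polar_prod, QuadraticMap.polar_prod] at this
  simp [QuadraticMap.polar] at this
  have h' : 2 * a * (e (v, 0)).2 = 0 := by linear_combination this
  simpa [h2, ha] using h'

/-- Witt cancellation of a form of degree one. -/
theorem equivalent_of_prod_smul_sq (h2 : (2 : F) ≠ 0) {a : F} (ha : a ≠ 0)
    {Q : QuadraticForm F V} {Q' : QuadraticForm F W}
    (h : (QuadraticMap.prod Q (a • QuadraticMap.sq)).Equivalent
      (QuadraticMap.prod Q' (a • QuadraticMap.sq))) : Q.Equivalent Q' := by
  obtain ⟨g⟩ := h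
  obtain ⟨σ, hσ⟩ := exists_isometryEquiv_apply_eq h2 (QuadraticMap.prod Q' (a • QuadraticMap.sq))
    (x := g (0, 1)) (y := (0, 1)) (by rw [g.map_app]; simp) (by rw [g.map_app]; simpa using ha)
  set e := g.trans σ with he
  have he1 : e (0, 1) = (0, 1) := hσ
  have hes : e.symm (0, 1) = (0, 1) := by rw [← he1]; exact e.symm_apply_apply _
  -- an isometry fixing the last coordinate vector preserves its orthogonal complement
  have h1 := snd_eq_zero_of_isometry h2 ha e he1
  have h3 := snd_eq_zero_of_isometry h2 ha e.symm hes
  have e1 : ∀ v, e (v, 0) = ((e (v, 0)).1, 0) := fun v => Prod.ext rfl (h1 v)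
  have e3 : ∀ v, e.symm (v, 0) = ((e.symm (v, 0)).1, 0) := fun v => Prod.ext rfl (h3 v)
  refine ⟨⟨LinearEquiv.ofLinearMap
    (LinearMap.fst F W F ∘ₗ e.toLinearEquiv.toLinearMap ∘ₗ LinearMap.inl F V F)
    (LinearMap.fst F V F ∘ₗ e.symm.toLinearEquiv.toLinearMap ∘ₗ LinearMap.inl F W F)
    ?_ ?_, fun v => ?_⟩⟩
  · ext w
    change (e ((e.symm (w, 0)).1, 0)).1 = w
    rw [← e3, e.apply_symm_apply]
  · ext w
    change (e.symm ((e (w, 0)).1, 0)).1 = w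
    rw [← e1, e.symm_apply_apply]
  · change Q' (e (v, 0)).1 = Q v
    have := e.map_app (v, 0)
    rw [e1] at this
    simpa using this

/-- The orthogonal sum of quadratic maps is associative. -/
def isometryEquivProdAssoc (Q : QuadraticForm F V) (Q' : QuadraticForm F W)
    (Q'' : QuadraticForm F V') : (QuadraticMap.prod (QuadraticMap.prod Q Q') Q'').IsometryEquiv
      (QuadraticMap.prod Q (QuadraticMap.prod Q' Q'')) where
  toLinearEquiv := LinearEquiv.prodAssoc F V W V'
  map_app' x := by simp [add_assoc]

theorem hyperbolicPlane_equivalent (h2 : (2 : F) ≠ 0) :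
    (hyperbolicPlane F).Equivalent
      (QuadraticMap.prod ((1 : F) • QuadraticMap.sq) ((-1 : F) • QuadraticMap.sq)) := by
  symm
  refine equivalent_of_isometry ?_ rfl ((LinearMap.fst F F F + LinearMap.snd F F F).prod
    (LinearMap.fst F F F - LinearMap.snd F F F)) ?_
  · rw [QuadraticMap.nondegenerate_iff]
    rintro ⟨x, y⟩ h
    have h1 := h (0, 1)
    have h3 := h (1, 0)
    simp [QuadraticMap.polar] at h1 h3
    have e1 : 2 * x = 0 := by linear_combination h3
    have e2 : 2 * y = 0 := by linear_combination -h1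
    simp [h2] at e1 e2
    simp [e1, e2]
  · rintro ⟨x, y⟩
    simp [hyperbolicPlane]
    ring

theorem hyperbolicSum_add (r s : ℕ) :
    (QuadraticMap.prod (hyperbolicSum F r) (hyperbolicSum F s)).Equivalent
      (hyperbolicSum F (r + s)) := by
  refine equivalent_of_isometry (nondegenerate_prod_iff.2
    ⟨nondegenerate_hyperbolicSum r, nondegenerate_hyperbolicSum s⟩) ?_
    ((LinearEquiv.funCongrLeft F (F × F) finSumFinEquiv.symm).toLinearMap ∘ₗ
      (LinearEquiv.sumArrowLequivProdArrow (Fin r) (Fin s) F (F × F)).symm.toLinearMap) ?_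
  · simp [Module.finrank_pi_fintype, add_mul]
  · rintro ⟨x, y⟩
    simp [hyperbolicSum_apply, Fin.sum_univ_add, LinearEquiv.funCongrLeft_apply,
      LinearMap.funLeft_apply]

theorem hyperbolicSum_one : (hyperbolicSum F 1).Equivalent (hyperbolicPlane F) :=
  ⟨⟨LinearEquiv.funUnique (Fin 1) F (F × F), fun x => by
    simp [hyperbolicSum_apply, hyperbolicPlane]⟩⟩

theorem equivalent_prod_hyperbolicSum_zero (Q : QuadraticForm F V) :
    (QuadraticMap.prod Q (hyperbolicSum F 0)).Equivalent Q :=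
  ⟨⟨LinearEquiv.prodUnique, fun x => by simp [hyperbolicSum_apply]⟩⟩

theorem prod_hyperbolicSum_add (Q : QuadraticForm F V) (r s : ℕ) :
    (QuadraticMap.prod Q (hyperbolicSum F (r + s))).Equivalent
      (QuadraticMap.prod (QuadraticMap.prod Q (hyperbolicSum F r)) (hyperbolicSum F s)) :=
  ((QuadraticMap.Equivalent.refl Q).prod (hyperbolicSum_add r s).symm).trans
    ⟨(isometryEquivProdAssoc _ _ _).symm⟩

theorem prod_hyperbolicSum_succ (h2 : (2 : F) ≠ 0) (Q : QuadraticForm F V) (r : ℕ) :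
    (QuadraticMap.prod Q (hyperbolicSum F (r + 1))).Equivalent
      (QuadraticMap.prod (QuadraticMap.prod (QuadraticMap.prod Q (hyperbolicSum F r))
        ((1 : F) • QuadraticMap.sq)) ((-1 : F) • QuadraticMap.sq)) :=
  (prod_hyperbolicSum_add Q r 1).trans
    ((((QuadraticMap.Equivalent.refl _).prod
      (hyperbolicSum_one.trans (hyperbolicPlane_equivalent h2)))).trans
      ⟨(isometryEquivProdAssoc _ _ _).symm⟩)

/-- Witt cancellation of hyperbolic forms. -/
theorem equivalent_of_prod_hyperbolicSum (h2 : (2 : F) ≠ 0) {Q : QuadraticForm F V}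
    {Q' : QuadraticForm F W} (r : ℕ) (h : (QuadraticMap.prod Q (hyperbolicSum F r)).Equivalent
      (QuadraticMap.prod Q' (hyperbolicSum F r))) : Q.Equivalent Q' := by
  induction r with
  | zero =>
    exact (equivalent_prod_hyperbolicSum_zero Q).symm.trans
      (h.trans (equivalent_prod_hyperbolicSum_zero Q'))
  | succ r ih =>
    exact ih (equivalent_of_prod_smul_sq h2 one_ne_zero (equivalent_of_prod_smul_sq h2
      (neg_ne_zero.2 one_ne_zero) ((prod_hyperbolicSum_succ h2 Q r).symm.trans
        (h.trans (prod_hyperbolicSum_succ h2 Q' r)))))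

theorem WittEquivalent.of_equivalent {Q : QuadraticForm F V} {Q' : QuadraticForm F W}
    (h : Q.Equivalent Q') : WittEquivalent Q Q' :=
  ⟨0, 0, h.prod (QuadraticMap.Equivalent.refl _)⟩

theorem WittEquivalent.symm {Q : QuadraticForm F V} {Q' : QuadraticForm F W}
    (h : WittEquivalent Q Q') : WittEquivalent Q' Q := by
  obtain ⟨r, s, h⟩ := h
  exact ⟨s, r, h.symm⟩

theorem WittEquivalent.trans {Q : QuadraticForm F V} {Q' : QuadraticForm F W}
    {Q'' : QuadraticForm F V'} (h : WittEquivalent Q Q') (h' : WittEquivalent Q' Q'') :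
    WittEquivalent Q Q'' := by
  obtain ⟨r, s, h⟩ := h
  obtain ⟨r', s', h'⟩ := h'
  refine ⟨r + r', s' + s, (prod_hyperbolicSum_add _ _ _).trans
    ((h.prod (QuadraticMap.Equivalent.refl _)).trans ?_)⟩
  refine (prod_hyperbolicSum_add _ _ _).symm.trans ?_
  rw [add_comm s r']
  exact (prod_hyperbolicSum_add _ _ _).trans
    ((h'.prod (QuadraticMap.Equivalent.refl _)).trans (prod_hyperbolicSum_add _ _ _).symm)

theorem prod_prod_hyperbolicSum_add (Q : QuadraticForm F V) (R : QuadraticForm F W) (r r' : ℕ) :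
    (QuadraticMap.prod (QuadraticMap.prod Q R) (hyperbolicSum F (r + r'))).Equivalent
      (QuadraticMap.prod (QuadraticMap.prod Q (hyperbolicSum F r))
        (QuadraticMap.prod R (hyperbolicSum F r'))) :=
  ((QuadraticMap.Equivalent.refl _).prod (hyperbolicSum_add r r').symm).trans
    ⟨QuadraticMap.IsometryEquiv.prodProdProdComm _ _ _ _⟩

theorem WittEquivalent.prod {Q : QuadraticForm F V} {Q' : QuadraticForm F W}
    {R : QuadraticForm F V'} {R' : QuadraticForm F W'} (h : WittEquivalent Q Q')
    (h' : WittEquivalent R R') : WittEquivalent (QuadraticMap.prod Q R)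
      (QuadraticMap.prod Q' R') := by
  obtain ⟨r, s, h⟩ := h
  obtain ⟨r', s', h'⟩ := h'
  exact ⟨r + r', s + s', (prod_prod_hyperbolicSum_add _ _ _ _).trans
    ((h.prod h').trans (prod_prod_hyperbolicSum_add _ _ _ _).symm)⟩

theorem wittEquivalent_hyperbolicSum_zero (r : ℕ) :
    WittEquivalent (hyperbolicSum F r) (hyperbolicSum F 0) :=
  ⟨0, r, (hyperbolicSum_add r 0).trans
    ((by rw [add_comm] : (hyperbolicSum F (r + 0)).Equivalent (hyperbolicSum F (0 + r))).trans
      (hyperbolicSum_add 0 r).symm)⟩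

/-- Of two Witt equivalent forms, one is obtained from the other by adding hyperbolic planes. -/
theorem WittEquivalent.exists_equivalent_prod (h2 : (2 : F) ≠ 0) [FiniteDimensional F V]
    [FiniteDimensional F W] {Q : QuadraticForm F V} {Q' : QuadraticForm F W}
    (h : WittEquivalent Q Q') :
    (∃ r, (QuadraticMap.prod Q (hyperbolicSum F r)).Equivalent Q') ∨
      ∃ r, Q.Equivalent (QuadraticMap.prod Q' (hyperbolicSum F r)) := by
  obtain ⟨r, s, h⟩ := h
  rcases le_total r s with hrs | hrs
  · obtain ⟨t, rfl⟩ := Nat.exists_eq_add_of_le' hrs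
    exact Or.inr ⟨t, equivalent_of_prod_hyperbolicSum h2 r
      (h.trans (prod_hyperbolicSum_add _ _ _))⟩
  · obtain ⟨t, rfl⟩ := Nat.exists_eq_add_of_le' hrs
    exact Or.inl ⟨t, equivalent_of_prod_hyperbolicSum h2 s
      ((prod_hyperbolicSum_add _ _ _).symm.trans h)⟩

theorem finrank_hyperbolicSum (r : ℕ) : Module.finrank F (Fin r → F × F) = 2 * r := by
  rw [Module.finrank_pi_fintype]
  simp [mul_comm]

/-- Witt equivalent forms of the same degree are isometric. -/
theorem WittEquivalent.equivalent (h2 : (2 : F) ≠ 0) [FiniteDimensional F V]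
    [FiniteDimensional F W] {Q : QuadraticForm F V} {Q' : QuadraticForm F W}
    (h : WittEquivalent Q Q') (hd : Module.finrank F V = Module.finrank F W) :
    Q.Equivalent Q' := by
  rcases h.exists_equivalent_prod h2 with ⟨r, h⟩ | ⟨r, h⟩
  · have := h.finrank_eq
    rw [Module.finrank_prod, finrank_hyperbolicSum] at this
    obtain rfl : r = 0 := by omega
    exact (equivalent_prod_hyperbolicSum_zero Q).symm.trans h
  · have := h.finrank_eq
    rw [Module.finrank_prod, finrank_hyperbolicSum] at this
    obtain rfl : r = 0 := by omega
    exact h.trans (equivalent_prod_hyperbolicSum_zero Q')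

/-- A form that is Witt equivalent to an anisotropic one is the sum of it and hyperbolic planes. -/
theorem WittEquivalent.equivalent_prod_of_anisotropic (h2 : (2 : F) ≠ 0) [FiniteDimensional F V]
    [FiniteDimensional F W] {Q : QuadraticForm F V} {Q' : QuadraticForm F W}
    (h : WittEquivalent Q Q') (ha : Q'.Anisotropic) :
    ∃ r, Q.Equivalent (QuadraticMap.prod Q' (hyperbolicSum F r)) := by
  rcases h.exists_equivalent_prod h2 with ⟨r, h⟩ | h
  · rcases r with - | r
    · exact ⟨0, (equivalent_prod_hyperbolicSum_zero Q).symm.trans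
        (h.trans (equivalent_prod_hyperbolicSum_zero Q').symm)⟩
    · obtain ⟨e⟩ := h
      have h0 := ha (e (0, fun _ => (1, 0))) (by
        rw [e.map_app]
        simp [hyperbolicSum_apply])
      have := congrArg e.symm h0
      rw [e.symm_apply_apply] at this
      have h1 : e.symm 0 = 0 := e.symm.toLinearEquiv.map_zero
      rw [h1] at this
      have h3 := congrFun (congrArg Prod.snd this) 0
      exact absurd (congrArg Prod.fst h3) one_ne_zero
  · exact h

end WittEquivalence


/-! ### The monoid of Witt classes -/

theorem equivalent_comp_equiv {F V W : Type*} [Field F] [AddCommGroup V] [Module F V]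
    [AddCommGroup W] [Module F W] (Q : QuadraticForm F V) (f : W ≃ₗ[F] V) :
    Q.Equivalent (Q.comp f.toLinearMap) :=
  ⟨QuadraticMap.isometryEquivOfCompLinearEquiv Q f⟩

/-- The form `a x ^ 2` of degree one. -/
abbrev unaryForm {F : Type*} [Field F] (a : F) : QuadraticForm F F := a • QuadraticMap.sq

theorem unaryForm_equivalent {F : Type*} [Field F] (a : F) {s : F} (hs : s ≠ 0) :
    (unaryForm (a * s ^ 2)).Equivalent (unaryForm a) :=
  ⟨⟨LinearEquiv.smulOfNeZero F F s hs, fun x => by simp; ring⟩⟩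

section WittMonoid

variable (F : Type*) [Field F]

/-- Witt equivalence of quadratic forms on coordinate spaces. -/
def wittSetoid : Setoid (Σ m : ℕ, QuadraticForm F (Fin m → F)) where
  r Q Q' := WittEquivalent Q.2 Q'.2
  iseqv := ⟨fun _ => .of_equivalent (.refl _), fun h => h.symm, fun h h' => h.trans h'⟩

/-- The commutative monoid of Witt classes of all (possibly degenerate) quadratic forms over `F`,
under orthogonal sum.  The classes of nondegenerate forms make up the Witt group, inside it. -/
def WittMonoid : Type _ := Quotient (wittSetoid F)

variable {F} {V W : Type*} [AddCommGroup V] [Module F V] [FiniteDimensional F V]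
  [AddCommGroup W] [Module F W] [FiniteDimensional F W]

/-- The Witt class of a quadratic form on a finite-dimensional space. -/
def wittClass (Q : QuadraticForm F V) : WittMonoid F :=
  Quotient.mk (wittSetoid F)
    ⟨Module.finrank F V, Q.comp (Module.finBasis F V).equivFun.symm.toLinearMap⟩

theorem wittClass_eq_iff {Q : QuadraticForm F V} {Q' : QuadraticForm F W} :
    wittClass Q = wittClass Q' ↔ WittEquivalent Q Q' := by
  have h : WittEquivalent Q (Q.comp (Module.finBasis F V).equivFun.symm.toLinearMap) :=
    .of_equivalent (equivalent_comp_equiv Q _)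
  have h' : WittEquivalent Q' (Q'.comp (Module.finBasis F W).equivFun.symm.toLinearMap) :=
    .of_equivalent (equivalent_comp_equiv Q' _)
  exact Quotient.eq.trans ⟨fun e => h.trans (.trans e h'.symm),
    fun e => h.symm.trans (e.trans h')⟩

theorem QuadraticMap.Equivalent.wittClass_eq {Q : QuadraticForm F V} {Q' : QuadraticForm F W}
    (h : Q.Equivalent Q') : wittClass Q = wittClass Q' :=
  wittClass_eq_iff.2 (.of_equivalent h)

theorem mk_eq_wittClass (Q : Σ m : ℕ, QuadraticForm F (Fin m → F)) :
    Quotient.mk (wittSetoid F) Q = wittClass Q.2 :=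
  Quotient.sound (.of_equivalent (equivalent_comp_equiv _ _))

instance : Add (WittMonoid F) where
  add := Quotient.lift₂ (fun Q Q' => wittClass (QuadraticMap.prod Q.2 Q'.2))
    fun _ _ _ _ h h' => wittClass_eq_iff.2 (WittEquivalent.prod h h')

instance : Zero (WittMonoid F) where
  zero := wittClass (hyperbolicSum F 0)

theorem wittClass_prod (Q : QuadraticForm F V) (Q' : QuadraticForm F W) :
    wittClass (QuadraticMap.prod Q Q') = wittClass Q + wittClass Q' :=
  wittClass_eq_iff.2 (WittEquivalent.prod (.of_equivalent (equivalent_comp_equiv _ _))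
    (.of_equivalent (equivalent_comp_equiv _ _)))

theorem wittClass_hyperbolicSum (r : ℕ) : wittClass (hyperbolicSum F r) = 0 :=
  wittClass_eq_iff.2 (wittEquivalent_hyperbolicSum_zero r)

theorem exists_wittClass_eq (w : WittMonoid F) :
    ∃ (m : ℕ) (Q : QuadraticForm F (Fin m → F)), wittClass Q = w := by
  induction w using Quotient.inductionOn with
  | h Q => exact ⟨Q.1, Q.2, (mk_eq_wittClass Q).symm⟩

instance : AddCommMonoid (WittMonoid F) where
  add_assoc u v w := by
    obtain ⟨_, Q, rfl⟩ := exists_wittClass_eq u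
    obtain ⟨_, Q', rfl⟩ := exists_wittClass_eq v
    obtain ⟨_, Q'', rfl⟩ := exists_wittClass_eq w
    simp only [← wittClass_prod]
    exact QuadraticMap.Equivalent.wittClass_eq ⟨isometryEquivProdAssoc _ _ _⟩
  zero_add u := by
    obtain ⟨_, Q, rfl⟩ := exists_wittClass_eq u
    refine (wittClass_prod _ _).symm.trans (QuadraticMap.Equivalent.wittClass_eq
      (QuadraticMap.Equivalent.trans ⟨QuadraticMap.IsometryEquiv.prodComm _ _⟩
        (equivalent_prod_hyperbolicSum_zero Q)))
  add_zero u := by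
    obtain ⟨_, Q, rfl⟩ := exists_wittClass_eq u
    exact (wittClass_prod _ _).symm.trans
      (QuadraticMap.Equivalent.wittClass_eq (equivalent_prod_hyperbolicSum_zero Q))
  add_comm u v := by
    obtain ⟨_, Q, rfl⟩ := exists_wittClass_eq u
    obtain ⟨_, Q', rfl⟩ := exists_wittClass_eq v
    simp only [← wittClass_prod]
    exact QuadraticMap.Equivalent.wittClass_eq ⟨QuadraticMap.IsometryEquiv.prodComm _ _⟩
  nsmul := nsmulRec

theorem wittClass_add_neg [NeZero (2 : F)] {Q : QuadraticForm F V}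
    (hQ : Q.polarBilin.Nondegenerate) :
    wittClass Q + wittClass (-Q) = 0 := by
  rw [← wittClass_prod, (equivalent_prod_neg two_ne_zero hQ).wittClass_eq,
    wittClass_hyperbolicSum]

theorem wittClass_of_subsingleton [Subsingleton V] (Q : QuadraticForm F V) : wittClass Q = 0 :=
  QuadraticMap.Equivalent.wittClass_eq ⟨⟨0, fun x => by
    rw [Subsingleton.elim x 0, map_zero]; exact map_zero _⟩⟩

theorem wittClass_pi {ι : Type*} [Fintype ι] {M : ι → Type*} [∀ i, AddCommGroup (M i)]
    [∀ i, Module F (M i)] [∀ i, FiniteDimensional F (M i)] (Q : ∀ i, QuadraticForm F (M i)) :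
    wittClass (QuadraticMap.pi Q) = ∑ i, wittClass (Q i) := by
  classical
  -- split off one summand at a time from the sum over a finite set of indices
  suffices h : ∀ s : Finset ι, wittClass (QuadraticMap.pi fun i : s => Q i) =
      ∑ i ∈ s, wittClass (Q i) by
    rw [← h Finset.univ]
    refine QuadraticMap.Equivalent.wittClass_eq ⟨⟨LinearEquiv.piCongrLeft' F M
      (Equiv.subtypeUnivEquiv (by simp)).symm, fun x => ?_⟩⟩
    simp only [QuadraticMap.pi_apply]
    exact Fintype.sum_equiv (Equiv.subtypeUnivEquiv (by simp)) _ _ fun i => rfl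
  intro s
  induction s using Finset.induction_on with
  | empty => rw [Finset.sum_empty]; exact wittClass_of_subsingleton _
  | insert i s hi ih =>
    rw [Finset.sum_insert hi, ← ih, ← wittClass_prod]
    refine QuadraticMap.Equivalent.wittClass_eq ⟨⟨LinearEquiv.ofBijective
      ((LinearMap.proj (⟨i, Finset.mem_insert_self i s⟩ : (insert i s : Finset ι))).prod
      (LinearMap.pi fun j : s => LinearMap.proj
        (⟨j, Finset.mem_insert_of_mem j.2⟩ : (insert i s : Finset ι)))) ⟨?_, ?_⟩, fun x => ?_⟩⟩
    · intro x y h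
      ext ⟨j, hj⟩
      rcases Finset.mem_insert.1 hj with rfl | hj'
      · exact congrArg Prod.fst h
      · exact congrFun (congrArg Prod.snd h) ⟨j, hj'⟩
    · rintro ⟨x, y⟩
      refine ⟨fun j => if h : j.1 = i then cast (congrArg M h.symm) x else
        y ⟨j.1, (Finset.mem_insert.1 j.2).resolve_left h⟩, Prod.ext (by simp) ?_⟩
      ext ⟨j, hj⟩
      have : j ≠ i := by rintro rfl; exact hi hj
      simp [this]
    · simp only [QuadraticMap.prod_apply, QuadraticMap.pi_apply]
      change Q i (x ⟨i, Finset.mem_insert_self i s⟩) +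
        ∑ j ∈ s.attach, Q j (x ⟨j, Finset.mem_insert_of_mem j.2⟩) =
        ∑ j ∈ (insert i s).attach, Q j (x j)
      rw [Finset.attach_insert, Finset.sum_insert (by simp [hi]), Finset.sum_image]
      exact fun x _ y _ h =>
        Subtype.ext (congrArg (fun z : (insert i s : Finset ι) => z.1) h)

theorem unaryForm_nondegenerate [NeZero (2 : F)] {a : F} (ha : a ≠ 0) :
    (unaryForm a).polarBilin.Nondegenerate := by
  rw [QuadraticMap.nondegenerate_iff]
  intro x hx
  have := hx 1
  simp [QuadraticMap.polar] at this
  have h' : 2 * a * x = 0 := by linear_combination this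
  simpa [ha, two_ne_zero] using h'

theorem wittClass_unaryForm_add_neg [NeZero (2 : F)] {a : F} (ha : a ≠ 0) :
    wittClass (unaryForm a) + wittClass (unaryForm (-a)) = 0 := by
  rw [← wittClass_add_neg (unaryForm_nondegenerate ha)]
  congr 2
  ext
  simp

/-- Every nondegenerate form is an orthogonal sum of forms of degree one. -/
theorem exists_wittClass_eq_sum [NeZero (2 : F)] {Q : QuadraticForm F V}
    (hQ : Q.polarBilin.Nondegenerate) :
    ∃ w : Fin (Module.finrank F V) → F, (∀ i, w i ≠ 0) ∧
      wittClass Q = ∑ i, wittClass (unaryForm (w i)) := by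
  have : Invertible (2 : F) := invertibleOfNonzero two_ne_zero
  obtain ⟨w, hw⟩ := QuadraticForm.equivalent_weightedSumSquares Q
  have hpi : QuadraticMap.weightedSumSquares F w = QuadraticMap.pi fun i => unaryForm (w i) := by
    ext x
    simp [QuadraticMap.weightedSumSquares_apply]
  refine ⟨w, fun i hi => ?_, by rw [hw.wittClass_eq, hpi, wittClass_pi]⟩
  have hnd := hw.nondegenerate hQ
  rw [hpi, QuadraticMap.nondegenerate_iff] at hnd
  have h1 := hnd (Pi.single i 1) fun y => by
    rw [QuadraticMap.Ring.polar_pi]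
    refine Finset.sum_eq_zero fun j _ => ?_
    by_cases hj : j = i
    · subst hj
      simp [hi, QuadraticMap.polar]
    · simp [Pi.single_eq_of_ne hj, QuadraticMap.polar]
  simpa using congrFun h1 i

end WittMonoid


/-! ### Quadratic forms over a henselian discretely valued field -/

section Henselian

open IsLocalRing

variable {O k : Type*} [CommRing O] [Field k] [Algebra O k]

/-- Hensel's lemma for `X ^ 2 - x`. -/
theorem isSquare_of_isSquare_residue [HenselianLocalRing O]
    (h2 : (2 : ResidueField O) ≠ 0) {x : O}
    (hx : IsUnit x) (h : IsSquare (residue O x)) : IsSquare x := by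
  obtain ⟨y, hy⟩ := h
  obtain ⟨a, rfl⟩ := residue_surjective y
  have hx0 : residue O x ≠ 0 := (residue_ne_zero_iff_isUnit x).2 hx
  have ha : residue O a ≠ 0 := by
    rintro h
    rw [h, mul_zero] at hy
    exact hx0 hy
  obtain ⟨b, hb, -⟩ := HenselianLocalRing.is_henselian (Polynomial.X ^ 2 - Polynomial.C x)
    (Polynomial.monic_X_pow_sub_C x two_ne_zero) a
    (by
      rw [← residue_eq_zero_iff]
      simp [hy, pow_two])
    (by
      have h2' : IsUnit (2 : O) := by
        rw [← residue_ne_zero_iff_isUnit, map_ofNat]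
        exact h2
      have := h2'.mul ((residue_ne_zero_iff_isUnit a).1 ha)
      simpa [one_add_one_eq_two] using this)
  refine ⟨b, ?_⟩
  have : b ^ 2 - x = 0 := by simpa using hb
  linear_combination -this

variable (O) in
/-- The nonzero elements of even valuation: the products of a unit and a nonzero square. -/
def EvenVal (x : k) : Prop := ∃ (ε : Oˣ) (s : k), s ≠ 0 ∧ x = algebraMap O k ε * s ^ 2

theorem EvenVal.ne_zero {x : k} (hx : EvenVal O x) : x ≠ 0 := by
  obtain ⟨ε, s, hs, rfl⟩ := hx
  exact mul_ne_zero (ε.isUnit.map _).ne_zero (pow_ne_zero 2 hs)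

theorem EvenVal.neg {x : k} (hx : EvenVal O x) : EvenVal O (-x) := by
  obtain ⟨ε, s, hs, rfl⟩ := hx
  exact ⟨-ε, s, hs, by simp⟩

theorem EvenVal.mul {x y : k} (hx : EvenVal O x) (hy : EvenVal O y) : EvenVal O (x * y) := by
  obtain ⟨ε, s, hs, rfl⟩ := hx
  obtain ⟨ε', s', hs', rfl⟩ := hy
  exact ⟨ε * ε', s * s', mul_ne_zero hs hs', by simp; ring⟩

theorem EvenVal.inv {x : k} (hx : EvenVal O x) : EvenVal O x⁻¹ := by
  obtain ⟨ε, s, hs, rfl⟩ := hx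
  refine ⟨ε⁻¹, s⁻¹, inv_ne_zero hs, ?_⟩
  rw [mul_inv, inv_pow]
  congr 1
  refine inv_eq_of_mul_eq_one_right ?_
  rw [← map_mul, Units.mul_inv, map_one]

theorem evenVal_unit (ε : Oˣ) : EvenVal O (algebraMap O k ε) := ⟨ε, 1, one_ne_zero, by simp⟩

theorem evenVal_sq {s : k} (hs : s ≠ 0) : EvenVal O (s ^ 2) := ⟨1, s, hs, by simp⟩

variable (O) in
/-- A quadratic form all of whose values at nonzero vectors have even valuation; over a residue
field of odd characteristic this means that it is unimodular with anisotropic reduction. -/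
def EvenValued {V : Type*} [AddCommGroup V] [Module k V] (Q : QuadraticForm k V) : Prop :=
  ∀ x, x ≠ 0 → EvenVal O (Q x)

theorem EvenValued.of_equivalent {V W : Type*} [AddCommGroup V] [Module k V] [AddCommGroup W]
    [Module k W] {Q : QuadraticForm k V} {Q' : QuadraticForm k W} (hQ : EvenValued O Q)
    (e : Q.Equivalent Q') : EvenValued O Q' := by
  obtain ⟨e⟩ := e
  intro x hx
  rw [← e.symm.map_app]
  exact hQ _ fun h => hx (by rw [← e.apply_symm_apply x, h]; exact e.toLinearEquiv.map_zero)

theorem evenValued_unaryForm (ε : Oˣ) : EvenValued O (unaryForm (algebraMap O k ε)) := by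
  intro x hx
  simpa [pow_two, Algebra.smul_def] using (evenVal_unit ε).mul (evenVal_sq (O := O) hx)

variable [IsDomain O] [IsDiscreteValuationRing O] [IsFractionRing O k]

/-- A uniformizer has odd valuation: if `π = ε s ^ 2` then `s` is integral, so `π` would be a square
up to a unit in the ring of integers. -/
theorem not_evenVal_irreducible {π : O} (hπ : Irreducible π) :
    ¬ EvenVal O (algebraMap O k π) := by
  rintro ⟨ε, s, hs, h⟩
  have hint : IsIntegral O s := by
    refine IsIntegral.of_pow (n := 2) two_pos ?_
    have : s ^ 2 = algebraMap O k ((ε⁻¹ : Oˣ) * π) := by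
      rw [map_mul, h, ← mul_assoc, ← map_mul, Units.inv_mul, map_one, one_mul]
    rw [this]
    exact isIntegral_algebraMap
  obtain ⟨t, rfl⟩ := IsIntegrallyClosed.isIntegral_iff.1 hint
  have h' : π = ε * t * t := by
    apply IsFractionRing.injective O k
    rw [h]
    simp
    ring
  rcases hπ.isUnit_or_isUnit h' with h1 | h1
  · have ht : IsUnit t := by simpa using h1
    exact hπ.not_isUnit (h' ▸ h1.mul ht)
  · exact hπ.not_isUnit (h' ▸ (ε.isUnit.mul h1).mul h1)

/-- The values of `Q` have even valuation and those of `π • Q'` have odd valuation, so they cannot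
cancel. -/
theorem EvenValued.anisotropic_prod {V W : Type*} [AddCommGroup V] [Module k V] [AddCommGroup W]
    [Module k W] {Q : QuadraticForm k V} {Q' : QuadraticForm k W} (hQ : EvenValued O Q)
    (hQ' : EvenValued O Q') {π : O} (hπ : Irreducible π) :
    (QuadraticMap.prod Q (algebraMap O k π • Q')).Anisotropic := by
  have hπ0 : algebraMap O k π ≠ 0 := by simpa using hπ.ne_zero
  rintro ⟨x, y⟩ h
  simp only [QuadraticMap.prod_apply, smul_apply, smul_eq_mul] at h
  by_cases hx : x = 0
  · subst hx
    by_cases hy : y = 0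
    · rw [hy]; rfl
    · rw [map_zero, zero_add] at h
      exact absurd h (mul_ne_zero hπ0 (hQ' y hy).ne_zero)
  · by_cases hy : y = 0
    · rw [hy, map_zero, mul_zero, add_zero] at h
      exact absurd h (hQ x hx).ne_zero
    · refine absurd ?_ (not_evenVal_irreducible (k := k) hπ)
      have : algebraMap O k π = -(Q x) * (Q' y)⁻¹ := by
        rw [eq_mul_inv_iff_mul_eq₀ (hQ' y hy).ne_zero]
        linear_combination h
      rw [this]
      exact (hQ x hx).neg.mul (hQ' y hy).inv

/-- The norm form of the unramified quadratic extension takes values of even valuation only. -/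
theorem evenVal_sq_sub {u : O} (hu : ¬ IsSquare (residue O u)) (z : k) :
    EvenVal O (z ^ 2 - algebraMap O k u) := by
  rcases ValuationRing.isInteger_or_isInteger O z with ⟨t, rfl⟩ | ⟨t, ht⟩
  · have h : IsUnit (t ^ 2 - u) := by
      rw [← residue_ne_zero_iff_isUnit, map_sub, map_pow, sub_ne_zero]
      exact fun h => hu ⟨residue O t, by rw [← h, pow_two]⟩
    obtain ⟨ε, hε⟩ := h
    rw [← map_pow, ← map_sub, ← hε]
    exact evenVal_unit ε
  · by_cases hz : z = 0
    · have h : IsUnit u := by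
        rw [← residue_ne_zero_iff_isUnit]
        rintro h
        exact hu (h ▸ IsSquare.zero)
      obtain ⟨ε, rfl⟩ := h
      simpa [hz] using (evenVal_unit (k := k) ε).neg
    · by_cases htu : IsUnit t
      · -- then `z` itself is integral
        obtain ⟨ε, rfl⟩ := htu
        have hz' : z = algebraMap O k (ε⁻¹ : Oˣ) := by
          rw [← inv_inv z, ← ht]
          refine inv_eq_of_mul_eq_one_left ?_
          rw [← map_mul, Units.inv_mul, map_one]
        have h : IsUnit ((ε⁻¹ : Oˣ) ^ 2 - u : O) := by
          rw [← residue_ne_zero_iff_isUnit, map_sub, map_pow, sub_ne_zero]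
          exact fun h => hu ⟨residue O (ε⁻¹ : Oˣ), by rw [← h, pow_two]⟩
        obtain ⟨η, hη⟩ := h
        rw [hz', ← map_pow, ← map_sub, ← hη]
        exact evenVal_unit η
      · have h : IsUnit (1 - u * t ^ 2) := by
          rw [← residue_ne_zero_iff_isUnit, map_sub, map_mul, map_pow,
            (residue_eq_zero_iff t).2 ((mem_maximalIdeal t).2 htu)]
          simp
        obtain ⟨ε, hε⟩ := h
        refine ⟨ε, z, hz, ?_⟩
        rw [hε, map_sub, map_mul, map_pow, ht]
        field_simp
        simp

/-- The norm form of the unramified quadratic extension takes values of even valuation. -/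
theorem evenValued_normForm {u : O} (hu : ¬ IsSquare (residue O u)) :
    EvenValued O (QuadraticMap.prod (unaryForm (1 : k)) (unaryForm (-algebraMap O k u))) := by
  rintro ⟨x, y⟩ hxy
  by_cases hy : y = 0
  · have hx : x ≠ 0 := by rintro rfl; exact hxy (by rw [hy]; rfl)
    simpa [hy, pow_two] using evenVal_sq (O := O) hx
  · have := (evenVal_sq_sub hu (x / y)).mul (evenVal_sq (O := O) hy)
    convert this using 1
    simp
    field_simp
    ring

/-- The four square classes. -/
theorem exists_squareClass [HenselianLocalRing O] [Finite (ResidueField O)]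
    (h2 : (2 : ResidueField O) ≠ 0) {u : O}
    (hu : ¬ IsSquare (residue O u)) {π : O} (hπ : Irreducible π) {x : k} (hx : x ≠ 0) :
    ∃ c : k, (c = 1 ∨ c = algebraMap O k π) ∧
      ∃ s : k, s ≠ 0 ∧ (x = c * s ^ 2 ∨ x = c * algebraMap O k u * s ^ 2) := by
  have huu : IsUnit u := by
    rw [← residue_ne_zero_iff_isUnit]
    exact fun h => hu (h ▸ IsSquare.zero)
  -- units
  have hunit : ∀ ε : Oˣ, ∃ s : Oˣ, (ε : O) = s ^ 2 ∨ (ε : O) = u * s ^ 2 := by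
    intro ε
    by_cases hε : IsSquare (residue O ε)
    · obtain ⟨s, hs⟩ := isSquare_of_isSquare_residue h2 ε.isUnit hε
      have : IsUnit s := isUnit_of_mul_isUnit_left (hs ▸ ε.isUnit)
      obtain ⟨s, rfl⟩ := this
      exact ⟨s, Or.inl (by rw [hs, pow_two])⟩
    · obtain ⟨v, rfl⟩ := huu
      have h3 : IsSquare (residue O ((ε * v⁻¹ : Oˣ) : O)) := by
        have := Fintype.ofFinite (ResidueField O)
        classical
        have hv0 := (residue_ne_zero_iff_isUnit (v : O)).2 v.isUnit
        have he0 := (residue_ne_zero_iff_isUnit (ε : O)).2 ε.isUnit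
        have hchar : ringChar (ResidueField O) ≠ 2 := fun h =>
          h2 (by exact_mod_cast (ringChar.spec (ResidueField O) 2).2 (by rw [h]))
        have h1 := (quadraticChar_neg_one_iff_not_isSquare (F := ResidueField O)).2 hu
        have h4 := (quadraticChar_neg_one_iff_not_isSquare (F := ResidueField O)).2 hε
        have h5 : IsSquare (residue O (ε : O) * residue O (v : O)) := by
          rw [← quadraticChar_one_iff_isSquare (mul_ne_zero he0 hv0), map_mul, h1, h4]
          norm_num
        obtain ⟨r, hr⟩ := h5
        have hvi : residue O ((v⁻¹ : Oˣ) : O) = (residue O (v : O))⁻¹ := by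
          refine eq_inv_of_mul_eq_one_left ?_
          rw [← map_mul, Units.inv_mul, map_one]
        refine ⟨r * (residue O (v : O))⁻¹, ?_⟩
        rw [Units.val_mul, map_mul, hvi]
        field_simp
        rw [hr, pow_two]
      obtain ⟨s, hs⟩ := isSquare_of_isSquare_residue h2 (ε * v⁻¹).isUnit h3
      have : IsUnit s := isUnit_of_mul_isUnit_left (hs ▸ (ε * v⁻¹).isUnit)
      obtain ⟨s, rfl⟩ := this
      refine ⟨s, Or.inr ?_⟩
      rw [pow_two, ← hs, Units.val_mul, mul_comm, mul_assoc, Units.inv_mul, mul_one]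
  have hπ0 : algebraMap O k π ≠ 0 := by simpa using hπ.ne_zero
  -- elements are units times powers of the uniformizer
  obtain ⟨ε, n, hn⟩ : ∃ (ε : Oˣ) (n : ℤ), x = algebraMap O k ε * algebraMap O k π ^ n := by
    obtain ⟨a, b, hb, rfl⟩ := IsFractionRing.div_surjective (A := O) x
    have hb0 := nonZeroDivisors.ne_zero hb
    have ha0 : a ≠ 0 := by rintro rfl; simp at hx
    obtain ⟨m, ε, rfl⟩ := IsDiscreteValuationRing.eq_unit_mul_pow_irreducible ha0 hπ
    obtain ⟨m', ε', rfl⟩ := IsDiscreteValuationRing.eq_unit_mul_pow_irreducible hb0 hπ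
    refine ⟨ε * ε'⁻¹, m - m', ?_⟩
    have h1 : algebraMap O k ε' * algebraMap O k (ε'⁻¹ : Oˣ) = 1 := by
      rw [← map_mul, Units.mul_inv, map_one]
    have h0 : algebraMap O k ε' ≠ 0 := left_ne_zero_of_mul_eq_one h1
    rw [zpow_sub₀ hπ0, Units.val_mul, map_mul, map_mul, map_mul, eq_inv_of_mul_eq_one_right h1]
    simp
    field_simp
  obtain ⟨s, hs⟩ := hunit ε
  have hs0 : algebraMap O k s ≠ 0 := (s.isUnit.map _).ne_zero
  rcases Int.even_or_odd' n with ⟨m, rfl | rfl⟩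
  · refine ⟨1, Or.inl rfl, algebraMap O k s * algebraMap O k π ^ m,
      mul_ne_zero hs0 (zpow_ne_zero _ hπ0), ?_⟩
    rw [hn, zpow_mul', zpow_ofNat]
    rcases hs with hs | hs
    · left; rw [hs, map_pow]; ring
    · right; rw [hs, map_mul, map_pow]; ring
  · refine ⟨_, Or.inr rfl, algebraMap O k s * algebraMap O k π ^ m,
      mul_ne_zero hs0 (zpow_ne_zero _ hπ0), ?_⟩
    rw [hn, zpow_add_one₀ hπ0, zpow_mul', zpow_ofNat]
    rcases hs with hs | hs
    · left; rw [hs, map_pow]; ring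
    · right; rw [hs, map_mul, map_pow]; ring

end Henselian


/-! ### Counting tuples of Witt classes -/

section Counting

/-- The Witt classes of anisotropic dimension given by `d` that contain a form of degree `m`. -/
def dimClasses {G : Type} [Fintype G] (d : G → ℕ) (m : ℕ) : Finset G :=
  Finset.univ.filter fun g => d g ≤ m ∧ d g % 2 = m % 2

/-- The properties of the Witt group `G` of a local field with odd residue characteristic, with
`d` the anisotropic dimension, on which the count of tuples depends. -/
structure IsLocalWittGroup (G : Type) [AddCommGroup G] [Fintype G] (d : G → ℕ) : Prop where
  le_four : ∀ w, d w ≤ 4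
  eq_zero : ∀ w, d w = 0 ↔ w = 0
  mod_two : ∀ w g, d (w - g) % 2 = (d w + d g) % 2
  card_one : (dimClasses d 1).card = 4
  card_two : (dimClasses d 2).card = 7
  card_three : (dimClasses d 3).card = 8
  card_four : (dimClasses d 4).card = 8
  sum_one : ∀ w, ∑ g ∈ dimClasses d 1, (2 - (d (w - g) : ℤ)) = 2 * (2 - d w)
  sum_two : ∀ w, ∑ g ∈ dimClasses d 2, (2 - (d (w - g) : ℤ)) = 2 - d w
  sum_three : ∀ w, ∑ g ∈ dimClasses d 3, (2 - (d (w - g) : ℤ)) = 0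
  sum_four : ∀ w, ∑ g ∈ dimClasses d 4, (2 - (d (w - g) : ℤ)) = 0
  zero_one : ∀ w, ((dimClasses d 1).filter fun g => d (w - g) = 0).card =
    if d w = 1 then 1 else 0
  zero_two : ∀ w, ((dimClasses d 2).filter fun g => d (w - g) = 0).card =
    if d w = 0 ∨ d w = 2 then 1 else 0
  zero_three : ∀ w, ((dimClasses d 3).filter fun g => d (w - g) = 0).card =
    if d w % 2 = 1 then 1 else 0
  zero_four : ∀ w, ((dimClasses d 4).filter fun g => d (w - g) = 0).card =
    if d w % 2 = 0 then 1 else 0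
  four_one : ∀ w, ((dimClasses d 1).filter fun g => d (w - g) = 4).card =
    if d w = 3 then 1 else 0
  four_two : ∀ w, ((dimClasses d 2).filter fun g => d (w - g) = 4).card =
    if d w = 2 ∨ d w = 4 then 1 else 0
  four_three : ∀ w, ((dimClasses d 3).filter fun g => d (w - g) = 4).card =
    if d w % 2 = 1 then 1 else 0
  four_four : ∀ w, ((dimClasses d 4).filter fun g => d (w - g) = 4).card =
    if d w % 2 = 0 then 1 else 0

/-- The anisotropic dimension on the Witt group `ZMod 4` of a finite field in which `-1` is not a
square; the class of the form `x ^ 2` is `1`. -/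
def dimFour (g : ZMod 4) : ℕ := if g = 0 then 0 else if g = 2 then 2 else 1

/-- The anisotropic dimension on the Witt group `ZMod 2 × ZMod 2` of a finite field of odd
characteristic in which `-1` is a square; the classes of the forms of degree one are `(1, 0)` and
`(0, 1)`. -/
def dimTwoTwo (g : ZMod 2 × ZMod 2) : ℕ := if g = 0 then 0 else if g = (1, 1) then 2 else 1

/-- The Witt group of a local field is the product of two copies of that of its residue field, and
the required counts are checked over its sixteen elements. -/
theorem isLocalWittGroup_dimFour :
    IsLocalWittGroup (ZMod 4 × ZMod 4) fun g => dimFour g.1 + dimFour g.2 := by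
  constructor <;> decide +kernel

theorem isLocalWittGroup_dimTwoTwo :
    IsLocalWittGroup ((ZMod 2 × ZMod 2) × (ZMod 2 × ZMod 2))
      fun g => dimTwoTwo g.1 + dimTwoTwo g.2 := by
  constructor <;> decide +kernel

/-- The number of tuples of classes of forms of degrees `m j` with sum `w`. -/
def tupleCount {G : Type} [AddCommGroup G] [Fintype G] (d : G → ℕ) {ι : Type*} [Fintype ι]
    (m : ι → ℕ) (w : G) : ℕ :=
  Nat.card {x : ι → G // (∀ j, x j ∈ dimClasses d (m j)) ∧ ∑ j, x j = w}

theorem round_seven_pow (b : ℕ) :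
    ((round ((1 / 8 : ℚ) * 7 ^ b) : ℤ) : ℚ) = (7 ^ b - (-1) ^ b) / 8 := by
  obtain ⟨t, ht⟩ : ∃ t : ℤ, (7 : ℤ) ^ b = 8 * t + (-1) ^ b := by
    have h : (8 : ℤ) ∣ 7 ^ b - (-1) ^ b := by simpa using sub_dvd_pow_sub_pow (7 : ℤ) (-1) b
    obtain ⟨t, ht⟩ := h
    exact ⟨t, by linear_combination ht⟩
  have hq : (7 : ℚ) ^ b = 8 * t + (-1) ^ b := by exact_mod_cast ht
  have : round ((1 / 8 : ℚ) * 7 ^ b) = t := by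
    rw [round_eq_iff, hq]
    rcases neg_one_pow_eq_or ℚ b with h | h <;> rw [h] <;> constructor <;> linarith
  rw [this, hq]
  ring

theorem orbitCount_of_one_le {a b c d : ℕ} (hc : 1 ≤ c) :
    orbitCount a b c d = 1 / 8 * 4 ^ a * 7 ^ b * 8 ^ c := by
  rw [orbitCount, if_pos hc]

theorem orbitCount_zero {a b d : ℕ} (ha : 0 < a) :
    orbitCount a b 0 d = 1 / 8 * 4 ^ a * 7 ^ b + (2 - d) * (2 ^ a / 4) := by
  rw [orbitCount, if_neg (by omega), if_pos ha, zpow_sub₀ two_ne_zero]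
  norm_num

theorem orbitCount_zero_zero {b d : ℕ} :
    orbitCount 0 b 0 d = (7 ^ b - (-1) ^ b) / 8 + (if Even b then if d = 0 then 1 else 0 else
      if d = 4 then -1 else 0) := by
  rw [orbitCount, if_neg (by omega), if_neg (by omega), round_seven_pow, orbitEpsilon]
  congr 1
  rcases Nat.even_or_odd b with h | h
  · simp [h, Nat.not_odd_iff_even.2 h]
  · simp [h, Nat.not_even_iff_odd.2 h]

variable {G : Type} [AddCommGroup G] [Fintype G] {d : G → ℕ}

theorem dimClasses_of_three_le (hG : IsLocalWittGroup G d) {m : ℕ} (hm : 3 ≤ m) :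
    dimClasses d m = if m % 2 = 1 then dimClasses d 3 else dimClasses d 4 := by
  ext g
  have := hG.le_four g
  split_ifs with h <;> simp only [dimClasses, Finset.mem_filter, Finset.mem_univ, true_and] <;>
    omega

theorem IsLocalWittGroup.card_of_three_le (hG : IsLocalWittGroup G d) {m : ℕ} (hm : 3 ≤ m) :
    (dimClasses d m).card = 8 := by
  rw [dimClasses_of_three_le hG hm]
  split_ifs
  exacts [hG.card_three, hG.card_four]

theorem IsLocalWittGroup.sum_of_three_le (hG : IsLocalWittGroup G d) {m : ℕ} (hm : 3 ≤ m) (w : G) :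
    ∑ g ∈ dimClasses d m, (2 - (d (w - g) : ℤ)) = 0 := by
  rw [dimClasses_of_three_le hG hm]
  split_ifs
  exacts [hG.sum_three w, hG.sum_four w]

/-- Adding a part of multiplicity `m` multiplies, in the group algebra, the counting function by
the sum of the classes of the forms of degree `m`. -/
theorem IsLocalWittGroup.sum_orbitCount (hG : IsLocalWittGroup G d) (a b c m : ℕ) (hm : 1 ≤ m)
    (w : G) (hw : a = 0 → c = 0 → d w % 2 = m % 2) :
    ∑ g ∈ dimClasses d m, orbitCount a b c (d (w - g)) =
      orbitCount (a + if m = 1 then 1 else 0) (b + if m = 2 then 1 else 0)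
        (c + if 3 ≤ m then 1 else 0) (d w) := by
  obtain rfl | rfl | hm : m = 1 ∨ m = 2 ∨ 3 ≤ m := by omega
  all_goals rcases Nat.eq_zero_or_pos c with rfl | hc
  · rcases Nat.eq_zero_or_pos a with rfl | ha
    · have hw1 := hw rfl rfl
      simp only [if_true, show ¬(1 = 2) by omega, show ¬(3 ≤ 1) by omega, if_false, add_zero]
      rw [zero_add, orbitCount_zero one_pos]
      simp only [orbitCount_zero_zero, Finset.sum_add_distrib, Finset.sum_const, hG.card_one]
      have h4 := hG.le_four w
      have h13 : d w = 1 ∨ d w = 3 := by omega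
      rcases Nat.even_or_odd b with hb | hb
      · simp only [hb, if_true, hb.neg_one_pow, Finset.sum_boole, hG.zero_one]
        rcases h13 with h | h <;> rw [h] <;> norm_num <;> ring
      · have he := Nat.not_even_iff_odd.2 hb
        have hsum : ∑ g ∈ dimClasses d 1, (if d (w - g) = 4 then (-1 : ℚ) else 0) =
            -((if d w = 3 then 1 else 0 : ℕ) : ℚ) := by
          rw [← hG.four_one, ← Finset.sum_boole, ← Finset.sum_neg_distrib]
          exact Finset.sum_congr rfl fun g _ => by split_ifs <;> simp
        simp only [he, if_false, hb.neg_one_pow, hsum]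
        rcases h13 with h | h <;> rw [h] <;> norm_num <;> ring
    · simp only [if_true, show ¬(1 = 2) by omega, show ¬(3 ≤ 1) by omega, if_false, add_zero]
      rw [orbitCount_zero (by omega)]
      simp only [orbitCount_zero ha, Finset.sum_add_distrib, Finset.sum_const, hG.card_one,
        ← Finset.sum_mul]
      have h1 : ∑ g ∈ dimClasses d 1, (2 - (d (w - g) : ℚ)) = 2 * (2 - d w) := by
        exact_mod_cast congrArg (Int.cast : ℤ → ℚ) (hG.sum_one w)
      rw [h1, pow_succ, pow_succ]
      simp only [nsmul_eq_mul]
      push_cast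
      ring
  · simp only [if_true, show ¬(1 = 2) by omega, show ¬(3 ≤ 1) by omega, if_false, add_zero]
    simp only [orbitCount_of_one_le hc, Finset.sum_const, hG.card_one, pow_succ, nsmul_eq_mul]
    push_cast
    ring
  · rcases Nat.eq_zero_or_pos a with rfl | ha
    · have hw1 := hw rfl rfl
      simp only [if_true, show ¬(2 = 1) by omega, show ¬(3 ≤ 2) by omega, if_false, add_zero]
      rw [orbitCount_zero_zero]
      simp only [orbitCount_zero_zero, Finset.sum_add_distrib, Finset.sum_const, hG.card_two]
      have h4 := hG.le_four w
      have h13 : d w = 0 ∨ d w = 2 ∨ d w = 4 := by omega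
      rcases Nat.even_or_odd b with hb | hb
      · have he : ¬ Even (b + 1) := Nat.not_even_iff_odd.2 hb.add_one
        simp only [hb, he, if_true, if_false, hb.neg_one_pow, hb.add_one.neg_one_pow,
          Finset.sum_boole, hG.zero_two]
        rcases h13 with h | h | h <;> rw [h] <;> norm_num <;> ring
      · have he := Nat.not_even_iff_odd.2 hb
        have hsum : ∑ g ∈ dimClasses d 2, (if d (w - g) = 4 then (-1 : ℚ) else 0) =
            -((if d w = 2 ∨ d w = 4 then 1 else 0 : ℕ) : ℚ) := by
          rw [← hG.four_two, ← Finset.sum_boole, ← Finset.sum_neg_distrib]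
          exact Finset.sum_congr rfl fun g _ => by split_ifs <;> simp
        simp only [he, hb.add_one, if_true, if_false, hb.neg_one_pow, hb.add_one.neg_one_pow, hsum]
        rcases h13 with h | h | h <;> rw [h] <;> norm_num <;> ring
    · simp only [if_true, show ¬(2 = 1) by omega, show ¬(3 ≤ 2) by omega, if_false, add_zero]
      rw [orbitCount_zero ha]
      simp only [orbitCount_zero ha, Finset.sum_add_distrib, Finset.sum_const, hG.card_two,
        ← Finset.sum_mul]
      have h1 : ∑ g ∈ dimClasses d 2, (2 - (d (w - g) : ℚ)) = 2 - d w := by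
        exact_mod_cast congrArg (Int.cast : ℤ → ℚ) (hG.sum_two w)
      rw [h1, pow_succ]
      simp only [nsmul_eq_mul]
      push_cast
      ring
  · simp only [if_true, show ¬(2 = 1) by omega, show ¬(3 ≤ 2) by omega, if_false, add_zero]
    simp only [orbitCount_of_one_le hc, Finset.sum_const, hG.card_two, pow_succ, nsmul_eq_mul]
    push_cast
    ring
  · have hc8 := hG.card_of_three_le hm
    simp only [show ¬(m = 1) by omega, show ¬(m = 2) by omega, hm, if_true, if_false, add_zero]
    rw [orbitCount_of_one_le (by omega), zero_add, pow_one]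
    rcases Nat.eq_zero_or_pos a with rfl | ha
    · have hw1 := hw rfl rfl
      simp only [orbitCount_zero_zero, Finset.sum_add_distrib, Finset.sum_const, hc8]
      have h0 : ((dimClasses d m).filter fun g => d (w - g) = 0).card = 1 := by
        rw [dimClasses_of_three_le hG hm]
        split_ifs with h
        · rw [hG.zero_three, if_pos (hw1.trans h)]
        · rw [hG.zero_four, if_pos (by omega)]
      have h4 : ((dimClasses d m).filter fun g => d (w - g) = 4).card = 1 := by
        rw [dimClasses_of_three_le hG hm]
        split_ifs with h
        · rw [hG.four_three, if_pos (hw1.trans h)]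
        · rw [hG.four_four, if_pos (by omega)]
      rcases Nat.even_or_odd b with hb | hb
      · simp only [hb, if_true, hb.neg_one_pow, Finset.sum_boole, h0]
        norm_num
        ring
      · have he := Nat.not_even_iff_odd.2 hb
        have hsum : ∑ g ∈ dimClasses d m, (if d (w - g) = 4 then (-1 : ℚ) else 0) =
            -((1 : ℕ) : ℚ) := by
          rw [← h4, ← Finset.sum_boole, ← Finset.sum_neg_distrib]
          exact Finset.sum_congr rfl fun g _ => by split_ifs <;> simp
        simp only [he, if_false, hb.neg_one_pow, hsum]
        norm_num
        ring
    · simp only [orbitCount_zero ha, Finset.sum_add_distrib, Finset.sum_const, hc8,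
        ← Finset.sum_mul]
      have h1 : ∑ g ∈ dimClasses d m, (2 - (d (w - g) : ℚ)) = 0 := by
        exact_mod_cast congrArg (Int.cast : ℤ → ℚ) (hG.sum_of_three_le hm w)
      rw [h1]
      simp only [nsmul_eq_mul]
      push_cast
      ring
  · simp only [show ¬(m = 1) by omega, show ¬(m = 2) by omega, hm, if_true, if_false, add_zero]
    rw [orbitCount_of_one_le (by omega)]
    simp only [orbitCount_of_one_le hc, Finset.sum_const, hG.card_of_three_le hm, pow_succ,
      nsmul_eq_mul]
    push_cast
    ring

/-- Fixing the class at one index leaves a count of shorter tuples with another sum. -/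
theorem tupleCount_option {ι : Type*} [Fintype ι] (m : Option ι → ℕ) (w : G) :
    tupleCount d m w = ∑ g ∈ dimClasses d (m none), tupleCount d (fun j => m (some j)) (w - g) := by
  let e : {x : Option ι → G // (∀ j, x j ∈ dimClasses d (m j)) ∧ ∑ j, x j = w} ≃
      Σ g : dimClasses d (m none), {x : ι → G //
        (∀ j, x j ∈ dimClasses d (m (some j))) ∧ ∑ j, x j = w - g} :=
    { toFun := fun x => ⟨⟨x.1 none, x.2.1 none⟩, ⟨fun j => x.1 (some j), fun j => x.2.1 (some j),
        eq_sub_of_add_eq' (by rw [← Fintype.sum_option]; exact x.2.2)⟩⟩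
      invFun := fun y => ⟨fun j => j.elim y.1.1 y.2.1, fun j => by
          cases j
          · exact y.1.2
          · exact y.2.2.1 _, by
          rw [Fintype.sum_option]
          simp [y.2.2.2]⟩
      left_inv := fun x => by
        ext j
        cases j <;> rfl
      right_inv := fun y => rfl }
  rw [tupleCount, Nat.card_congr e, Nat.card_sigma, Finset.sum_coe_sort (dimClasses d (m none))
    fun g => Nat.card {x : ι → G // (∀ j, x j ∈ dimClasses d (m (some j))) ∧ ∑ j, x j = w - g}]
  rfl

theorem tupleCount_congr {ι κ : Type*} [Fintype ι] [Fintype κ] (e : ι ≃ κ) (m : κ → ℕ) (w : G) :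
    tupleCount d (fun j => m (e j)) w = tupleCount d m w := by
  refine Nat.card_congr ((Equiv.arrowCongr e (Equiv.refl G)).subtypeEquiv fun x => ?_)
  simp only [Equiv.arrowCongr_apply, Equiv.coe_refl, Function.comp, id]
  rw [← e.symm.sum_comp x]
  refine and_congr ⟨fun h j => ?_, fun h j => ?_⟩ Iff.rfl
  · simpa using h (e.symm j)
  · simpa using h (e j)

/-- The count of tuples satisfies the same recursion as `orbitCount` when one index is added; the
summands over `dimClasses` are those tabulated in `IsLocalWittGroup`. -/
theorem tupleCount_eq_orbitCount (hG : IsLocalWittGroup G d) {ι : Type*} [Fintype ι] :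
    ∀ (m : ι → ℕ), (∀ j, 1 ≤ m j) → ∀ w : G, d w % 2 = (∑ j, m j) % 2 →
      (tupleCount d m w : ℚ) = orbitCount (Finset.univ.filter fun j => m j = 1).card
        (Finset.univ.filter fun j => m j = 2).card
        (Finset.univ.filter fun j => 3 ≤ m j).card (d w) := by
  refine Fintype.induction_empty_option (P := fun ι [Fintype ι] =>
    ∀ (m : ι → ℕ), (∀ j, 1 ≤ m j) → ∀ w : G, d w % 2 = (∑ j, m j) % 2 →
      (tupleCount d m w : ℚ) = orbitCount (Finset.univ.filter fun j => m j = 1).card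
        (Finset.univ.filter fun j => m j = 2).card
        (Finset.univ.filter fun j => 3 ≤ m j).card (d w)) ?_ ?_ ?_ ι
  · intro α β _ e ih m hm w hw
    let _ := Fintype.ofEquiv β e.symm
    have h := ih (fun j => m (e j)) (fun j => hm _) w (by rw [hw, e.sum_comp])
    rw [tupleCount_congr] at h
    rw [h]
    simp only [Finset.card_filter]
    congr 1
    · exact e.sum_comp fun j => if m j = 1 then 1 else 0
    · exact e.sum_comp fun j => if m j = 2 then 1 else 0
    · exact e.sum_comp fun j => if 3 ≤ m j then 1 else 0
  · intro m _ w hw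
    simp only [Finset.univ_eq_empty, Finset.sum_empty, Finset.filter_empty,
      Finset.card_empty] at hw ⊢
    rw [orbitCount_zero_zero]
    by_cases h : w = 0
    · subst h
      have h1 : d (0 : G) = 0 := (hG.eq_zero 0).2 rfl
      have : tupleCount d m 0 = 1 := by
        rw [tupleCount, Nat.card_eq_one_iff_unique]
        exact ⟨inferInstance, ⟨⟨fun j => 0, fun j => j.elim, rfl⟩⟩⟩
      rw [this, h1]
      norm_num
    · have h1 : d w ≠ 0 := fun h' => h ((hG.eq_zero w).1 h')
      have : tupleCount d m w = 0 := by
        rw [tupleCount, Nat.card_eq_zero]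
        refine Or.inl ⟨fun x => h ?_⟩
        rw [← x.2.2]
        rfl
      rw [this]
      simp [h1]
  · intro ι _ ih m hm w hw
    rw [Fintype.sum_option] at hw
    rw [tupleCount_option]
    push_cast
    have h1 : ∀ g ∈ dimClasses d (m none),
        (tupleCount d (fun j => m (some j)) (w - g) : ℚ) = _ := fun g hg => by
      refine ih (fun j => m (some j)) (fun j => hm _) (w - g) ?_
      have h1 := hG.mod_two w g
      simp only [dimClasses, Finset.mem_filter] at hg
      omega
    rw [Finset.sum_congr rfl h1, hG.sum_orbitCount _ _ _ _ (hm none)]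
    · simp only [Finset.card_filter, Fintype.sum_option]
      congr 1 <;> exact add_comm _ _
    · intro h1 h2
      -- all other degrees are even
      have h3 : ∀ j, m (some j) % 2 = 0 := fun j => by
        rw [Finset.card_eq_zero, Finset.filter_eq_empty_iff] at h1 h2
        have := h1 (Finset.mem_univ j)
        have := h2 (Finset.mem_univ j)
        have := hm (some j)
        omega
      have h4 : (∑ j, m (some j)) % 2 = 0 := by
        rw [Finset.sum_nat_mod, Finset.sum_congr rfl fun j _ => h3 j]
        simp
      omega

end Counting


/-! ### The Witt group of a local field -/

section LocalWittGroup

/-- The homomorphism from `ZMod n` to a commutative monoid sending `1` to `x`. -/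
def zmodLift {M : Type*} [AddCommMonoid M] (n : ℕ) [NeZero n] (x : M) (hx : n • x = 0) :
    ZMod n →+ M where
  toFun g := g.val • x
  map_zero' := by simp
  map_add' g h := by
    rw [← add_nsmul, ZMod.val_add]
    conv_rhs => rw [← Nat.mod_add_div (g.val + h.val) n, add_nsmul, mul_nsmul, hx, nsmul_zero,
      add_zero]

theorem QuadraticMap.Anisotropic.nondegenerate {F V : Type*} [Field F] [AddCommGroup V]
    [Module F V] (h2 : (2 : F) ≠ 0) {Q : QuadraticForm F V} (h : Q.Anisotropic) :
    Q.polarBilin.Nondegenerate := by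
  rw [QuadraticMap.nondegenerate_iff]
  intro x hx
  refine h x ?_
  have := hx x
  rw [QuadraticMap.polar_self, two_nsmul, ← two_mul] at this
  simpa [h2] using this

theorem QuadraticMap.Equivalent.anisotropic {F V W : Type*} [Field F] [AddCommGroup V] [Module F V]
    [AddCommGroup W] [Module F W] {Q : QuadraticForm F V} {Q' : QuadraticForm F W}
    (e : Q.Equivalent Q') (h : Q.Anisotropic) : Q'.Anisotropic := by
  obtain ⟨e⟩ := e
  intro x hx
  have := h (e.symm x) (by rw [e.symm.map_app, hx])
  rw [← e.apply_symm_apply x, this]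
  exact e.toLinearEquiv.map_zero

theorem QuadraticMap.Equivalent.smul {F V W : Type*} [Field F] [AddCommGroup V] [Module F V]
    [AddCommGroup W] [Module F W] {Q : QuadraticForm F V} {Q' : QuadraticForm F W}
    (e : Q.Equivalent Q') (a : F) : (a • Q).Equivalent (a • Q') := by
  obtain ⟨e⟩ := e
  exact ⟨⟨e.toLinearEquiv, fun x => congrArg (a * ·) (e.map_app x)⟩⟩

theorem exists_equivalent_fin {F V : Type*} [Field F] [AddCommGroup V] [Module F V]
    [FiniteDimensional F V] (Q : QuadraticForm F V) {m : ℕ} (hm : Module.finrank F V = m) :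
    ∃ Q' : QuadraticForm F (Fin m → F), Q.Equivalent Q' :=
  ⟨_, equivalent_comp_equiv Q (Module.finBasisOfFinrankEq F V hm).equivFun.symm⟩

theorem smul_unaryForm {F : Type*} [Field F] (a b : F) :
    a • unaryForm b = unaryForm (a * b) := by
  rw [unaryForm, smul_smul]

theorem smul_prod {F V W : Type*} [Field F] [AddCommGroup V] [Module F V]
    [AddCommGroup W] [Module F W] (a : F) (Q : QuadraticForm F V) (Q' : QuadraticForm F W) :
    a • QuadraticMap.prod Q Q' = QuadraticMap.prod (a • Q) (a • Q') := by
  ext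
  simp [mul_add]

/-- `G`, with anisotropic dimension `d`, is the Witt group of the field `k` through the map `φ`
to Witt classes. -/
structure IsWittGroupOf (k : Type*) [Field k] {G : Type} [AddCommGroup G] [Fintype G] (d : G → ℕ)
    (φ : G →+ WittMonoid k) : Prop where
  isLocalWittGroup : IsLocalWittGroup G d
  exists_eq : ∀ (m : ℕ) (Q : QuadraticForm k (Fin m → k)), Q.polarBilin.Nondegenerate →
    ∃ g, φ g = wittClass Q
  exists_anisotropic : ∀ g, ∃ Q : QuadraticForm k (Fin (d g) → k),
    Q.Anisotropic ∧ wittClass Q = φ g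

open IsLocalRing

variable {O k : Type*} [CommRing O] [Field k] [Algebra O k]

theorem evenValued_of_subsingleton {V : Type*} [AddCommGroup V] [Module k V] [Subsingleton V]
    (Q : QuadraticForm k V) : EvenValued O Q :=
  fun x hx => absurd (Subsingleton.elim x 0) hx

theorem EvenValued.exists_fin {V : Type*} [AddCommGroup V] [Module k V] [FiniteDimensional k V]
    {Q : QuadraticForm k V} (hQ : EvenValued O Q) {m : ℕ} (hm : Module.finrank k V = m)
    {w : k → WittMonoid k} (hw : ∀ a, a ≠ 0 → wittClass (a • Q) = w a) :
    ∃ Q : QuadraticForm k (Fin m → k), EvenValued O Q ∧ ∀ a, a ≠ 0 → wittClass (a • Q) = w a := by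
  obtain ⟨Q', h⟩ := exists_equivalent_fin Q hm
  exact ⟨Q', hQ.of_equivalent h, fun a ha => by rw [← hw a ha, (h.smul a).wittClass_eq]⟩

theorem unaryForm_one_evenValued : EvenValued O (unaryForm (1 : k)) := by
  simpa using evenValued_unaryForm (k := k) (1 : Oˣ)

variable [IsDomain O] [IsDiscreteValuationRing O] [HenselianLocalRing O]
  [IsFractionRing O k] [NeZero (2 : k)]

variable (O) in
/-- `G` is the Witt group of the residue field: for every scaling factor `a`, the map `φ a` sends
a class over the residue field to the class of `a` times its lift. -/
structure IsResidueWittGroup {G : Type} [AddCommGroup G] (d : G → ℕ) (u : O)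
    (φ : k → G →+ WittMonoid k) : Prop where
  exists_evenValued : ∀ g, ∃ Q : QuadraticForm k (Fin (d g) → k), EvenValued O Q ∧
    ∀ a, a ≠ 0 → wittClass (a • Q) = φ a g
  mem_range : ∀ a, a ≠ 0 → (∃ g, φ a g = wittClass (unaryForm a)) ∧
    ∃ g, φ a g = wittClass (unaryForm (a * algebraMap O k u))

theorem two_nsmul_wittClass_unaryForm (hs : IsSquare (-1 : k)) {a : k} (ha : a ≠ 0) :
    2 • wittClass (unaryForm a) = 0 := by
  obtain ⟨i, hi⟩ := hs
  have hi0 : i ≠ 0 := by rintro rfl; simp at hi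
  have h := wittClass_unaryForm_add_neg ha
  rw [show -a = a * i ^ 2 by rw [pow_two, ← hi]; ring,
    (unaryForm_equivalent a hi0).wittClass_eq] at h
  rw [two_nsmul, h]

/-- If `-1` is a square, every class over the residue field is killed by `2`, and the classes of `1`
and of a nonsquare unit `u` form a basis. -/
theorem isResidueWittGroup_dimTwoTwo (hs : IsSquare (-1 : k)) {u : O}
    (hu : ¬ IsSquare (residue O u)) :
    ∃ φ : k → (ZMod 2 × ZMod 2) →+ WittMonoid k, IsResidueWittGroup O dimTwoTwo u φ := by
  classical
  have huu : IsUnit u := by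
    rw [← residue_ne_zero_iff_isUnit]
    exact fun h => hu (h ▸ IsSquare.zero)
  have hu0 : algebraMap O k u ≠ 0 := (huu.map _).ne_zero
  let φ : k → (ZMod 2 × ZMod 2) →+ WittMonoid k := fun a =>
    if ha : a ≠ 0 then
      (zmodLift 2 _ (two_nsmul_wittClass_unaryForm hs ha)).coprod
        (zmodLift 2 _ (two_nsmul_wittClass_unaryForm hs (mul_ne_zero ha hu0)))
    else 0
  have hφ : ∀ a, a ≠ 0 → ∀ g, φ a g = g.1.val • wittClass (unaryForm a) +
      g.2.val • wittClass (unaryForm (a * algebraMap O k u)) := fun a ha g => by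
    simp only [φ, dif_pos ha]
    rfl
  refine ⟨φ, ⟨fun g => ?_, fun a ha => ⟨⟨(1, 0), ?_⟩, ⟨(0, 1), ?_⟩⟩⟩⟩
  · obtain rfl | rfl | rfl | rfl : g = 0 ∨ g = (1, 0) ∨ g = (0, 1) ∨ g = (1, 1) := by
      revert g; decide
    · exact (evenValued_of_subsingleton (0 : QuadraticForm k (Fin 0 → k))).exists_fin (by simp; rfl)
        fun a ha => by rw [wittClass_of_subsingleton, map_zero]
    · exact (unaryForm_one_evenValued).exists_fin (by simp; rfl) fun a ha => by
        rw [hφ a ha, smul_unaryForm]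
        simp [ZMod.val_one]
    · obtain ⟨ε, rfl⟩ := huu
      exact (evenValued_unaryForm ε).exists_fin (by simp; rfl) fun a ha => by
        rw [hφ a ha, smul_unaryForm]
        simp [ZMod.val_one]
    · exact (evenValued_normForm hu).exists_fin (by simp; rfl) fun a ha => by
        obtain ⟨i, hi⟩ := hs
        have hi0 : i ≠ 0 := by rintro rfl; simp at hi
        rw [hφ a ha, smul_prod, wittClass_prod, smul_unaryForm, smul_unaryForm,
          show a * -algebraMap O k u = a * algebraMap O k u * i ^ 2 by rw [pow_two, ← hi]; ring,
          (unaryForm_equivalent _ hi0).wittClass_eq]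
        simp [ZMod.val_one]
  · rw [hφ a ha]
    simp [ZMod.val_one]
  · rw [hφ a ha]
    simp [ZMod.val_one]

/-- If `-1` is a sum of two squares, the form `a (x ^ 2 + y ^ 2)` is isometric to its opposite. -/
theorem four_nsmul_wittClass_unaryForm {α β : k} (h : α ^ 2 + β ^ 2 = -1) {a : k} (ha : a ≠ 0) :
    4 • wittClass (unaryForm a) = 0 := by
  have h1 : wittClass (unaryForm a) + wittClass (unaryForm a) =
      wittClass (unaryForm (-a)) + wittClass (unaryForm (-a)) := by
    rw [← wittClass_prod, ← wittClass_prod]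
    refine QuadraticMap.Equivalent.wittClass_eq (equivalent_of_isometry (nondegenerate_prod_iff.2
      ⟨unaryForm_nondegenerate ha, unaryForm_nondegenerate ha⟩) rfl
      ((α • LinearMap.fst k k k - β • LinearMap.snd k k k).prod
        (β • LinearMap.fst k k k + α • LinearMap.snd k k k)) ?_)
    rintro ⟨x, y⟩
    simp
    linear_combination -a * (x ^ 2 + y ^ 2) * h
  have h2 := wittClass_unaryForm_add_neg ha
  calc 4 • wittClass (unaryForm a) = (wittClass (unaryForm a) + wittClass (unaryForm a)) +
        (wittClass (unaryForm a) + wittClass (unaryForm a)) := by abel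
    _ = (wittClass (unaryForm a) + wittClass (unaryForm a)) +
        (wittClass (unaryForm (-a)) + wittClass (unaryForm (-a))) := by rw [← h1]
    _ = (wittClass (unaryForm a) + wittClass (unaryForm (-a))) +
        (wittClass (unaryForm a) + wittClass (unaryForm (-a))) := by abel
    _ = 0 := by rw [h2, add_zero]

/-- If `-1` is not a square in the residue field, the class of `x ^ 2` generates a cyclic group of
order `4`. -/
theorem isResidueWittGroup_dimFour {α β : k} (h : α ^ 2 + β ^ 2 = -1)
    (hu : ¬ IsSquare (residue O (-1))) :
    ∃ φ : k → ZMod 4 →+ WittMonoid k, IsResidueWittGroup O dimFour (-1) φ := by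
  classical
  let φ : k → ZMod 4 →+ WittMonoid k := fun a =>
    if ha : a ≠ 0 then zmodLift 4 _ (four_nsmul_wittClass_unaryForm h ha) else 0
  have hφ : ∀ a, a ≠ 0 → ∀ g, φ a g = g.val • wittClass (unaryForm a) := fun a ha g => by
    simp only [φ, dif_pos ha]
    rfl
  have h3 : ∀ a : k, a ≠ 0 → 3 • wittClass (unaryForm a) = wittClass (unaryForm (-a)) := by
    intro a ha
    calc
      3 • wittClass (unaryForm a) = 3 • wittClass (unaryForm a) +
          (wittClass (unaryForm a) + wittClass (unaryForm (-a))) := by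
            rw [wittClass_unaryForm_add_neg ha, add_zero]
      _ = 4 • wittClass (unaryForm a) + wittClass (unaryForm (-a)) := by
            rw [← add_assoc, ← succ_nsmul]
      _ = _ := by rw [four_nsmul_wittClass_unaryForm h ha, zero_add]
  refine ⟨φ, ⟨fun g => ?_, fun a ha => ⟨⟨1, ?_⟩, ⟨3, ?_⟩⟩⟩⟩
  · obtain rfl | rfl | rfl | rfl : g = 0 ∨ g = 1 ∨ g = 2 ∨ g = 3 := by
      revert g; decide
    · exact (evenValued_of_subsingleton (0 : QuadraticForm k (Fin 0 → k))).exists_fin (by simp; rfl)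
        fun a ha => by rw [wittClass_of_subsingleton, map_zero]
    · exact (unaryForm_one_evenValued).exists_fin (by simp; rfl) fun a ha => by
        rw [hφ a ha, smul_unaryForm, show (1 : ZMod 4).val = 1 from rfl]
        simp
    · exact (evenValued_normForm hu).exists_fin (by simp; rfl) fun a ha => by
        rw [hφ a ha, smul_prod, wittClass_prod, smul_unaryForm, smul_unaryForm,
          show (2 : ZMod 4).val = 2 from rfl, two_nsmul]
        simp
    · exact (evenValued_unaryForm (-1 : Oˣ)).exists_fin (by simp; rfl) fun a ha => by
        rw [hφ a ha, smul_unaryForm, show (3 : ZMod 4).val = 3 from rfl, h3 a ha]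
        simp
  · rw [hφ a ha, show (1 : ZMod 4).val = 1 from rfl, one_nsmul]
  · rw [hφ a ha, show (3 : ZMod 4).val = 3 from rfl, h3 a ha]
    simp

/-- The Witt group of `k` is the sum of two copies of the Witt group of the residue field. -/
theorem IsResidueWittGroup.isWittGroupOf [Finite (ResidueField O)] (h2 : (2 : ResidueField O) ≠ 0)
    {G : Type} [AddCommGroup G] [Fintype G] {d : G → ℕ} {u : O} (hu : ¬ IsSquare (residue O u))
    {φ : k → G →+ WittMonoid k} (h : IsResidueWittGroup O d u φ)
    (hG : IsLocalWittGroup (G × G) fun g => d g.1 + d g.2) :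
    ∃ ψ : G × G →+ WittMonoid k, IsWittGroupOf k (fun g => d g.1 + d g.2) ψ := by
  obtain ⟨π, hπ⟩ := IsDiscreteValuationRing.exists_irreducible O
  have hπ0 : algebraMap O k π ≠ 0 := by simpa using hπ.ne_zero
  refine ⟨(φ 1).coprod (φ (algebraMap O k π)), ⟨hG, fun m Q hQ => ?_, fun g => ?_⟩⟩
  · obtain ⟨w, hw, hwQ⟩ := exists_wittClass_eq_sum hQ
    rw [hwQ]
    refine AddMonoidHom.mem_mrange.1 (AddSubmonoid.sum_mem _ fun i _ => ?_)
    rw [AddMonoidHom.mem_mrange]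
    obtain ⟨c, hc, s, hs, hx⟩ := exists_squareClass h2 hu hπ (hw i)
    rcases hc with rfl | rfl
    · obtain ⟨⟨g, hg⟩, g', hg'⟩ := h.mem_range 1 one_ne_zero
      rcases hx with hx | hx
      · exact ⟨(g, 0), by
          rw [AddMonoidHom.coprod_apply, map_zero, add_zero, hg, hx,
            (unaryForm_equivalent _ hs).wittClass_eq]⟩
      · exact ⟨(g', 0), by
          rw [AddMonoidHom.coprod_apply, map_zero, add_zero, hg', hx,
            (unaryForm_equivalent _ hs).wittClass_eq]⟩
    · obtain ⟨⟨g, hg⟩, g', hg'⟩ := h.mem_range _ hπ0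
      rcases hx with hx | hx
      · exact ⟨(0, g), by
          rw [AddMonoidHom.coprod_apply, map_zero, zero_add, hg, hx,
            (unaryForm_equivalent _ hs).wittClass_eq]⟩
      · exact ⟨(0, g'), by
          rw [AddMonoidHom.coprod_apply, map_zero, zero_add, hg', hx,
            (unaryForm_equivalent _ hs).wittClass_eq]⟩
  · obtain ⟨Q, hQ, hQw⟩ := h.exists_evenValued g.1
    obtain ⟨Q', hQ', hQw'⟩ := h.exists_evenValued g.2
    obtain ⟨R, hR⟩ := exists_equivalent_fin (QuadraticMap.prod Q (algebraMap O k π • Q'))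
      (m := d g.1 + d g.2) (by simp)
    refine ⟨R, hR.anisotropic (hQ.anisotropic_prod hQ' hπ), ?_⟩
    rw [← hR.wittClass_eq, wittClass_prod, hQw' _ hπ0, AddMonoidHom.coprod_apply,
      ← hQw 1 one_ne_zero, one_smul]

variable (O k) in
/-- The Witt group of a henselian discretely valued field whose residue field is finite of odd
characteristic. -/
theorem exists_isWittGroupOf [Finite (ResidueField O)] (h2 : (2 : ResidueField O) ≠ 0) :
    ∃ (G : Type) (_ : AddCommGroup G) (_ : Fintype G) (d : G → ℕ) (φ : G →+ WittMonoid k),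
      IsWittGroupOf k d φ := by
  have := Fintype.ofFinite (ResidueField O)
  have hchar : ringChar (ResidueField O) ≠ 2 := fun h =>
    h2 (by exact_mod_cast (ringChar.spec (ResidueField O) 2).2 (by rw [h]))
  by_cases hs : IsSquare (residue O (-1))
  · obtain ⟨x, hx⟩ := FiniteField.exists_nonsquare hchar
    obtain ⟨u, rfl⟩ := residue_surjective x
    have hs' := (isSquare_of_isSquare_residue h2 isUnit_one.neg hs).map (algebraMap O k)
    rw [map_neg, map_one] at hs'
    obtain ⟨φ, hφ⟩ := isResidueWittGroup_dimTwoTwo hs' hx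
    obtain ⟨ψ, hψ⟩ := hφ.isWittGroupOf h2 hx isLocalWittGroup_dimTwoTwo
    exact ⟨_, _, _, _, ψ, hψ⟩
  · -- lift a representation of `-1` as a sum of two squares from the residue field
    have hc0 : NeZero (ringChar (ResidueField O)) := ⟨CharP.ringChar_ne_zero_of_finite _⟩
    obtain ⟨x, y, hxy⟩ := CharP.sq_add_sq (ResidueField O) (ringChar (ResidueField O)) (-1)
    have hx0 : (x : ResidueField O) ≠ 0 := by
      intro h
      refine hs ⟨(y : ResidueField O), ?_⟩
      rw [h] at hxy
      rw [map_neg, map_one, ← pow_two]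
      push_cast at hxy
      linear_combination -hxy
    have hsum : residue O (-1 - (y : O) ^ 2) = (x : ResidueField O) ^ 2 := by
      push_cast at hxy
      simp only [map_sub, map_neg, map_one, map_pow, map_natCast]
      linear_combination -hxy
    obtain ⟨α, hα⟩ := isSquare_of_isSquare_residue h2
      ((residue_ne_zero_iff_isUnit _).1 (by rw [hsum]; exact pow_ne_zero 2 hx0))
      ⟨(x : ResidueField O), by rw [hsum, pow_two]⟩
    have h : (algebraMap O k α) ^ 2 + (algebraMap O k y) ^ 2 = -1 := by
      rw [← map_pow, ← map_pow, ← map_add, pow_two α, ← hα]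
      simp
    obtain ⟨φ, hφ⟩ := isResidueWittGroup_dimFour h hs
    obtain ⟨ψ, hψ⟩ := hφ.isWittGroupOf h2 hs isLocalWittGroup_dimFour
    exact ⟨_, _, _, _, ψ, hψ⟩

end LocalWittGroup


/-! ### Counting tuples of quadratic forms -/

section FormTuples

variable {k : Type*} [Field k] {G : Type} [AddCommGroup G] [Fintype G]
  {d : G → ℕ} {φ : G →+ WittMonoid k} {V : Type*} [AddCommGroup V] [Module k V]
  [FiniteDimensional k V]

theorem IsWittGroupOf.exists_eq' (h : IsWittGroupOf k d φ) {Q : QuadraticForm k V}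
    (hQ : Q.polarBilin.Nondegenerate) : ∃ g, φ g = wittClass Q := by
  obtain ⟨Q', hQ'⟩ := exists_equivalent_fin Q rfl
  obtain ⟨g, hg⟩ := h.exists_eq _ Q' (hQ'.nondegenerate hQ)
  exact ⟨g, by rw [hg, hQ'.wittClass_eq]⟩

/-- The Witt class of an isometry class. -/
def QuadFormClass.wittClass {k : Type*} [Field k] {m : ℕ} (c : QuadFormClass k m) : WittMonoid k :=
  Quotient.lift (fun Q : NondegForm k m => _root_.wittClass Q.1)
    (fun _ _ h => QuadraticMap.Equivalent.wittClass_eq h) c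

theorem mem_representingTuples_iff {Q : QuadraticForm k V} {n : ℕ} {lam : n.Partition}
    {t : FormTuples k lam} : t ∈ representingTuples Q lam ↔
      ∑ j, (t j).wittClass = wittClass Q := by
  constructor
  · rintro ⟨f, hf, hQ⟩
    rw [← wittClass_eq_iff, wittClass_pi] at hQ
    rw [← hQ]
    exact Finset.sum_congr rfl fun j _ => by rw [← hf j]; rfl
  · intro h
    choose f hf using fun j => Quotient.exists_rep (t j)
    refine ⟨f, hf, wittClass_eq_iff.1 ?_⟩
    rw [wittClass_pi, ← h]
    exact Finset.sum_congr rfl fun j _ => by rw [← hf j]; rfl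

variable [NeZero (2 : k)]

/-- A form is the sum of the anisotropic form in its class and hyperbolic planes. -/
theorem IsWittGroupOf.finrank_eq (h : IsWittGroupOf k d φ) {Q : QuadraticForm k V} {g : G}
    (hg : φ g = wittClass Q) : ∃ r, Module.finrank k V = d g + 2 * r := by
  obtain ⟨Q', ha, hQ'⟩ := h.exists_anisotropic g
  obtain ⟨r, e⟩ := (wittClass_eq_iff.1 (hg.symm.trans hQ'.symm)).equivalent_prod_of_anisotropic
    two_ne_zero ha
  exact ⟨r, by rw [e.finrank_eq, Module.finrank_prod, finrank_hyperbolicSum]; simp⟩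

/-- A hyperbolic form has anisotropic dimension `0`, and only `0` in `G` has this dimension. -/
theorem IsWittGroupOf.injective (h : IsWittGroupOf k d φ) : Function.Injective φ := by
  intro g g' hgg
  have h0 : φ (g - g') = wittClass (hyperbolicSum k 0) := by
    rw [wittClass_hyperbolicSum, sub_eq_add_neg, map_add, hgg, ← map_add, add_neg_cancel, map_zero]
  obtain ⟨r, hr⟩ := h.finrank_eq h0
  rw [finrank_hyperbolicSum] at hr
  exact sub_eq_zero.1 ((h.isLocalWittGroup.eq_zero _).1 (by omega))

theorem IsWittGroupOf.anisotropicDim_eq (h : IsWittGroupOf k d φ) {Q : QuadraticForm k V} {g : G}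
    (hg : φ g = wittClass Q) : anisotropicDim Q = d g := by
  have hset : {m : ℕ | ∃ q₀ : QuadraticForm k (Fin m → k), q₀.Anisotropic ∧ WittEquivalent Q q₀} =
      {d g} := by
    ext m
    simp only [Set.mem_ofPred_eq, Set.mem_singleton_iff]
    constructor
    · rintro ⟨Q', ha, hQ'⟩
      obtain ⟨Q'', ha', hQ''⟩ := h.exists_anisotropic g
      have hw : wittClass Q' = wittClass Q'' := by rw [hQ'', hg, wittClass_eq_iff.2 hQ']
      obtain ⟨r, e⟩ := (wittClass_eq_iff.1 hw).equivalent_prod_of_anisotropic two_ne_zero ha'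
      obtain ⟨s, e'⟩ := (wittClass_eq_iff.1 hw.symm).equivalent_prod_of_anisotropic two_ne_zero ha
      have e1 := e.finrank_eq
      have e2 := e'.finrank_eq
      rw [Module.finrank_prod, finrank_hyperbolicSum] at e1 e2
      simp only [Module.finrank_fin_fun] at e1 e2
      omega
    · rintro rfl
      obtain ⟨Q', ha, hQ'⟩ := h.exists_anisotropic g
      exact ⟨Q', ha, wittClass_eq_iff.1 (hg.symm.trans hQ'.symm)⟩
  rw [anisotropicDim, hset, csInf_singleton]

/-- A class of anisotropic dimension at most `m` and of the parity of `m` contains a form of degree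
`m`: add hyperbolic planes to its anisotropic form. -/
theorem IsWittGroupOf.exists_nondegForm (h : IsWittGroupOf k d φ) {m : ℕ} {g : G}
    (hg : g ∈ dimClasses d m) : ∃ Q : NondegForm k m, wittClass Q.1 = φ g := by
  obtain ⟨Q, ha, hQ⟩ := h.exists_anisotropic g
  simp only [dimClasses, Finset.mem_filter, Finset.mem_univ, true_and] at hg
  obtain ⟨r, hr⟩ : ∃ r, m = d g + 2 * r := ⟨(m - d g) / 2, by omega⟩
  obtain ⟨Q', hQ'⟩ := exists_equivalent_fin (QuadraticMap.prod Q (hyperbolicSum k r)) (m := m)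
    (by rw [Module.finrank_prod, finrank_hyperbolicSum, hr]; simp)
  exact ⟨⟨Q', hQ'.nondegenerate (nondegenerate_prod_iff.2
    ⟨ha.nondegenerate two_ne_zero, nondegenerate_hyperbolicSum r⟩)⟩, by
    rw [← hQ'.wittClass_eq, wittClass_prod, wittClass_hyperbolicSum, add_zero, hQ]⟩

/-- By Witt cancellation, a Witt class contains at most one isometry class of each degree. -/
theorem QuadFormClass.wittClass_injective {m : ℕ} :
    Function.Injective (QuadFormClass.wittClass : QuadFormClass k m → WittMonoid k) := by
  intro c c' h
  induction c using Quotient.inductionOn with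
  | h Q =>
    induction c' using Quotient.inductionOn with
    | h Q' => exact Quotient.sound ((wittClass_eq_iff.1 h).equivalent two_ne_zero rfl)

theorem IsWittGroupOf.exists_mem_dimClasses (h : IsWittGroupOf k d φ) {m : ℕ}
    (c : QuadFormClass k m) : ∃ g ∈ dimClasses d m, φ g = c.wittClass := by
  induction c using Quotient.inductionOn with
  | h Q =>
    obtain ⟨g, hg⟩ := h.exists_eq m Q.1 Q.2
    obtain ⟨r, hr⟩ := h.finrank_eq hg
    rw [Module.finrank_fin_fun] at hr
    refine ⟨g, ?_, hg⟩
    simp only [dimClasses, Finset.mem_filter, Finset.mem_univ, true_and]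
    omega

theorem IsWittGroupOf.exists_equiv (h : IsWittGroupOf k d φ) {Q : QuadraticForm k V} {g : G}
    (hg : φ g = wittClass Q) {n : ℕ} (lam : n.Partition) :
    Nonempty ({t // t ∈ representingTuples Q lam} ≃
      {x : oddParts lam → G // (∀ j : oddParts lam, x j ∈ dimClasses d (lam.parts.count (j : ℕ))) ∧
        ∑ j, x j = g}) := by
  choose γ hγ hφ using fun (m : ℕ) (c : QuadFormClass k m) => h.exists_mem_dimClasses c
  refine ⟨Equiv.ofBijective (fun t => ⟨fun j => γ _ (t.1 j), fun j => hγ _ _, ?_⟩) ⟨?_, ?_⟩⟩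
  · apply h.injective
    rw [map_sum, hg, ← mem_representingTuples_iff.1 t.2]
    exact Finset.sum_congr rfl fun j _ => hφ _ _
  · intro t t' htt
    refine Subtype.ext (funext fun j => QuadFormClass.wittClass_injective ?_)
    rw [← hφ, ← hφ]
    exact congrArg φ (congrFun (congrArg Subtype.val htt) j)
  · rintro ⟨x, hx, hxg⟩
    choose f hf using fun j => h.exists_nondegForm (hx j)
    refine ⟨⟨fun j => Quotient.mk (isometrySetoid k _) (f j), mem_representingTuples_iff.2 ?_⟩,
      Subtype.ext (funext fun j => h.injective ?_)⟩
    · rw [← hg, ← hxg, map_sum]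
      exact Finset.sum_congr rfl fun j _ => hf j
    · rw [hφ]
      exact hf j

theorem oddParts_count_pos {n : ℕ} (lam : n.Partition) (j : oddParts lam) :
    1 ≤ lam.parts.count (j : ℕ) := by
  have := j.2
  simp only [oddParts, Finset.mem_filter, Multiset.mem_toFinset] at this
  exact Multiset.one_le_count_iff_mem.2 this.1

theorem count_le {n : ℕ} (lam : n.Partition) (j : ℕ) :
    lam.parts.count j ≤ n := by
  have h1 : lam.parts.card ≤ lam.parts.sum := by
    have := Multiset.card_nsmul_le_sum (s := lam.parts) (a := 1) fun i hi => lam.parts_pos hi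
    simpa using this
  rw [lam.parts_sum] at h1
  exact (Multiset.count_le_card _ _).trans h1

theorem card_filter_oddParts {n : ℕ} (lam : n.Partition) (p : ℕ → Prop) [DecidablePred p] :
    (Finset.univ.filter fun j : oddParts lam => p (lam.parts.count (j : ℕ))).card =
      ((oddParts lam).filter fun j => p (lam.parts.count j)).card := by
  rw [Finset.card_filter, Finset.card_filter,
    Finset.sum_coe_sort (oddParts lam) fun j => if p (lam.parts.count j) then 1 else 0]

theorem sum_numOddParts {n : ℕ} (lam : n.Partition) :
    ∑ i ∈ Finset.Icc 3 n, numOddParts lam i =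
      ((oddParts lam).filter fun j => 3 ≤ lam.parts.count j).card := by
  simp only [numOddParts]
  rw [← Finset.card_biUnion]
  · congr 1
    ext j
    simp only [Finset.mem_biUnion, Finset.mem_Icc, Finset.mem_filter]
    constructor
    · rintro ⟨i, hi, hj, rfl⟩
      exact ⟨hj, hi.1⟩
    · rintro ⟨hj, h⟩
      refine ⟨_, ⟨h, count_le lam j⟩, hj, rfl⟩
  · intro i _ i' _ hii
    rw [Function.onFun, Finset.disjoint_left]
    intro j hj hj'
    simp only [Finset.mem_filter] at hj hj'
    exact hii (hj.2.symm.trans hj'.2)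

theorem sum_count_oddParts_mod_two {n : ℕ} (lam : n.Partition) :
    (∑ j : oddParts lam, lam.parts.count (j : ℕ)) % 2 = n % 2 := by
  conv_rhs => rw [← lam.parts_sum, Finset.sum_multiset_count]
  rw [Finset.sum_coe_sort (oddParts lam) fun j => lam.parts.count j, oddParts, Finset.sum_filter,
    Finset.sum_nat_mod, Finset.sum_nat_mod (lam.parts.toFinset) 2 fun j => lam.parts.count j • j]
  congr 1
  refine Finset.sum_congr rfl fun j hj => ?_
  rw [smul_eq_mul]
  rcases Nat.even_or_odd j with h | h
  · rw [if_neg (Nat.not_odd_iff_even.2 h)]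
    obtain ⟨r, hr⟩ := h
    rw [hr, show lam.parts.count (r + r) * (r + r) = 2 * (lam.parts.count (r + r) * r) by ring]
    simp
  · rw [if_pos h, Nat.mul_mod, Nat.odd_iff.1 h, mul_one, Nat.mod_mod]

/-- Tuples of isometry classes are tuples of Witt classes with bounded anisotropic dimension and
prescribed parity, which `tupleCount_eq_orbitCount` counts. -/
theorem IsWittGroupOf.ncard_representingTuples (h : IsWittGroupOf k d φ) {Q : QuadraticForm k V}
    (hQ : Q.polarBilin.Nondegenerate) {n : ℕ} (hn : Module.finrank k V = n) (lam : n.Partition) :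
    (representingTuples Q lam).Finite ∧ ((representingTuples Q lam).ncard : ℚ) =
      orbitCount (numOddParts lam 1) (numOddParts lam 2) (∑ i ∈ Finset.Icc 3 n, numOddParts lam i)
        (anisotropicDim Q) := by
  obtain ⟨g, hg⟩ := h.exists_eq' hQ
  obtain ⟨e⟩ := h.exists_equiv hg lam
  refine ⟨Set.finite_coe_iff.1 (Finite.of_equiv _ e.symm), ?_⟩
  rw [← Nat.card_coe_set_eq, Nat.card_congr e, h.anisotropicDim_eq hg, sum_numOddParts,
    numOddParts, numOddParts, ← card_filter_oddParts lam fun i => i = 1,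
    ← card_filter_oddParts lam fun i => i = 2, ← card_filter_oddParts lam fun i => 3 ≤ i]
  refine tupleCount_eq_orbitCount h.isLocalWittGroup _ (oddParts_count_pos lam) g ?_
  obtain ⟨r, hr⟩ := h.finrank_eq hg
  rw [sum_count_oddParts_mod_two lam, ← hn, hr]
  omega

end FormTuples

section LocalField

variable (k : Type*) [Field k] [ValuativeRel k] [TopologicalSpace k]
    [IsNonarchimedeanLocalField k]

theorem henselianLocalRing_integers : HenselianLocalRing 𝒪[k] := by
  let _ := IsTopologicalAddGroup.rightUniformSpace k
  have := isUniformAddGroup_of_addCommGroup (G := k)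
  have h : HenselianRing 𝒪[k] (IsLocalRing.maximalIdeal 𝒪[k]) := inferInstance
  refine ⟨fun f hf a h0 h1 => h.is_henselian f hf a h0 (h1.map _)⟩

theorem two_ne_zero_residue (hp : ringChar 𝓀[k] ≠ 2) : (2 : 𝓀[k]) ≠ 0 := by
  intro h
  have h2 : ringChar 𝓀[k] ∣ 2 := (ringChar.spec 𝓀[k] 2).1 (by exact_mod_cast h)
  rcases (Nat.dvd_prime Nat.prime_two).1 h2 with h1 | h1
  · exact one_ne_zero (α := 𝓀[k]) (by exact_mod_cast (ringChar.spec 𝓀[k] 1).2 (by rw [h1]))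
  · exact hp h1

theorem two_ne_zero_of_residue (hp : ringChar 𝓀[k] ≠ 2) : (2 : k) ≠ 0 := by
  intro h
  have h0 : (2 : 𝒪[k]) = 0 := Subtype.ext h
  refine two_ne_zero_residue k hp ?_
  have := congrArg (IsLocalRing.residue 𝒪[k]) h0
  rwa [map_ofNat, map_zero] at this

theorem exists_isWittGroupOf_localField (hp : ringChar 𝓀[k] ≠ 2) [NeZero (2 : k)] :
    ∃ (G : Type) (_ : AddCommGroup G) (_ : Fintype G) (d : G → ℕ) (φ : G →+ WittMonoid k),
      IsWittGroupOf k d φ := by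
  have := henselianLocalRing_integers k
  exact exists_isWittGroupOf 𝒪[k] k (two_ne_zero_residue k hp)

end LocalField


/-! ### Decomposition of skew-adjoint nilpotent endomorphisms into strings -/

section Strings

variable {F : Type*} [Field F] {V : Type*} [AddCommGroup V] [Module F V]

/-- A decomposition of a nilpotent skew-adjoint `X` into strings.  The vectors of `L j` head the
strings of length `j`; two strings are orthogonal unless they have the same length `j`, and then
only opposite members pair nontrivially, through the nondegenerate form `B u (X ^ (j - 1) v)` on
`L j`. -/
structure StringDecomp (B : LinearMap.BilinForm F V) (X : Module.End F V)
    (L : ℕ → Submodule F V) : Prop where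
  pow_eq_zero : ∀ j, ∀ u ∈ L j, (X ^ j) u = 0
  orth : ∀ i j a, ¬ (i = j ∧ a + 1 = j) → ∀ u ∈ L i, ∀ v ∈ L j, B u ((X ^ a) v) = 0
  nondeg : ∀ j, ∀ u ∈ L j, (∀ v ∈ L j, B u ((X ^ (j - 1)) v) = 0) → u = 0
  span : ∀ W : Submodule F V, (∀ j, ∀ u ∈ L j, ∀ a, (X ^ a) u ∈ W) → W = ⊤

theorem pow_skew {B : LinearMap.BilinForm F V} {X : Module.End F V}
    (hX : ∀ x y, B (X x) y = -B x (X y)) (a : ℕ) (x y : V) :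
    B ((X ^ a) x) y = (-1) ^ a * B x ((X ^ a) y) := by
  induction a generalizing x y with
  | zero => simp
  | succ a ih =>
    rw [pow_succ, Module.End.mul_apply, ih, hX, pow_succ', Module.End.mul_apply,
      ← Module.End.mul_apply, ← Module.End.mul_apply, ← pow_succ, ← pow_succ', pow_succ]
    ring

theorem pow_pow_apply (X : Module.End F V) (a b : ℕ) (z : V) :
    (X ^ a) ((X ^ b) z) = (X ^ (a + b)) z := by
  rw [pow_add, Module.End.mul_apply]

theorem pow_apply_eq_zero_of_le {X : Module.End F V} {x : V} {a b : ℕ} (h : (X ^ a) x = 0)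
    (hab : a ≤ b) : (X ^ b) x = 0 := by
  obtain ⟨c, rfl⟩ := Nat.exists_eq_add_of_le' hab
  rw [pow_add, Module.End.mul_apply, h, map_zero]

/-- The complement `C` of the kernel of `X ^ N` can be moved so that it pairs to zero with its
images under the powers `X ^ a` with `a < N`. -/
theorem exists_orthogonal_heads (h2 : (2 : F) ≠ 0) [FiniteDimensional F V]
    {B : LinearMap.BilinForm F V} (hs : ∀ x y, B x y = B y x) {X : Module.End F V}
    (hX : ∀ x y, B (X x) y = -B x (X y)) {N : ℕ} (hN : X ^ (N + 1) = 0) {C : Submodule F V}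
    (hC : ∀ u ∈ C, (∀ v ∈ C, B u ((X ^ N) v) = 0) → u = 0) (s : ℕ) :
    ∃ e : C →ₗ[F] V, (∀ v, (X ^ N) (e v) = (X ^ N) v) ∧
      ∀ a, a < N → N ≤ a + s → ∀ u v, B (e u) ((X ^ a) (e v)) = 0 := by
  induction s with
  | zero => exact ⟨C.subtype, fun v => rfl, fun a h1 h2 => by omega⟩
  | succ s ih =>
    obtain ⟨e, he, hea⟩ := ih
    rcases Nat.lt_or_ge s N with hsN | hsN
    swap
    · exact ⟨e, he, fun a h1 _ => hea a h1 (by omega)⟩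
    obtain ⟨m, rfl⟩ : ∃ m, N = m + (s + 1) := ⟨N - (s + 1), by omega⟩
    have hpow : ∀ b, m + (s + 1) < b → X ^ b = 0 := fun b hb => pow_eq_zero_of_le (by omega) hN
    let ψ : LinearMap.BilinForm F C :=
      B.compl₁₂ C.subtype (LinearMap.comp (X ^ (m + (s + 1))) C.subtype)
    have hψ : ∀ u v : C, ψ u v = B u ((X ^ (m + (s + 1))) v) := fun u v => rfl
    have hψe : ∀ u v : C, B (e u) ((X ^ (m + (s + 1))) (e v)) = ψ u v := by
      intro u v
      have h := pow_skew hX (m + (s + 1)) (e u) v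
      have h' := pow_skew hX (m + (s + 1)) u v
      rw [he, h'] at h
      rw [he, hψ]
      exact (mul_left_cancel₀ (pow_ne_zero _ (by simp)) h).symm
    have hψs : ∀ u v : C, ψ v u = (-1) ^ (m + (s + 1)) * ψ u v := by
      intro u v
      rw [hψ, hψ, ← pow_skew hX, hs]
    have hnd : ψ.Nondegenerate := by
      refine ⟨fun u hu => Subtype.ext (hC u u.2 fun v hv => hu ⟨v, hv⟩), fun u hu => ?_⟩
      refine Subtype.ext (hC u u.2 fun v hv => ?_)
      rw [← hψ u ⟨v, hv⟩, hψs, hu, mul_zero]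
    let b : LinearMap.BilinForm F C := B.compl₁₂ e (LinearMap.comp (X ^ m) e)
    have hb : ∀ u v, b u v = B (e u) ((X ^ m) (e v)) := fun u v => rfl
    have hbs : ∀ u v, b v u = (-1) ^ m * b u v := by
      intro u v
      rw [hb, hb, ← pow_skew hX, hs]
    let S : C →ₗ[F] C := (ψ.toDual hnd).symm.toLinearMap ∘ₗ (-(2 : F)⁻¹ • b)
    have hS : ∀ u v, ψ (S u) v = -2⁻¹ * b u v := fun u v => by
      rw [← LinearMap.BilinForm.toDual_def hnd]
      change (ψ.toDual hnd) ((ψ.toDual hnd).symm _) v = _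
      rw [LinearEquiv.apply_symm_apply]
      rfl
    -- solve for a correction `X ^ (s + 1) ∘ T` of `e`
    let T : C →ₗ[F] C := (-1 : F) ^ (s + 1) • S
    have hT1 : ∀ u v, ψ (T u) v = (-1) ^ (s + 1) * (-2⁻¹ * b u v) := fun u v => by
      simp only [T, LinearMap.smul_apply, map_smul, smul_eq_mul, hS]
    have hT2 : ∀ u v, ψ u (T v) = -2⁻¹ * b u v := fun u v => by
      rw [hψs, hT1, hbs]
      have h1 : ((-1 : F) ^ m) * (-1) ^ m = 1 := by rw [← mul_pow]; simp
      have h3 : ((-1 : F) ^ (s + 1)) * (-1) ^ (s + 1) = 1 := by rw [← mul_pow]; simp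
      rw [pow_add]
      linear_combination (-2⁻¹ * b u v) * h1 + (-2⁻¹ * b u v) * ((-1 : F) ^ m * (-1) ^ m) * h3
    refine ⟨e + LinearMap.comp (X ^ (s + 1)) (e ∘ₗ T), fun v => ?_, fun a ha1 ha2 u v => ?_⟩
    · rw [LinearMap.add_apply, map_add, he, LinearMap.comp_apply, pow_pow_apply,
        hpow (m + (s + 1) + (s + 1)) (by omega)]
      simp
    · have hexp : B ((e + LinearMap.comp (X ^ (s + 1)) (e ∘ₗ T)) u)
          ((X ^ a) ((e + LinearMap.comp (X ^ (s + 1)) (e ∘ₗ T)) v)) =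
          B (e u) ((X ^ a) (e v)) + B (e u) ((X ^ (a + (s + 1))) (e (T v))) +
          (-1) ^ (s + 1) * B (e (T u)) ((X ^ (a + (s + 1))) (e v)) +
          (-1) ^ (s + 1) * B (e (T u)) ((X ^ (a + (s + 1) + (s + 1))) (e (T v))) := by
        have h3 : ∀ b z, (X ^ (s + 1)) ((X ^ b) z) = (X ^ (b + (s + 1))) z := fun b z => by
          rw [pow_pow_apply, add_comm]
        simp only [LinearMap.add_apply, LinearMap.comp_apply, map_add, pow_skew hX, h3,
          pow_pow_apply X a (s + 1)]
        ring
      rw [hexp, hpow (a + (s + 1) + (s + 1)) (by omega)]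
      simp only [LinearMap.zero_apply, map_zero, mul_zero, add_zero]
      rcases Nat.lt_or_ge m a with hma | hma
      · rw [hea a ha1 (by omega), hpow (a + (s + 1)) (by omega)]
        simp
      · obtain rfl : a = m := by omega
        rw [hψe, hψe, hT1, hT2, hb]
        have h3 : ((-1 : F) ^ (s + 1)) * (-1) ^ (s + 1) = 1 := by rw [← mul_pow]; simp
        have h4 : (2 : F) * 2⁻¹ = 1 := mul_inv_cancel₀ h2
        linear_combination (-2⁻¹ * B (e u) ((X ^ a) (e v))) * h3 - B (e u) ((X ^ a) (e v)) * h4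

/-- Induction on the order of nilpotency: the strings of maximal length, with orthogonal heads, span
a nondegenerate `X`-stable subspace, and `X` has smaller order on its orthogonal complement. -/
theorem exists_stringDecomp (h2 : (2 : F) ≠ 0) (N : ℕ) :
    ∀ {V : Type _} [AddCommGroup V] [Module F V] [FiniteDimensional F V]
      {B : LinearMap.BilinForm F V} (_ : ∀ x y, B x y = B y x)
      (_ : ∀ x, (∀ y, B x y = 0) → x = 0) {X : Module.End F V}
      (_ : ∀ x y, B (X x) y = -B x (X y)) (_ : X ^ N = 0), ∃ L, StringDecomp B X L := by
  induction N with
  | zero =>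
    intro V _ _ _ B _ _ X _ hN
    have : Subsingleton V := ⟨fun x y => by
      have h : ∀ z : V, z = 0 := fun z => by
        have := congrArg (fun f : Module.End F V => f z) hN
        simpa using this
      rw [h x, h y]⟩
    exact ⟨fun _ => ⊥, fun j u _ => Subsingleton.elim _ _, fun i j a _ u _ v _ => by
      rw [Subsingleton.elim u 0]; simp, fun j u _ _ => Subsingleton.elim _ _,
      fun W _ => Subsingleton.elim _ _⟩
  | succ N ih =>
    intro V _ _ _ B hs hnd X hX hN
    obtain ⟨C, hC⟩ := (LinearMap.ker (X ^ N)).exists_isCompl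
    have hdec : ∀ x, ∃ z c, (X ^ N) z = 0 ∧ c ∈ C ∧ z + c = x := fun x => by
      obtain ⟨z, c, hz, hc, h⟩ := Submodule.codisjoint_iff_exists_add_eq.1 hC.codisjoint x
      exact ⟨z, c, hz, hc, h⟩
    have hCnd : ∀ u ∈ C, (∀ v ∈ C, B u ((X ^ N) v) = 0) → u = 0 := by
      intro u hu h
      have hker : (X ^ N) u = 0 := hnd _ fun x => by
        obtain ⟨z, c, hz, hc, rfl⟩ := hdec x
        rw [pow_skew hX, map_add, hz, zero_add, h c hc, mul_zero]
      exact Submodule.disjoint_def.1 hC.disjoint u hker hu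
    obtain ⟨e, he, hea⟩ := exists_orthogonal_heads h2 hs hX hN hCnd N
    have hψe : ∀ u v : C, B (e u) ((X ^ N) (e v)) = B u ((X ^ N) v) := by
      intro u v
      have h := pow_skew hX N (e u) v
      have h' := pow_skew hX N u v
      rw [he, h'] at h
      rw [he]
      exact (mul_left_cancel₀ (pow_ne_zero _ (by simp)) h).symm
    have hpow : ∀ b, N < b → X ^ b = 0 := fun b hb => pow_eq_zero_of_le (by omega) hN
    have hee : ∀ a, a ≠ N → ∀ u v, B (e u) ((X ^ a) (e v)) = 0 := fun a ha u v => by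
      rcases Nat.lt_or_ge a N with h | h
      · exact hea a h (by omega) u v
      · rw [hpow a (by omega)]; simp
    -- the span of the strings of maximal length
    let Ψ : (Fin (N + 1) → C) →ₗ[F] V := ∑ a : Fin (N + 1),
      LinearMap.comp (X ^ (a : ℕ)) (e ∘ₗ (LinearMap.proj a : (Fin (N + 1) → C) →ₗ[F] C))
    have hΨ : ∀ c, Ψ c = ∑ a : Fin (N + 1), (X ^ (a : ℕ)) (e (c a)) := fun c => by
      simp [Ψ, LinearMap.sum_apply]
    let W := LinearMap.range Ψ
    have hW : ∀ a u, (X ^ a) (e u) ∈ W := by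
      intro a u
      rcases Nat.lt_or_ge N a with h | h
      · rw [hpow a h]; exact W.zero_mem
      · refine ⟨Pi.single ⟨a, by omega⟩ u, ?_⟩
        rw [hΨ, Finset.sum_eq_single ⟨a, by omega⟩]
        · simp
        · intro b _ hb
          simp [Pi.single_eq_of_ne hb]
        · simp
    have hWle : ∀ U : Submodule F V, (∀ a u, (X ^ a) (e u) ∈ U) → W ≤ U := by
      rintro U hU _ ⟨c, rfl⟩
      rw [hΨ]
      exact U.sum_mem fun a _ => hU _ _
    have hWX : ∀ a, ∀ w ∈ W, (X ^ a) w ∈ W := by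
      intro a
      have : W ≤ W.comap (X ^ a) := hWle _ fun b u => by
        rw [Submodule.mem_comap, ← Module.End.mul_apply, ← pow_add]
        exact hW _ _
      exact fun w hw => this hw
    let W' := B.orthogonal W
    have hW' : ∀ x, x ∈ W' ↔ ∀ w ∈ W, B w x = 0 := fun x => LinearMap.BilinForm.mem_orthogonal_iff
    have hdisj : Disjoint W W' := by
      rw [Submodule.disjoint_def]
      rintro _ ⟨c, rfl⟩ hc
      have hc0 : ∀ a, c a = 0 := by
        intro a
        refine Subtype.ext (hCnd _ (c a).2 fun v hv => ?_)
        have h := (hW' _).1 hc _ (hW (N - a) ⟨v, hv⟩)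
        rw [hs, hΨ, map_sum, LinearMap.sum_apply, Finset.sum_eq_single a] at h
        · rw [pow_skew hX, ← Module.End.mul_apply, ← pow_add,
            show (a : ℕ) + (N - a) = N by omega, hψe] at h
          simpa using h
        · intro b _ hb
          have hb' : (b : ℕ) ≠ a := fun h => hb (Fin.ext h)
          rw [pow_skew hX, ← Module.End.mul_apply, ← pow_add, hee _ (by omega), mul_zero]
        · simp
      rw [hΨ]
      exact Finset.sum_eq_zero fun a _ => by rw [hc0 a]; simp
    have hrefl : B.IsRefl := fun x y h => by rw [hs]; exact h
    have hcompl : IsCompl W W' :=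
      (LinearMap.BilinForm.isCompl_orthogonal_iff_disjoint hrefl).2 hdisj
    have hW'X : ∀ x ∈ W', X x ∈ W' := by
      intro x hx
      rw [hW'] at hx ⊢
      intro w hw
      have h := hx _ (hWX 1 w hw)
      rw [pow_one, hX] at h
      exact neg_eq_zero.1 h
    have hW'N : ∀ x ∈ W', (X ^ N) x = 0 := by
      intro x hx
      obtain ⟨z, c, hz, hc, rfl⟩ := hdec x
      rw [hW'] at hx
      have hc0 : (⟨c, hc⟩ : C) = 0 := Subtype.ext (hCnd c hc fun v hv => by
        have h := hx _ (hW N ⟨v, hv⟩)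
        rw [pow_skew hX, map_add, hz, zero_add, ← he ⟨c, hc⟩, hψe] at h
        have h' : B v ((X ^ N) c) = 0 := by simpa using h
        have h3 := pow_skew hX N c v
        rw [hs, h'] at h3
        simpa using h3.symm)
      have : c = 0 := congrArg Subtype.val hc0
      rw [this, add_zero, hz]
    -- the orthogonal complement is handled by induction
    let X' : Module.End F W' := X.restrict hW'X
    have hX'pow : ∀ a (x : W'), ((X' ^ a) x : V) = (X ^ a) x := fun a x => by
      rw [Module.End.pow_restrict, LinearMap.coe_restrict_apply]
    obtain ⟨L', hL'⟩ := ih (V := W') (B := B.restrict W') (X := X')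
      (fun x y => hs x y) (fun x hx => by
        refine Subtype.ext (hnd x fun y => ?_)
        obtain ⟨w, w', hw, hw', rfl⟩ := Submodule.codisjoint_iff_exists_add_eq.1 hcompl.codisjoint y
        rw [map_add, hs x w, (hW' x).1 x.2 w hw, zero_add]
        exact hx ⟨w', hw'⟩)
      (fun x y => hX x y) (by
        ext x
        rw [hX'pow, hW'N x x.2]
        rfl)
    have hX'N : X' ^ N = 0 := by
      ext x
      rw [hX'pow, hW'N x x.2]
      rfl
    have htop : ∀ u ∈ L' (N + 1), u = 0 := fun u hu => hL'.nondeg (N + 1) u hu fun v _ => by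
      rw [Nat.add_sub_cancel, hX'N]
      simp
    have hBW : ∀ w ∈ W, ∀ x ∈ W', B w x = 0 := fun w hw x hx => (hW' x).1 hx w hw
    have hLt : ∀ i, i ≠ N + 1 → ∀ u, u ∈ (if i = N + 1 then LinearMap.range e else
        (L' i).map W'.subtype) → ∃ h : u ∈ W', (⟨u, h⟩ : W') ∈ L' i := by
      intro i hi u hu
      rw [if_neg hi] at hu
      obtain ⟨u, hu, rfl⟩ := hu
      exact ⟨u.2, hu⟩
    have hLe : ∀ i, i = N + 1 → ∀ u, u ∈ (if i = N + 1 then LinearMap.range e else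
        (L' i).map W'.subtype) → ∃ c, e c = u := by
      intro i hi u hu
      rw [if_pos hi] at hu
      exact hu
    have hW'pow : ∀ a, ∀ x ∈ W', (X ^ a) x ∈ W' := fun a x hx => by
      rw [← hX'pow a ⟨x, hx⟩]
      exact Subtype.property _
    refine ⟨fun j => if j = N + 1 then LinearMap.range e else (L' j).map W'.subtype, ?_, ?_, ?_, ?_⟩
    · intro j u hu
      by_cases hj : j = N + 1
      · rw [hj, hN]; rfl
      · obtain ⟨h, hu'⟩ := hLt j hj u hu
        rw [← hX'pow j ⟨u, h⟩, hL'.pow_eq_zero j _ hu']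
        rfl
    · intro i j a hija u hu v hv
      by_cases hi : i = N + 1 <;> by_cases hj : j = N + 1
      · obtain ⟨c, rfl⟩ := hLe i hi u hu
        obtain ⟨c', rfl⟩ := hLe j hj v hv
        exact hee a (by omega) c c'
      · obtain ⟨c, rfl⟩ := hLe i hi u hu
        obtain ⟨h, hv'⟩ := hLt j hj v hv
        exact hBW _ (hW 0 c) _ (hW'pow a v h)
      · obtain ⟨h, hu'⟩ := hLt i hi u hu
        obtain ⟨c', rfl⟩ := hLe j hj v hv
        rw [hs]
        exact hBW _ (hW a c') _ h
      · obtain ⟨h, hu'⟩ := hLt i hi u hu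
        obtain ⟨h', hv'⟩ := hLt j hj v hv
        have h0 : B u (((X' ^ a) ⟨v, h'⟩ : W') : V) = 0 := hL'.orth i j a hija _ hu' _ hv'
        rwa [hX'pow] at h0
    · intro j u hu huv
      by_cases hj : j = N + 1
      · obtain ⟨c, rfl⟩ := hLe j hj u hu
        subst hj
        have : c = 0 := Subtype.ext (hCnd c c.2 fun v hv => by
          rw [← hψe c ⟨v, hv⟩]
          exact huv _ (by rw [if_pos rfl]; exact ⟨_, rfl⟩))
        rw [this, map_zero]
      · obtain ⟨h, hu'⟩ := hLt j hj u hu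
        refine congrArg Subtype.val (hL'.nondeg j _ hu' fun v hv => ?_)
        have := huv v (by rw [if_neg hj]; exact ⟨v, hv, rfl⟩)
        rwa [← hX'pow] at this
    · intro U hU
      have h1 : W ≤ U := hWle U fun a u =>
        hU (N + 1) (e u) (by rw [if_pos rfl]; exact ⟨u, rfl⟩) a
      have h3 := hL'.span (U.comap W'.subtype) fun j u hu a => by
        rw [Submodule.mem_comap, Submodule.subtype_apply, hX'pow]
        by_cases hj : j = N + 1
        · rw [htop u (hj ▸ hu)]
          simp
        · exact hU j u (by rw [if_neg hj]; exact ⟨u, hu, rfl⟩) a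
      have h4 : W' ≤ U := fun x hx => by
        have : (⟨x, hx⟩ : W') ∈ U.comap W'.subtype := h3 ▸ Submodule.mem_top
        exact this
      exact top_le_iff.1 (hcompl.sup_eq_top ▸ sup_le h1 h4)

end Strings


/-! ### Bases of strings -/

section StringBases

variable {F : Type*} [Field F] {V : Type*} [AddCommGroup V] [Module F V]

/-- The index set of a basis that consists of `m j` strings of length `j` for every `j`. -/
abbrev StringIndex (m : ℕ → ℕ) : Type := (p : (j : ℕ) × Fin (m j)) × Fin p.1

/-- The basis `b` consists of strings for `X`: within a string, `X` maps each vector to the next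
one, and the last one to zero. -/
def IsStringBasis (X : Module.End F V) {m : ℕ → ℕ} (b : Module.Basis (StringIndex m) F V) : Prop :=
  ∀ (p : (j : ℕ) × Fin (m j)) (j : Fin p.1),
    X (b ⟨p, j⟩) = if h : (j : ℕ) + 1 < p.1 then b ⟨p, ⟨(j : ℕ) + 1, h⟩⟩ else 0

theorem hasJordanType_iff {X : Module.End F V} {n : ℕ} {lam : n.Partition} :
    HasJordanType X lam ↔
      ∃ b : Module.Basis (StringIndex fun j => lam.parts.count j) F V, IsStringBasis X b :=
  Iff.rfl

/-- A decomposition into strings, as in `StringDecomp`, with coordinates on the spaces of heads. -/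
structure StringFrame (B : LinearMap.BilinForm F V) (X : Module.End F V) {m : ℕ → ℕ}
    (e : ∀ j, (Fin (m j) → F) →ₗ[F] V) : Prop where
  pow_eq_zero : ∀ j w, (X ^ j) (e j w) = 0
  orth : ∀ i j a, ¬ (i = j ∧ a + 1 = j) → ∀ u v, B (e i u) ((X ^ a) (e j v)) = 0
  nondeg : ∀ j u, (∀ v, B (e j u) ((X ^ (j - 1)) (e j v)) = 0) → u = 0
  span : ∀ W : Submodule F V, (∀ j u a, (X ^ a) (e j u) ∈ W) → W = ⊤

theorem StringDecomp.exists_frame [FiniteDimensional F V] {B : LinearMap.BilinForm F V}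
    {X : Module.End F V} {L : ℕ → Submodule F V} (h : StringDecomp B X L) :
    ∃ e : ∀ j, (Fin (Module.finrank F (L j)) → F) →ₗ[F] V, StringFrame B X e := by
  let c : ∀ j, (Fin (Module.finrank F (L j)) → F) ≃ₗ[F] L j := fun j =>
    (Module.finBasis F (L j)).equivFun.symm
  refine ⟨fun j => (L j).subtype ∘ₗ (c j).toLinearMap, ?_, ?_, ?_, ?_⟩
  · exact fun j w => h.pow_eq_zero j _ (c j w).2
  · exact fun i j a hija u v => h.orth i j a hija _ (c i u).2 _ (c j v).2
  · intro j u hu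
    refine (c j).map_eq_zero_iff.1 (Subtype.ext (h.nondeg j _ (c j u).2 fun v hv => ?_))
    have := hu ((c j).symm ⟨v, hv⟩)
    rwa [LinearMap.comp_apply, LinearMap.comp_apply, LinearEquiv.coe_coe,
      LinearEquiv.apply_symm_apply] at this
  · intro W hW
    refine h.span W fun j u hu a => ?_
    have := hW j ((c j).symm ⟨u, hu⟩) a
    rwa [LinearMap.comp_apply, LinearEquiv.coe_coe, LinearEquiv.apply_symm_apply] at this

namespace StringFrame

variable {B : LinearMap.BilinForm F V} {X : Module.End F V} {m : ℕ → ℕ}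
  {e : ∀ j, (Fin (m j) → F) →ₗ[F] V}

/-- The vectors of the strings. -/
def vec (X : Module.End F V) (e : ∀ j, (Fin (m j) → F) →ₗ[F] V) (x : StringIndex m) : V :=
  (X ^ (x.2 : ℕ)) (e x.1.1 (Pi.single x.1.2 1))

/-- The form `B u (X ^ (j - 1) v)` on the heads of the strings of length `j`. -/
def headForm (B : LinearMap.BilinForm F V) (X : Module.End F V)
    (e : ∀ j, (Fin (m j) → F) →ₗ[F] V) (j : ℕ) : LinearMap.BilinForm F (Fin (m j) → F) :=
  B.compl₁₂ (e j) ((X ^ (j - 1)).comp (e j))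

theorem headForm_apply (j : ℕ) (u v : Fin (m j) → F) :
    headForm B X e j u v = B (e j u) ((X ^ (j - 1)) (e j v)) := rfl

theorem eq_zero_of_zero (h : StringFrame B X e) : m 0 = 0 := by
  by_contra h0
  let i : Fin (m 0) := ⟨0, Nat.pos_of_ne_zero h0⟩
  have h1 := h.nondeg 0 (Pi.single i 1) fun v => by
    have := h.pow_eq_zero 0 v
    rw [pow_zero, Module.End.one_apply] at this
    rw [this, map_zero, map_zero]
  have := congrFun h1 i
  simp at this

theorem apply_pow_pow (h : StringFrame B X e) (hX : ∀ x y, B (X x) y = -B x (X y))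
    (i j a c : ℕ) (u : Fin (m i) → F) (v : Fin (m j) → F) (hij : ¬ (i = j ∧ a + c + 1 = j)) :
    B ((X ^ a) (e i u)) ((X ^ c) (e j v)) = 0 := by
  rw [pow_skew hX, pow_pow_apply, h.orth i j _ hij, mul_zero]

theorem apply_pow_pow_self (hX : ∀ x y, B (X x) y = -B x (X y)) (j a c : ℕ)
    (u v : Fin (m j) → F) (hj : a + c + 1 = j) :
    B ((X ^ a) (e j u)) ((X ^ c) (e j v)) = (-1) ^ a * headForm B X e j u v := by
  rw [pow_skew hX, pow_pow_apply, headForm_apply, show a + c = j - 1 by omega]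

theorem headForm_nondegenerate (h : StringFrame B X e) (j : ℕ) :
    (headForm B X e j).Nondegenerate := by
  have h1 : LinearMap.ker (headForm B X e j) = ⊥ := by
    rw [LinearMap.ker_eq_bot']
    exact fun u hu => h.nondeg j u fun v => by rw [← headForm_apply, hu]; rfl
  exact LinearMap.BilinForm.nondegenerate_iff_ker_eq_bot.2 h1

/-- The pairing with a suitable vector picks out the coordinate at any given index. -/
theorem exists_dual (h : StringFrame B X e) (hX : ∀ x y, B (X x) y = -B x (X y))
    (x : StringIndex m) : ∃ y, ∀ x', B (vec X e x') y = if x' = x then 1 else 0 := by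
  obtain ⟨⟨j, i⟩, a, ha⟩ := x
  change a < j at ha
  obtain ⟨v, hv⟩ : ∃ v, ∀ u, headForm B X e j u v = u i := by
    have hnd := (h.headForm_nondegenerate j).flip
    refine ⟨(LinearMap.BilinForm.toDual _ hnd).symm (LinearMap.proj i), fun u => ?_⟩
    have := LinearMap.BilinForm.apply_toDual_symm_apply (hB := hnd) (LinearMap.proj i) u
    exact this
  refine ⟨(-1 : F) ^ a • (X ^ (j - 1 - a)) (e j v), ?_⟩
  rintro ⟨⟨j', i'⟩, a', ha'⟩
  change a' < j' at ha'
  rw [map_smul, smul_eq_mul, vec]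
  by_cases hj : j' = j ∧ a' = a
  · obtain ⟨rfl, rfl⟩ := hj
    have ha1 : a' + (j' - 1 - a') + 1 = j' := by omega
    rw [apply_pow_pow_self hX _ _ _ _ _ ha1, hv, ← mul_assoc, ← mul_pow]
    by_cases hi : i' = i
    · subst hi; simp
    · rw [if_neg (by simpa using hi)]
      simp [Pi.single_eq_of_ne (Ne.symm hi)]
  · have hj' : ¬ (j' = j ∧ a' + (j - 1 - a) + 1 = j) := by omega
    rw [h.apply_pow_pow hX _ _ _ _ _ _ hj', mul_zero, if_neg]
    rintro heq
    apply hj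
    cases heq
    exact ⟨rfl, rfl⟩

theorem linearIndependent_vec (h : StringFrame B X e) (hX : ∀ x y, B (X x) y = -B x (X y)) :
    LinearIndependent F (vec X e) := by
  choose y hy using h.exists_dual hX
  refine LinearIndependent.of_pairwise_dual_eq_zero_one _ (fun x => B.flip (y x)) ?_ ?_
  · intro x x' hx
    simp [hy, hx.symm]
  · intro x
    simp [hy]

theorem span_vec (h : StringFrame B X e) : Submodule.span F (Set.range (vec X e)) = ⊤ := by
  refine h.span _ fun j u a => ?_
  rcases Nat.lt_or_ge a j with ha | ha
  · rw [← (Pi.basisFun F (Fin (m j))).sum_repr u, map_sum, map_sum]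
    refine Submodule.sum_mem _ fun i _ => ?_
    rw [map_smul, map_smul, Pi.basisFun_apply]
    exact Submodule.smul_mem _ _ (Submodule.subset_span ⟨⟨⟨j, i⟩, ⟨a, ha⟩⟩, rfl⟩)
  · rw [pow_apply_eq_zero_of_le (h.pow_eq_zero j u) ha]
    exact Submodule.zero_mem _

/-- The basis of the vectors of the strings. -/
def basis (h : StringFrame B X e) (hX : ∀ x y, B (X x) y = -B x (X y)) :
    Module.Basis (StringIndex m) F V :=
  Module.Basis.mk (h.linearIndependent_vec hX) h.span_vec.ge

theorem basis_apply (h : StringFrame B X e) (hX : ∀ x y, B (X x) y = -B x (X y))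
    (x : StringIndex m) : h.basis hX x = vec X e x := by
  rw [basis, Module.Basis.mk_apply]

theorem isStringBasis (h : StringFrame B X e) (hX : ∀ x y, B (X x) y = -B x (X y)) :
    IsStringBasis X (h.basis hX) := by
  rintro ⟨j, i⟩ ⟨a, ha⟩
  change a < j at ha
  rw [basis_apply, vec, ← Module.End.mul_apply, ← pow_succ']
  dsimp only
  split_ifs with hlt
  · rw [basis_apply, vec]
  · rw [show a + 1 = j by omega]
    exact h.pow_eq_zero j _

/-- The form is automatically nondegenerate. -/
theorem eq_zero_of_forall (h : StringFrame B X e) (hX : ∀ x y, B (X x) y = -B x (X y)) {z : V}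
    (hz : ∀ y, B z y = 0) : z = 0 := by
  choose y hy using h.exists_dual hX
  refine (h.basis hX).ext_elem fun x => ?_
  have h1 : B.flip (y x) = (h.basis hX).coord x := (h.basis hX).ext fun x' => by
    rw [LinearMap.BilinForm.flip_apply, basis_apply, hy, Module.Basis.coord_apply,
      ← basis_apply h hX, Module.Basis.repr_self, Finsupp.single_apply]
  have h2 := congrArg (fun f => f z) h1
  rw [LinearMap.BilinForm.flip_apply, hz] at h2
  rw [map_zero]
  exact h2.symm

end StringFrame

end StringBases

/-! ### Uniqueness of the lengths of the strings -/

section Uniqueness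

variable {F : Type*} [Field F] {V : Type*} [AddCommGroup V] [Module F V]

theorem IsStringBasis.pow_apply {X : Module.End F V} {m : ℕ → ℕ}
    {b : Module.Basis (StringIndex m) F V} (hb : IsStringBasis X b) (i : ℕ)
    (p : (j : ℕ) × Fin (m j)) (a : Fin p.1) :
    (X ^ i) (b ⟨p, a⟩) = if h : (a : ℕ) + i < p.1 then b ⟨p, ⟨(a : ℕ) + i, h⟩⟩ else 0 := by
  induction i with
  | zero => simp
  | succ i ih =>
    rw [pow_succ', Module.End.mul_apply, ih]
    by_cases h1 : (a : ℕ) + i < p.1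
    · rw [dif_pos h1, hb]
      rfl
    · rw [dif_neg h1, map_zero, dif_neg (by omega)]

theorem IsStringBasis.range_pow {X : Module.End F V} {m : ℕ → ℕ}
    {b : Module.Basis (StringIndex m) F V} (hb : IsStringBasis X b) (i : ℕ) :
    LinearMap.range (X ^ i) =
      Submodule.span F (Set.range fun x : {x : StringIndex m // i ≤ x.2} => b x) := by
  rw [LinearMap.range_eq_map, ← b.span_eq, Submodule.map_span, ← Set.range_comp]
  refine le_antisymm (Submodule.span_le.2 ?_) (Submodule.span_le.2 ?_)
  · rintro _ ⟨⟨p, a⟩, rfl⟩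
    rw [Function.comp_apply, hb.pow_apply]
    split_ifs with h
    · exact Submodule.subset_span ⟨⟨⟨p, ⟨a + i, h⟩⟩, by simp⟩, rfl⟩
    · exact Submodule.zero_mem _
  · rintro _ ⟨⟨⟨p, a⟩, h⟩, rfl⟩
    dsimp only at h
    have ha := a.2
    refine Submodule.subset_span ⟨⟨p, ⟨a - i, by omega⟩⟩, ?_⟩
    rw [Function.comp_apply, hb.pow_apply, dif_pos (by dsimp only; omega)]
    congr 3
    dsimp only
    omega

theorem IsStringBasis.finrank_range_pow [FiniteDimensional F V] {X : Module.End F V} {m : ℕ → ℕ}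
    {b : Module.Basis (StringIndex m) F V} (hb : IsStringBasis X b) (i : ℕ) :
    Module.finrank F (LinearMap.range (X ^ i)) = Nat.card {x : StringIndex m // i ≤ x.2} := by
  have := Module.Finite.finite_basis b
  have := Fintype.ofFinite {x : StringIndex m // i ≤ x.2}
  rw [hb.range_pow, finrank_span_eq_card, Nat.card_eq_fintype_card]
  exact b.linearIndependent.comp _ Subtype.val_injective

theorem Nat.card_subtype_and_add {α : Type*} [Finite α] (p q : α → Prop) :
    Nat.card {x // p x ∧ q x} + Nat.card {x // p x ∧ ¬ q x} = Nat.card {x // p x} := by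
  classical
  have := Fintype.ofFinite α
  simp only [Nat.card_eq_fintype_card, Fintype.card_subtype, ← Finset.filter_filter]
  exact Finset.card_filter_add_card_filter_not _

/-- The number of strings of length `i + 1` is a second difference of the numbers of vectors
at height at least `i`. -/
theorem card_stringIndex (m : ℕ → ℕ) [Finite (StringIndex m)] (i : ℕ) :
    Nat.card {x : StringIndex m // i ≤ x.2} + Nat.card {x : StringIndex m // i + 2 ≤ x.2} =
      2 * Nat.card {x : StringIndex m // i + 1 ≤ x.2} + m (i + 1) := by
  have h1 : ∀ i, Nat.card {x : StringIndex m // i ≤ (x.2 : ℕ)} =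
      Nat.card {x : StringIndex m // i + 1 ≤ (x.2 : ℕ)} +
        Nat.card {x : StringIndex m // (x.2 : ℕ) = i} := by
    intro i
    rw [← Nat.card_subtype_and_add (fun x : StringIndex m => i ≤ (x.2 : ℕ))
      (fun x => i + 1 ≤ (x.2 : ℕ))]
    congr 3 <;> ext x <;> omega
  have h2 : Nat.card {x : StringIndex m // (x.2 : ℕ) = i} =
      Nat.card {x : StringIndex m // (x.2 : ℕ) = i + 1} + m (i + 1) := by
    rw [← Nat.card_subtype_and_add (fun x : StringIndex m => (x.2 : ℕ) = i)
      (fun x => i + 1 < x.1.1)]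
    congr 1
    · refine Nat.card_congr ⟨fun x => ⟨⟨x.1.1, ⟨i + 1, x.2.2⟩⟩, rfl⟩,
        fun x => ⟨⟨x.1.1, ⟨i, by have := x.1.2.2; have := x.2; omega⟩⟩,
          rfl, by have := x.1.2.2; have := x.2; dsimp only; omega⟩, ?_, ?_⟩
      · rintro ⟨⟨p, a⟩, rfl, h⟩
        rfl
      · rintro ⟨⟨p, ⟨a, ha⟩⟩, h⟩
        dsimp only at h
        subst h
        rfl
    · have h3 : ∀ x : {x : StringIndex m // (x.2 : ℕ) = i ∧ ¬ i + 1 < x.1.1},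
          i + 1 = x.1.1.1 := fun x => by
        have := x.1.2.2
        have := x.2
        omega
      rw [← Nat.card_fin (m (i + 1))]
      refine Nat.card_congr ⟨fun x => Fin.cast (congrArg m (h3 x).symm) x.1.1.2,
        fun y => ⟨⟨⟨i + 1, y⟩, ⟨i, Nat.lt_succ_self i⟩⟩, rfl, lt_irrefl _⟩, ?_, ?_⟩
      · rintro ⟨⟨⟨j, p⟩, ⟨a, ha⟩⟩, h, h'⟩
        dsimp only at h h' ha
        obtain rfl : j = i + 1 := by omega
        subst h
        rfl
      · intro y
        rfl
  have h3 := h1 i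
  have h4 := h1 (i + 1)
  rw [h2] at h3
  rw [show i + 1 + 1 = i + 2 from rfl] at h4
  omega

/-- The numbers of strings of each positive length are determined by the endomorphism. -/
theorem IsStringBasis.eq_of_pos [FiniteDimensional F V] {X : Module.End F V} {m m' : ℕ → ℕ}
    {b : Module.Basis (StringIndex m) F V} (hb : IsStringBasis X b)
    {b' : Module.Basis (StringIndex m') F V} (hb' : IsStringBasis X b') {j : ℕ} (hj : 0 < j) :
    m j = m' j := by
  have := Module.Finite.finite_basis b
  have := Module.Finite.finite_basis b'
  obtain ⟨i, rfl⟩ : ∃ i, j = i + 1 := ⟨j - 1, by omega⟩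
  have h1 := card_stringIndex m i
  have h2 := card_stringIndex m' i
  simp only [← hb.finrank_range_pow] at h1
  simp only [← hb'.finrank_range_pow] at h2
  omega

theorem IsStringBasis.baseChange {X : Module.End F V} {m : ℕ → ℕ}
    {b : Module.Basis (StringIndex m) F V} (hb : IsStringBasis X b) (K : Type*) [Field K]
    [Algebra F K] : IsStringBasis (LinearMap.baseChange K X) (b.baseChange K) := by
  intro p j
  rw [Module.Basis.baseChange_apply, LinearMap.baseChange_tmul, hb]
  split_ifs
  · rw [Module.Basis.baseChange_apply]
  · rw [TensorProduct.tmul_zero]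

end Uniqueness


/-! ### Alternating forms -/

section Alternating

variable {F : Type*} [Field F]

theorem isAlt_of_skew (h2 : (2 : F) ≠ 0) {V : Type*} [AddCommGroup V] [Module F V]
    {φ : LinearMap.BilinForm F V} (hs : ∀ x y, φ x y = -φ y x) (x : V) : φ x x = 0 := by
  have h := hs x x
  have h3 : 2 * φ x x = 0 := by linear_combination h
  exact (mul_eq_zero.1 h3).resolve_left h2

/-- A hyperbolic pair in an alternating space, with the codimension of its orthogonal complement. -/
theorem exists_pair_eq_one (h2 : (2 : F) ≠ 0) {V : Type*} [AddCommGroup V] [Module F V]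
    [FiniteDimensional F V] (φ : LinearMap.BilinForm F V) (hs : ∀ x y, φ x y = -φ y x)
    (hnd : ∀ x, (∀ y, φ x y = 0) → x = 0) (hV : 0 < Module.finrank F V) :
    ∃ x y, φ x y = 1 ∧
      Module.finrank F (LinearMap.ker ((φ x).prod (φ y))) + 2 = Module.finrank F V := by
  have : Nontrivial V := Module.finrank_pos_iff.1 hV
  obtain ⟨x, hx⟩ := exists_ne (0 : V)
  obtain ⟨y, hy⟩ : ∃ y, φ x y ≠ 0 := by
    by_contra! h
    exact hx (hnd x h)
  have hxy : φ x ((φ x y)⁻¹ • y) = 1 := by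
    rw [map_smul, smul_eq_mul, inv_mul_cancel₀ hy]
  refine ⟨x, (φ x y)⁻¹ • y, hxy, ?_⟩
  generalize (φ x y)⁻¹ • y = z at hxy
  have hsurj : LinearMap.range ((φ x).prod (φ z)) = ⊤ := by
    rw [LinearMap.range_eq_top]
    rintro ⟨s, t⟩
    refine ⟨s • z - t • x, ?_⟩
    have h1 : φ z x = -1 := by rw [hs, hxy]
    simp [isAlt_of_skew h2 hs, hxy, h1]
  have h := LinearMap.finrank_range_add_finrank_ker ((φ x).prod (φ z))
  rw [hsurj, finrank_top, Module.finrank_prod, Module.finrank_self] at h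
  omega

/-- The orthogonal complement of a hyperbolic pair is nondegenerate. -/
theorem eq_zero_of_pair (h2 : (2 : F) ≠ 0) {V : Type*} [AddCommGroup V] [Module F V]
    (φ : LinearMap.BilinForm F V) (hs : ∀ x y, φ x y = -φ y x)
    (hnd : ∀ x, (∀ y, φ x y = 0) → x = 0) (x y : V) (hxy : φ x y = 1) (v : V) (hv1 : φ x v = 0)
    (hv2 : φ y v = 0) (hv : ∀ w, φ x w = 0 → φ y w = 0 → φ v w = 0) : v = 0 := by
  refine hnd v fun u => ?_
  have h1 : φ y x = -1 := by rw [hs, hxy]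
  have h := hv (u - φ x u • y + φ y u • x) (by simp [isAlt_of_skew h2 hs, hxy])
    (by simp [isAlt_of_skew h2 hs, h1])
  have h3 : φ v x = 0 := by rw [hs, hv1, neg_zero]
  have h4 : φ v y = 0 := by rw [hs, hv2, neg_zero]
  simpa [h3, h4] using h

/-- Nondegenerate alternating forms on spaces of the same dimension are isometric. -/
theorem exists_isometry_of_skew (h2 : (2 : F) ≠ 0) (n : ℕ) :
    ∀ {V V' : Type _} [AddCommGroup V] [Module F V] [FiniteDimensional F V]
      [AddCommGroup V'] [Module F V'] [FiniteDimensional F V']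
      (φ : LinearMap.BilinForm F V) (φ' : LinearMap.BilinForm F V')
      (_ : ∀ x y, φ x y = -φ y x) (_ : ∀ x y, φ' x y = -φ' y x)
      (_ : ∀ x, (∀ y, φ x y = 0) → x = 0) (_ : ∀ x, (∀ y, φ' x y = 0) → x = 0)
      (_ : Module.finrank F V = n) (_ : Module.finrank F V' = n),
      ∃ f : V ≃ₗ[F] V', ∀ x y, φ' (f x) (f y) = φ x y := by
  induction n using Nat.strong_induction_on with
  | _ n ih =>
    intro V V' _ _ _ _ _ _ φ φ' hs hs' hnd hnd' hV hV'
    rcases Nat.eq_zero_or_pos n with rfl | hn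
    · have := Module.finrank_zero_iff.1 hV
      refine ⟨LinearEquiv.ofFinrankEq V V' (hV.trans hV'.symm), fun x y => ?_⟩
      rw [Subsingleton.elim x 0, map_zero, map_zero, map_zero]
      rfl
    obtain ⟨x, y, hxy, hW⟩ := exists_pair_eq_one h2 φ hs hnd (hV ▸ hn)
    obtain ⟨x', y', hxy', hW'⟩ := exists_pair_eq_one h2 φ' hs' hnd' (hV' ▸ hn)
    have hyx : φ y x = -1 := by rw [hs, hxy]
    have hyx' : φ' y' x' = -1 := by rw [hs', hxy']
    let W := LinearMap.ker ((φ x).prod (φ y))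
    let W' := LinearMap.ker ((φ' x').prod (φ' y'))
    have memW : ∀ v, v ∈ W ↔ φ x v = 0 ∧ φ y v = 0 := fun v => by
      simp [W]
    have memW' : ∀ v, v ∈ W' ↔ φ' x' v = 0 ∧ φ' y' v = 0 := fun v => by
      simp [W']
    obtain ⟨f, hf⟩ := ih (n - 2) (by omega) (V := W) (V' := W') (φ.restrict W) (φ'.restrict W')
      (fun u v => hs u v) (fun u v => hs' u v)
      (fun v hv => Subtype.ext (eq_zero_of_pair h2 φ hs hnd x y hxy v ((memW v).1 v.2).1
        ((memW v).1 v.2).2 fun w h1 h2 => hv ⟨w, (memW w).2 ⟨h1, h2⟩⟩))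
      (fun v hv => Subtype.ext (eq_zero_of_pair h2 φ' hs' hnd' x' y' hxy' v ((memW' v).1 v.2).1
        ((memW' v).1 v.2).2 fun w h1 h2 => hv ⟨w, (memW' w).2 ⟨h1, h2⟩⟩))
      (Nat.eq_sub_of_add_eq (hW.trans hV)) (Nat.eq_sub_of_add_eq (hW'.trans hV'))
    let π : V →ₗ[F] W := LinearMap.codRestrict W
      (LinearMap.id - (φ x).smulRight y + (φ y).smulRight x) fun v => by
        rw [memW]
        constructor
        · simp [isAlt_of_skew h2 hs, hxy]
        · simp [isAlt_of_skew h2 hs, hyx]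
    have hπ : ∀ v, (π v : V) = v - φ x v • y + φ y v • x := fun v => rfl
    let g : V →ₗ[F] V' := W'.subtype ∘ₗ f.toLinearMap ∘ₗ π + (φ x).smulRight y'
      - (φ y).smulRight x'
    have hg : ∀ v, g v = f (π v) + φ x v • y' - φ y v • x' := fun v => rfl
    have hgφ : ∀ u v, φ' (g u) (g v) = φ u v := by
      intro u v
      have hf' : φ' (f (π u)) (f (π v)) = φ (π u) (π v) := hf (π u) (π v)
      have h1 : ∀ w : W', φ' x' w = 0 ∧ φ' y' w = 0 := fun w => (memW' w).1 w.2
      have h3 : ∀ w : W', φ' w x' = 0 ∧ φ' w y' = 0 := fun w =>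
        ⟨by rw [hs', (h1 w).1, neg_zero], by rw [hs', (h1 w).2, neg_zero]⟩
      rw [hπ, hπ] at hf'
      simp only [hg, map_add, map_sub, map_smul, LinearMap.add_apply, LinearMap.sub_apply,
        LinearMap.smul_apply, smul_eq_mul, h1, h3, hxy', hyx', isAlt_of_skew h2 hs', hf', hxy, hyx,
        isAlt_of_skew h2 hs, hs u x, hs u y]
      ring
    have hinj : Function.Injective g := (injective_iff_map_eq_zero g).2 fun u hu =>
      hnd u fun v => by rw [← hgφ, hu]; simp
    exact ⟨LinearEquiv.ofInjectiveOfFinrankEq g hinj (hV.trans hV'.symm), hgφ⟩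

/-- The alternating form on a coordinate space of even dimension `m` that pairs opposite
coordinates. -/
theorem exists_skew_form {m : ℕ} (hm : Even m) :
    ∃ φ : LinearMap.BilinForm F (Fin m → F), (∀ x y, φ x y = -φ y x) ∧
      ∀ x, (∀ y, φ x y = 0) → x = 0 := by
  let ε : Fin m → F := fun i => if 2 * (i : ℕ) < m then 1 else -1
  have hε : ∀ i, ε i.rev = -ε i := fun i => by
    obtain ⟨r, hr⟩ := hm
    have := i.2
    simp only [ε, Fin.val_rev]
    by_cases h : 2 * (i : ℕ) < m
    · rw [if_pos h, if_neg (by omega)]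
    · rw [if_neg h, if_pos (by omega), neg_neg]
  let φ : LinearMap.BilinForm F (Fin m → F) := ∑ i, ε i •
    (LinearMap.mul F F).compl₁₂ (LinearMap.proj i) (LinearMap.proj i.rev)
  have hφ : ∀ x y, φ x y = ∑ i, ε i * (x i * y i.rev) := fun x y => by
    simp [φ, LinearMap.sum_apply]
  refine ⟨φ, fun x y => ?_, fun x hx => ?_⟩
  · rw [hφ, hφ, ← Finset.sum_neg_distrib, ← Equiv.sum_comp Fin.revPerm]
    refine Finset.sum_congr rfl fun i _ => ?_
    rw [Fin.revPerm_apply, Fin.rev_rev, hε]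
    ring
  · funext i
    have h := hx (Pi.single i.rev 1)
    rw [hφ, Finset.sum_eq_single i] at h
    · have hi : ε i ≠ 0 := by
        simp only [ε]
        split_ifs <;> simp
      simpa [hi] using h
    · intro j _ hj
      rw [Pi.single_eq_of_ne (by simpa using hj)]
      ring
    · simp

end Alternating

/-! ### The forms on the heads of the strings as invariants -/

section Invariants

variable {F : Type*} [Field F] {V : Type*} [AddCommGroup V] [Module F V]

theorem IsStringBasis.exists_pow_eq_zero [FiniteDimensional F V] {X : Module.End F V} {m : ℕ → ℕ}
    {b : Module.Basis (StringIndex m) F V} (hb : IsStringBasis X b) : ∃ N, X ^ N = 0 := by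
  have := Module.Finite.finite_basis b
  have := Fintype.ofFinite (StringIndex m)
  refine ⟨∑ x : StringIndex m, x.1.1, b.ext fun x => ?_⟩
  have h := Finset.single_le_sum (f := fun x : StringIndex m => x.1.1) (fun _ _ => Nat.zero_le _)
    (Finset.mem_univ x)
  rw [hb.pow_apply, dif_neg (by omega)]
  rfl

/-- If the lengths of the strings of `X` are given by `m`, then `X` has a frame of this type. -/
theorem exists_stringFrame (h2 : (2 : F) ≠ 0) [FiniteDimensional F V]
    {B : LinearMap.BilinForm F V} (hs : ∀ x y, B x y = B y x)
    (hnd : ∀ x, (∀ y, B x y = 0) → x = 0) {X : Module.End F V}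
    (hX : ∀ x y, B (X x) y = -B x (X y)) {m : ℕ → ℕ} (hm : m 0 = 0)
    (hN : IsNilpotent X) (huniq : ∀ (m' : ℕ → ℕ) (b' : Module.Basis (StringIndex m') F V),
      IsStringBasis X b' → ∀ j, 0 < j → m' j = m j) :
    ∃ e : ∀ j, (Fin (m j) → F) →ₗ[F] V, StringFrame B X e := by
  obtain ⟨N, hN⟩ := hN
  obtain ⟨L, hL⟩ := exists_stringDecomp h2 N hs hnd hX hN
  obtain ⟨m', e, he⟩ : ∃ (m' : ℕ → ℕ) (e : ∀ j, (Fin (m' j) → F) →ₗ[F] V), StringFrame B X e :=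
    ⟨_, hL.exists_frame⟩
  obtain rfl : m' = m := by
    funext j
    rcases Nat.eq_zero_or_pos j with rfl | hj
    · rw [hm, he.eq_zero_of_zero]
    · exact huniq m' _ (he.isStringBasis hX) j hj
  exact ⟨e, he⟩

theorem IsStringBasis.ker_pow_le {X : Module.End F V} {m : ℕ → ℕ}
    {b : Module.Basis (StringIndex m) F V} (hb : IsStringBasis X b) (j : ℕ) :
    LinearMap.ker (X ^ j) ≤ Submodule.span F (b '' {x | x.1.1 ≤ x.2 + j}) := by
  intro y hy
  rw [Module.Basis.mem_span_image]
  rintro ⟨p, a⟩ hx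
  rw [Finset.mem_coe, Finsupp.mem_support_iff] at hx
  by_contra hlt
  simp only [Set.mem_ofPred_eq, not_le] at hlt
  apply hx
  have h : b.coord ⟨p, ⟨a + j, hlt⟩⟩ ∘ₗ (X ^ j) = b.coord ⟨p, a⟩ := b.ext fun ⟨q, c⟩ => by
    rw [LinearMap.comp_apply, hb.pow_apply, Module.Basis.coord_apply, Module.Basis.coord_apply,
      b.repr_self, Finsupp.single_apply]
    split_ifs with h1 h3 h3
    · cases h3
      rw [b.repr_self, Finsupp.single_eq_same]
    · rw [b.repr_self, Finsupp.single_apply, if_neg]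
      intro h4
      apply h3
      obtain ⟨rfl, h5⟩ := Sigma.mk.inj_iff.1 h4
      have h6 := Fin.mk.inj_iff.1 (eq_of_heq h5)
      congr 1
      ext
      omega
    · cases h3
      exact absurd hlt h1
    · simp
  have h' := congrArg (fun f => f y) h
  simp only [LinearMap.comp_apply, Module.Basis.coord_apply] at h'
  rw [← h', LinearMap.mem_ker.1 hy]
  simp

namespace StringFrame

variable {V' : Type*} [AddCommGroup V'] [Module F V']
  {B : LinearMap.BilinForm F V} {X : Module.End F V} {m : ℕ → ℕ}
  {e : ∀ j, (Fin (m j) → F) →ₗ[F] V}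
  {B' : LinearMap.BilinForm F V'} {X' : Module.End F V'}
  {e' : ∀ j, (Fin (m j) → F) →ₗ[F] V'}

theorem headForm_swap (hs : ∀ x y, B x y = B y x) (hX : ∀ x y, B (X x) y = -B x (X y)) (j : ℕ)
    (u v : Fin (m j) → F) : headForm B X e j u v = (-1) ^ (j - 1) * headForm B X e j v u := by
  rw [headForm_apply, headForm_apply, ← pow_skew hX, hs]

/-- Vectors killed by `X ^ j` pair with vectors of the form `X ^ (j - 1) (f w)` only through the
component of `f w` at the heads of the strings of length `j`. -/
theorem exists_head (h : StringFrame B X e) (hX : ∀ x y, B (X x) y = -B x (X y)) {j : ℕ}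
    (hj : 0 < j) {W : Type*} [AddCommGroup W] [Module F W] (f : W →ₗ[F] V)
    (hf : ∀ w, (X ^ j) (f w) = 0) :
    ∃ T : W →ₗ[F] (Fin (m j) → F), ∀ w y, (X ^ j) y = 0 →
      B y ((X ^ (j - 1)) (f w)) = B y ((X ^ (j - 1)) (e j (T w))) := by
  have hnd := (h.headForm_nondegenerate j).flip
  let T : W →ₗ[F] (Fin (m j) → F) := (LinearMap.BilinForm.toDual _ hnd).symm.toLinearMap ∘ₗ
    (B.compl₁₂ (e j) ((X ^ (j - 1)).comp f)).flip
  have hT : ∀ w v, headForm B X e j v (T w) = B (e j v) ((X ^ (j - 1)) (f w)) := fun w v =>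
    LinearMap.BilinForm.apply_toDual_symm_apply (hB := hnd) _ v
  refine ⟨T, fun w y hy => ?_⟩
  obtain ⟨z, hz⟩ : ∃ z, z = f w - e j (T w) := ⟨_, rfl⟩
  have hz1 : (X ^ j) z = 0 := by rw [hz, map_sub, hf, h.pow_eq_zero, sub_zero]
  have hz2 : ∀ v, B (e j v) ((X ^ (j - 1)) z) = 0 := fun v => by
    rw [hz, map_sub, map_sub, ← headForm_apply, hT, sub_self]
  suffices hyz : B y ((X ^ (j - 1)) z) = 0 by
    rw [hz, map_sub, map_sub] at hyz
    exact sub_eq_zero.1 hyz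
  suffices hle : Submodule.span F (h.basis hX '' {x | x.1.1 ≤ x.2 + j}) ≤
      LinearMap.ker (B.flip ((X ^ (j - 1)) z)) from
    hle ((h.isStringBasis hX).ker_pow_le j hy)
  rw [Submodule.span_le]
  rintro _ ⟨⟨⟨i, s⟩, a⟩, hx, rfl⟩
  have hx : i ≤ a + j := hx
  rw [SetLike.mem_coe, LinearMap.mem_ker, LinearMap.BilinForm.flip_apply, basis_apply, vec,
    pow_skew hX, pow_pow_apply]
  rcases Nat.eq_zero_or_pos (a : ℕ) with ha | ha
  · rw [ha, zero_add] at hx ⊢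
    rcases hx.eq_or_lt with rfl | hlt
    · rw [hz2, mul_zero]
    · have h3 := pow_skew hX (j - 1) (e i (Pi.single s 1)) z
      rw [pow_apply_eq_zero_of_le (h.pow_eq_zero i _) (by omega : i ≤ j - 1)] at h3
      have h4 : B (e i (Pi.single s 1)) ((X ^ (j - 1)) z) = 0 := by simpa using h3
      rw [h4, mul_zero]
  · have haj : j ≤ (a : ℕ) + (j - 1) := by omega
    rw [pow_apply_eq_zero_of_le hz1 haj, map_zero, mul_zero]

/-- An isometry that intertwines two endomorphisms induces isometries of the forms on the heads of
their strings. -/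
theorem exists_headForm_isometry (h : StringFrame B X e) (h' : StringFrame B' X' e')
    (hX' : ∀ x y, B' (X' x) y = -B' x (X' y))
    (hs' : ∀ x y, B' x y = B' y x) {g : V →ₗ[F] V'} (hg : ∀ x y, B' (g x) (g y) = B x y)
    (hgX : ∀ x, g (X x) = X' (g x)) (j : ℕ) :
    ∃ T : (Fin (m j) → F) ≃ₗ[F] (Fin (m j) → F),
      ∀ u v, headForm B' X' e' j (T u) (T v) = headForm B X e j u v := by
  rcases Nat.eq_zero_or_pos j with rfl | hj
  · have : IsEmpty (Fin (m 0)) := by rw [h.eq_zero_of_zero]; infer_instance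
    refine ⟨LinearEquiv.refl _ _, fun u v => ?_⟩
    rw [Subsingleton.elim u 0, map_zero, map_zero, map_zero]
    rfl
  have hgpow : ∀ a x, g ((X ^ a) x) = (X' ^ a) (g x) := fun a => by
    induction a with
    | zero => simp
    | succ a ih =>
      intro x
      rw [pow_succ, Module.End.mul_apply, ih, hgX, pow_succ, Module.End.mul_apply]
  have hge : ∀ w, (X' ^ j) (g (e j w)) = 0 := fun w => by
    rw [← hgpow, h.pow_eq_zero, map_zero]
  obtain ⟨T, hT⟩ := h'.exists_head hX' hj (g ∘ₗ e j) hge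
  have hT' : ∀ u v, headForm B' X' e' j (T u) (T v) = headForm B X e j u v := by
    intro u v
    have hsw : ∀ y z, B' y ((X' ^ (j - 1)) z) = (-1) ^ (j - 1) * B' z ((X' ^ (j - 1)) y) :=
      fun y z => by rw [← pow_skew hX', hs']
    rw [headForm_apply, ← hT v _ (h'.pow_eq_zero j _), hsw, LinearMap.comp_apply,
      ← hT u _ (hge v), ← hsw, headForm_apply, LinearMap.comp_apply, ← hgpow, hg]
  have hinj : Function.Injective T := (injective_iff_map_eq_zero T).2 fun u hu =>
    h.nondeg j u fun v => by rw [← headForm_apply, ← hT', hu]; simp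
  exact ⟨LinearEquiv.ofInjectiveEndo T hinj, hT'⟩

theorem comp_equiv (h : StringFrame B X e) (T : ∀ j, (Fin (m j) → F) ≃ₗ[F] (Fin (m j) → F)) :
    StringFrame B X fun j => e j ∘ₗ (T j).toLinearMap where
  pow_eq_zero j w := h.pow_eq_zero j _
  orth i j a hij u v := h.orth i j a hij _ _
  nondeg j u hu := (T j).map_eq_zero_iff.1 (h.nondeg j _ fun v => by
    have := hu ((T j).symm v)
    rwa [LinearMap.comp_apply, LinearMap.comp_apply, LinearEquiv.coe_coe,
      LinearEquiv.apply_symm_apply] at this)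
  span W hW := h.span W fun j u a => by
    have := hW j ((T j).symm u) a
    rwa [LinearMap.comp_apply, LinearEquiv.coe_coe, LinearEquiv.apply_symm_apply] at this

/-- Isometries of the forms on the heads of the strings extend to an isometry that intertwines the
endomorphisms. -/
theorem exists_isometry (h : StringFrame B X e) (h' : StringFrame B' X' e')
    (hX : ∀ x y, B (X x) y = -B x (X y)) (hX' : ∀ x y, B' (X' x) y = -B' x (X' y))
    (T : ∀ j, (Fin (m j) → F) ≃ₗ[F] (Fin (m j) → F))
    (hT : ∀ j u v, headForm B' X' e' j (T j u) (T j v) = headForm B X e j u v) :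
    ∃ g : V ≃ₗ[F] V', (∀ x y, B' (g x) (g y) = B x y) ∧ (∀ x, g (X x) = X' (g x)) ∧
      ∀ x, g (h.basis hX x) = vec X' (fun j => e' j ∘ₗ (T j).toLinearMap) x := by
  have h'' := h'.comp_equiv T
  let g : V ≃ₗ[F] V' := (h.basis hX).equiv (h''.basis hX') (Equiv.refl _)
  have hg : ∀ x, g (h.basis hX x) = h''.basis hX' x := fun x => Module.Basis.equiv_apply ..
  refine ⟨g, fun x y => ?_, fun x => ?_, fun x => by rw [hg, basis_apply]⟩
  · have : B'.compl₁₂ g.toLinearMap g.toLinearMap = B := by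
      refine LinearMap.ext_basis (h.basis hX) (h.basis hX) fun ⟨⟨i, s⟩, a⟩ ⟨⟨j, t⟩, c⟩ => ?_
      rw [LinearMap.compl₁₂_apply, LinearEquiv.coe_coe, hg, hg, basis_apply, basis_apply,
        basis_apply, basis_apply, vec, vec, vec, vec]
      dsimp only
      by_cases hij : i = j ∧ (a : ℕ) + c + 1 = j
      · obtain ⟨rfl, hac⟩ := hij
        rw [apply_pow_pow_self hX _ _ _ _ _ hac, ← hT]
        exact apply_pow_pow_self (e := e') hX' _ _ _ _ _ hac
      · rw [h''.apply_pow_pow hX' _ _ _ _ _ _ hij, h.apply_pow_pow hX _ _ _ _ _ _ hij]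
    exact congrArg (fun b => b x y) this
  · have : g.toLinearMap ∘ₗ X = X' ∘ₗ g.toLinearMap := (h.basis hX).ext fun ⟨p, a⟩ => by
      rw [LinearMap.comp_apply, LinearMap.comp_apply, h.isStringBasis hX, LinearEquiv.coe_coe, hg,
        h''.isStringBasis hX']
      split_ifs
      · rw [hg]
      · rw [map_zero]
    exact congrArg (fun f => f x) this

/-- The forms attached to even lengths carry no information. -/
theorem exists_headForm_isometry_of_even (h2 : (2 : F) ≠ 0) (h : StringFrame B X e)
    (h' : StringFrame B' X' e')
    (hs : ∀ x y, B x y = B y x) (hX : ∀ x y, B (X x) y = -B x (X y))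
    (hs' : ∀ x y, B' x y = B' y x) (hX' : ∀ x y, B' (X' x) y = -B' x (X' y)) {j : ℕ}
    (hj : Even j) :
    ∃ T : (Fin (m j) → F) ≃ₗ[F] (Fin (m j) → F),
      ∀ u v, headForm B' X' e' j (T u) (T v) = headForm B X e j u v := by
  rcases Nat.eq_zero_or_pos j with rfl | hpos
  · have : IsEmpty (Fin (m 0)) := by rw [h.eq_zero_of_zero]; infer_instance
    refine ⟨LinearEquiv.refl _ _, fun u v => ?_⟩
    rw [Subsingleton.elim u 0, map_zero, map_zero, map_zero]
    rfl
  have hodd : (-1 : F) ^ (j - 1) = -1 := Odd.neg_one_pow (Nat.Even.sub_odd hpos hj odd_one)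
  refine exists_isometry_of_skew h2 (m j) _ _ (fun u v => ?_) (fun u v => ?_) (h.nondeg j)
    (h'.nondeg j) (by simp) (by simp)
  · rw [headForm_swap hs hX, hodd, neg_one_mul]
  · rw [headForm_swap hs' hX', hodd, neg_one_mul]

end StringFrame

end Invariants


/-! ### The Witt class of a space with strings -/

section WittClassFormula

variable {F : Type*} [Field F] {V : Type*} [AddCommGroup V] [Module F V]

/-- The quadratic form induced on the middles `X ^ ((j - 1) / 2) (e j w)` of the strings of odd
length `j`. -/
def midForm (Q : QuadraticForm F V) (X : Module.End F V) {m : ℕ → ℕ}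
    (e : ∀ j, (Fin (m j) → F) →ₗ[F] V) (j : ℕ) : QuadraticForm F (Fin (m j) → F) :=
  Q.comp ((X ^ ((j - 1) / 2)).comp (e j))

variable {Q : QuadraticForm F V} {X : Module.End F V} {m : ℕ → ℕ}
  {e : ∀ j, (Fin (m j) → F) →ₗ[F] V}

theorem polar_midForm (hX : ∀ x y, Q.polarBilin (X x) y = -Q.polarBilin x (X y)) {j : ℕ}
    (hj : Odd j) (u v : Fin (m j) → F) : QuadraticMap.polar (midForm Q X e j) u v =
      (-1) ^ ((j - 1) / 2) * StringFrame.headForm Q.polarBilin X e j u v := by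
  rw [← StringFrame.apply_pow_pow_self hX j ((j - 1) / 2) ((j - 1) / 2) u v
    (by obtain ⟨r, rfl⟩ := hj; omega)]
  exact (polar_of_isometry (Q := midForm Q X e j) (Q' := Q) ((X ^ ((j - 1) / 2)).comp (e j))
    (fun _ => rfl) u v).symm

theorem StringFrame.midForm_nondegenerate (h : StringFrame Q.polarBilin X e)
    (hX : ∀ x y, Q.polarBilin (X x) y = -Q.polarBilin x (X y)) {j : ℕ} (hj : Odd j) :
    (midForm Q X e j).polarBilin.Nondegenerate := by
  rw [QuadraticMap.nondegenerate_iff]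
  intro u hu
  refine h.nondeg j u fun v => ?_
  have := hu v
  rw [polar_midForm hX hj] at this
  exact (mul_eq_zero.1 this).resolve_left (by simp)

theorem apply_eq_zero_of_mem_span (h2 : (2 : F) ≠ 0) {ι : Type*} {y : ι → V}
    (h : ∀ i j, QuadraticMap.polar Q (y i) (y j) = 0) {z : V}
    (hz : z ∈ Submodule.span F (Set.range y)) : Q z = 0 := by
  have h1 : ∀ i, ∀ z ∈ Submodule.span F (Set.range y), Q.polarBilin z (y i) = 0 := by
    intro i
    suffices Submodule.span F (Set.range y) ≤ LinearMap.ker (Q.polarBilin.flip (y i)) from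
      fun z hz => this hz
    rw [Submodule.span_le]
    rintro _ ⟨j, rfl⟩
    exact h j i
  have h3 : Submodule.span F (Set.range y) ≤ LinearMap.ker (Q.polarBilin z) := by
    rw [Submodule.span_le]
    rintro _ ⟨i, rfl⟩
    exact h1 i z hz
  have h4 : QuadraticMap.polar Q z z = 0 := h3 hz
  rw [QuadraticMap.polar_self, two_smul, ← two_mul] at h4
  exact (mul_eq_zero.1 h4).resolve_left h2

/-- Reversing the strings exchanges the lower and the upper halves, which meet in the middles. -/
theorem two_mul_card_upper (m : ℕ → ℕ) [Finite (StringIndex m)] :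
    2 * Nat.card {x : StringIndex m // x.1.1 ≤ 2 * (x.2 : ℕ) + 1} =
      Nat.card (StringIndex m) + Nat.card {x : StringIndex m // x.1.1 = 2 * (x.2 : ℕ) + 1} := by
  have h1 := Nat.card_subtype_and_add (fun _ : StringIndex m => True)
    (fun x => x.1.1 ≤ 2 * (x.2 : ℕ) + 1)
  have h2 := Nat.card_subtype_and_add (fun x : StringIndex m => x.1.1 ≤ 2 * (x.2 : ℕ) + 1)
    (fun x => x.1.1 = 2 * (x.2 : ℕ) + 1)
  have h3 : Nat.card {x : StringIndex m // True ∧ ¬ x.1.1 ≤ 2 * (x.2 : ℕ) + 1} =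
      Nat.card {x : StringIndex m // x.1.1 ≤ 2 * (x.2 : ℕ) + 1 ∧ ¬ x.1.1 = 2 * (x.2 : ℕ) + 1} := by
    refine Nat.card_congr ⟨fun x => ⟨⟨x.1.1, x.1.2.rev⟩, ?_⟩, fun x => ⟨⟨x.1.1, x.1.2.rev⟩, ?_⟩,
      fun x => Subtype.ext ?_, fun x => Subtype.ext ?_⟩
    · obtain ⟨⟨p, a⟩, -, h⟩ := x
      have := a.2
      simp only [Fin.val_rev] at h ⊢
      omega
    · obtain ⟨⟨p, a⟩, h⟩ := x
      have := a.2
      refine ⟨trivial, ?_⟩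
      simp only [Fin.val_rev] at h ⊢
      omega
    · simp
    · simp
  have h4 : Nat.card {x : StringIndex m // True ∧ x.1.1 ≤ 2 * (x.2 : ℕ) + 1} =
      Nat.card {x : StringIndex m // x.1.1 ≤ 2 * (x.2 : ℕ) + 1} := by simp
  have h5 : Nat.card {x : StringIndex m // x.1.1 ≤ 2 * (x.2 : ℕ) + 1 ∧ x.1.1 = 2 * (x.2 : ℕ) + 1} =
      Nat.card {x : StringIndex m // x.1.1 = 2 * (x.2 : ℕ) + 1} := by
    congr 2
    ext x
    omega
  have h6 : Nat.card {x : StringIndex m // True} = Nat.card (StringIndex m) :=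
    Nat.card_congr (Equiv.subtypeUnivEquiv fun _ => trivial)
  omega

theorem card_middle (m : ℕ → ℕ) (S : Finset ℕ) (hS : ∀ j ∈ S, Odd j)
    (hS' : ∀ j, Odd j → 0 < m j → j ∈ S) :
    Nat.card {x : StringIndex m // x.1.1 = 2 * (x.2 : ℕ) + 1} = ∑ j : S, m j := by
  rw [← Nat.card_congr (β := {x : StringIndex m // x.1.1 = 2 * (x.2 : ℕ) + 1})
    (α := (j : S) × Fin (m j))]
  · rw [Nat.card_sigma]
    simp
  · refine ⟨fun p => ⟨⟨⟨p.1, p.2⟩, ⟨((p.1 : ℕ) - 1) / 2, ?_⟩⟩, ?_⟩,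
      fun x => ⟨⟨x.1.1.1, hS' _ ⟨_, x.2⟩ x.1.1.2.pos⟩, x.1.1.2⟩, fun p => rfl, ?_⟩
    · obtain ⟨r, hr⟩ := hS _ p.1.2
      dsimp only
      omega
    · obtain ⟨r, hr⟩ := hS _ p.1.2
      dsimp only
      omega
    · rintro ⟨⟨⟨j, i⟩, ⟨a, ha⟩⟩, hx⟩
      dsimp only at hx
      have : (j - 1) / 2 = a := by omega
      subst this
      rfl

/-- The Witt class of `Q` is the sum of the classes of the forms on the middles of the strings of
odd length.  The upper halves of the strings, together with the graph of the embedding of the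
middles, form a Lagrangian of the difference of the two sides. -/
theorem StringFrame.wittClass_eq_sum [NeZero (2 : F)] [FiniteDimensional F V]
    (hQ : Q.polarBilin.Nondegenerate) (h : StringFrame Q.polarBilin X e)
    (hX : ∀ x y, Q.polarBilin (X x) y = -Q.polarBilin x (X y)) (S : Finset ℕ)
    (hS : ∀ j ∈ S, Odd j) (hS' : ∀ j, Odd j → 0 < m j → j ∈ S) :
    wittClass Q = ∑ j : S, wittClass (midForm Q X e j) := by
  classical
  rw [← wittClass_pi]
  let f : QuadraticForm F ((j : S) → (Fin (m j) → F)) :=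
    QuadraticMap.pi fun j : S => midForm Q X e j
  change wittClass Q = wittClass f
  have hf : f.polarBilin.Nondegenerate :=
    nondegenerate_pi fun j => h.midForm_nondegenerate hX (hS j j.2)
  let R := QuadraticMap.prod Q (-f)
  have hR : R.polarBilin.Nondegenerate := nondegenerate_prod_iff.2 ⟨hQ, nondegenerate_neg hf⟩
  have hRp : ∀ x y, QuadraticMap.polar R x y =
      Q.polarBilin x.1 y.1 - QuadraticMap.polar f x.2 y.2 := fun x y => by
    rw [QuadraticMap.polar_prod, FunLike.coe_neg, QuadraticMap.polar_neg,
      sub_eq_add_neg]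
    rfl
  let Up := {x : StringIndex m // x.1.1 ≤ 2 * (x.2 : ℕ) + 1}
  let y : Up → V × ((j : S) → (Fin (m j) → F)) := fun x =>
    (vec X e x.1, if hx : x.1.1.1 = 2 * (x.1.2 : ℕ) + 1 then
      Pi.single (⟨x.1.1.1, hS' _ ⟨_, hx⟩ x.1.1.2.pos⟩ : S) (Pi.single x.1.1.2 1) else 0)
  have hyp : ∀ x x', QuadraticMap.polar R (y x) (y x') = 0 := by
    rintro ⟨⟨⟨j, i⟩, a⟩, hx⟩ ⟨⟨⟨j', i'⟩, a'⟩, hx'⟩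
    have hx : j ≤ 2 * (a : ℕ) + 1 := hx
    have hx' : j' ≤ 2 * (a' : ℕ) + 1 := hx'
    rw [hRp]
    simp only [y, vec]
    by_cases hm : j = 2 * (a : ℕ) + 1 ∧ j' = 2 * (a' : ℕ) + 1
    · rw [dif_pos hm.1, dif_pos hm.2, QuadraticMap.Ring.polar_pi]
      by_cases hjj : j = j'
      · subst hjj
        rw [Finset.sum_eq_single (⟨j, hS' _ ⟨_, hm.1⟩ i.pos⟩ : S), Pi.single_eq_same,
          Pi.single_eq_same, polar_midForm hX ⟨_, hm.1⟩,
          StringFrame.apply_pow_pow_self hX _ _ _ _ _ (by omega),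
          show (j - 1) / 2 = a by omega, sub_self]
        · intro k _ hk
          rw [Pi.single_eq_of_ne hk, QuadraticMap.polar_zero_left]
        · simp
      · rw [h.apply_pow_pow hX _ _ _ _ _ _ (fun hc => hjj hc.1), zero_sub, neg_eq_zero]
        refine Finset.sum_eq_zero fun k _ => ?_
        by_cases hk : (k : ℕ) = j
        · rw [Pi.single_eq_of_ne (M := fun j : S => Fin (m j) → F)
            (fun hc => hjj (hk.symm.trans (congrArg Subtype.val hc)) : k ≠ ⟨j', _⟩),
            QuadraticMap.polar_zero_right]
        · rw [Pi.single_eq_of_ne (M := fun j : S => Fin (m j) → F)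
            (fun hc => hk (congrArg Subtype.val hc) : k ≠ ⟨j, _⟩),
            QuadraticMap.polar_zero_left]
    · have hne : ¬ (j = j' ∧ (a : ℕ) + a' + 1 = j') := by omega
      rw [h.apply_pow_pow hX _ _ _ _ _ _ hne, zero_sub, neg_eq_zero]
      rcases not_and_or.1 hm with hm | hm
      · rw [dif_neg hm, QuadraticMap.polar_zero_left]
      · rw [dif_neg hm, QuadraticMap.polar_zero_right]
  have hfin := Module.Finite.finite_basis (h.basis hX)
  have := Fintype.ofFinite Up
  have hind : LinearIndependent F y :=
    LinearIndependent.of_comp (LinearMap.fst F V _)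
      ((h.linearIndependent_vec hX).comp _ Subtype.val_injective)
  have hd : 2 * Module.finrank F (Submodule.span F (Set.range y)) =
      Module.finrank F (V × ((j : S) → (Fin (m j) → F))) := by
    rw [finrank_span_eq_card hind, ← Nat.card_eq_fintype_card, two_mul_card_upper,
      card_middle m S hS hS', Module.finrank_prod, Module.finrank_pi_fintype,
      Module.finrank_eq_nat_card_basis (h.basis hX)]
    simp
  have hW := (equivalent_hyperbolicSum_of_lagrangian two_ne_zero hR _
    (fun z hz => apply_eq_zero_of_mem_span two_ne_zero hyp hz) hd).wittClass_eq
  rw [wittClass_hyperbolicSum, wittClass_prod] at hW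
  calc wittClass Q = wittClass Q + (wittClass f + wittClass (-f)) := by
        rw [wittClass_add_neg hf, add_zero]
    _ = wittClass f := by rw [add_comm (wittClass f), ← add_assoc, hW, zero_add]

end WittClassFormula

/-! ### Construction of spaces with prescribed strings -/

section Model

variable {F : Type*} [Field F]

/-- The space of `m j` strings of length `j` for each `j` in `S`. -/
abbrev StringSpace (F : Type*) [Field F] (m : ℕ → ℕ) (S : Finset ℕ) : Type _ :=
  (j : S) → Fin (j : ℕ) → Fin (m j) → F

namespace StringSpace

variable {m : ℕ → ℕ} {S : Finset ℕ}

/-- The inclusion of the vectors at height `a` in the strings of length `j`. -/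
def incl (j : S) (a : Fin (j : ℕ)) : (Fin (m j) → F) →ₗ[F] StringSpace F m S :=
  LinearMap.single F (fun j : S => Fin (j : ℕ) → Fin (m j) → F) j ∘ₗ
    LinearMap.single F (fun _ : Fin (j : ℕ) => Fin (m j) → F) a

/-- The endomorphism that moves up the strings by one step. -/
def shift : Module.End F (StringSpace F m S) :=
  LinearMap.pi fun j => LinearMap.pi fun a =>
    if (a : ℕ) = 0 then 0
    else LinearMap.proj (⟨(a : ℕ) - 1, by omega⟩ : Fin (j : ℕ)) ∘ₗ LinearMap.proj j

/-- The form that pairs opposite members of the strings of length `j` through `φ j`. -/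
def form (φ : ∀ j, LinearMap.BilinForm F (Fin (m j) → F)) :
    LinearMap.BilinForm F (StringSpace F m S) :=
  ∑ j : S, ∑ a : Fin (j : ℕ), (-1 : F) ^ (a : ℕ) •
    (φ j).compl₁₂ (LinearMap.proj a ∘ₗ LinearMap.proj j) (LinearMap.proj a.rev ∘ₗ LinearMap.proj j)

theorem incl_same (j : S) (a : Fin (j : ℕ)) (w : Fin (m j) → F) : incl j a w j a = w := by
  simp [incl]

theorem incl_of_ne (j : S) {a b : Fin (j : ℕ)} (h : b ≠ a) (w : Fin (m j) → F) :
    incl j a w j b = 0 := by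
  simp [incl, h]

theorem incl_of_ne' {i j : S} (h : i ≠ j) (a : Fin (j : ℕ)) (w : Fin (m j) → F) :
    incl j a w i = 0 := by
  simp [incl, h]

theorem eq_top_of_incl_mem {W : Submodule F (StringSpace F m S)}
    (h : ∀ j a w, incl j a w ∈ W) : W = ⊤ := by
  classical
  refine Submodule.eq_top_iff'.2 fun x => ?_
  have : x = ∑ j : S, ∑ a : Fin (j : ℕ), incl j a (x j a) := by
    conv_lhs => rw [← Finset.univ_sum_single x]
    refine Finset.sum_congr rfl fun j _ => ?_
    conv_lhs => rw [← Finset.univ_sum_single (x j)]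
    exact map_sum (LinearMap.single F (fun j : S => Fin (j : ℕ) → Fin (m j) → F) j) _ _
  rw [this]
  exact Submodule.sum_mem _ fun j _ => Submodule.sum_mem _ fun a _ => h j a _

theorem ext_incl {U : Type*} [AddCommGroup U] [Module F U] {f g : StringSpace F m S →ₗ[F] U}
    (h : ∀ j a w, f (incl j a w) = g (incl j a w)) : f = g :=
  LinearMap.eqLocus_eq_top.1 (eq_top_of_incl_mem h)

theorem shift_incl (j : S) (a : Fin (j : ℕ)) (w : Fin (m j) → F) :
    shift (incl j a w) = if h : (a : ℕ) + 1 < j then incl j ⟨a + 1, h⟩ w else 0 := by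
  funext i b
  simp only [shift, LinearMap.pi_apply]
  by_cases hij : i = j
  · subst hij
    by_cases hb : (b : ℕ) = 0
    · rw [if_pos hb]
      split_ifs with h
      · rw [incl_of_ne _ (by rw [Ne, Fin.ext_iff]; dsimp only; omega)]
        rfl
      · rfl
    · rw [if_neg hb]
      change incl i a w i _ = _
      by_cases hab : (b : ℕ) = a + 1
      · have h : (a : ℕ) + 1 < i := hab ▸ b.2
        obtain rfl : b = ⟨a + 1, h⟩ := Fin.ext hab
        rw [dif_pos h, incl_same]
        exact incl_same i a w
      · rw [incl_of_ne _ (by rw [Ne, Fin.ext_iff]; dsimp only; omega)]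
        split_ifs with h
        · rw [incl_of_ne _ (by rw [Ne, Fin.ext_iff]; exact hab)]
        · rfl
  · have h1 : (if (b : ℕ) = 0 then (0 : StringSpace F m S →ₗ[F] (Fin (m i) → F)) else
        LinearMap.proj (⟨(b : ℕ) - 1, by omega⟩ : Fin (i : ℕ)) ∘ₗ LinearMap.proj i)
        (incl j a w) = 0 := by
      split_ifs
      · rfl
      · change incl j a w i _ = 0
        rw [incl_of_ne' hij]
        rfl
    refine h1.trans ?_
    split_ifs
    · rw [incl_of_ne' hij]
      rfl
    · rfl

theorem shift_pow_incl (j : S) (a : Fin (j : ℕ)) (c : ℕ) (w : Fin (m j) → F) :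
    (shift ^ c) (incl j a w) = if h : (a : ℕ) + c < j then incl j ⟨a + c, h⟩ w else 0 := by
  induction c with
  | zero => simp
  | succ c ih =>
    rw [pow_succ', Module.End.mul_apply, ih]
    by_cases h : (a : ℕ) + c < j
    · rw [dif_pos h, shift_incl]
      rfl
    · rw [dif_neg h, map_zero, dif_neg (by omega)]

variable {φ : ∀ j, LinearMap.BilinForm F (Fin (m j) → F)}

theorem form_apply (x y : StringSpace F m S) : form φ x y =
    ∑ j : S, ∑ a : Fin (j : ℕ), (-1 : F) ^ (a : ℕ) * φ j (x j a) (y j a.rev) := by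
  simp [form, LinearMap.sum_apply]

theorem form_incl_left (j : S) (a : Fin (j : ℕ)) (u : Fin (m j) → F) (y : StringSpace F m S) :
    form φ (incl j a u) y = (-1) ^ (a : ℕ) * φ j u (y j a.rev) := by
  rw [form_apply, Finset.sum_eq_single j, Finset.sum_eq_single a, incl_same]
  · intro b _ hb
    rw [incl_of_ne _ hb]
    simp
  · simp
  · intro i _ hi
    rw [incl_of_ne' hi]
    simp
  · simp

theorem form_incl_self (j : S) (a c : Fin (j : ℕ)) (h : (a : ℕ) + c + 1 = j)
    (u v : Fin (m j) → F) : form φ (incl j a u) (incl j c v) = (-1) ^ (a : ℕ) * φ j u v := by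
  obtain rfl : c = a.rev := Fin.ext (by rw [Fin.val_rev]; omega)
  rw [form_incl_left, incl_same]

theorem form_incl_of_ne {i j : S} {a : Fin (i : ℕ)} {c : Fin (j : ℕ)}
    (h : ¬ (i = j ∧ (a : ℕ) + c + 1 = j)) (u : Fin (m i) → F) (v : Fin (m j) → F) :
    form φ (incl i a u) (incl j c v) = 0 := by
  rw [form_incl_left]
  by_cases hij : i = j
  · subst hij
    have h' : ¬ (a : ℕ) + c + 1 = i := fun hc => h ⟨rfl, hc⟩
    rw [incl_of_ne _ (by rw [Ne, Fin.ext_iff, Fin.val_rev]; omega)]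
    simp
  · rw [incl_of_ne' hij]
    simp

theorem form_comm (hφ : ∀ j u v, φ j u v = (-1) ^ (j - 1) * φ j v u)
    (x y : StringSpace F m S) : form φ x y = form φ y x := by
  have : form φ = (form φ).flip (M := StringSpace F m S) := by
    refine ext_incl fun i a u => ext_incl fun j c v => ?_
    rw [LinearMap.BilinForm.flip_apply]
    by_cases h : i = j ∧ (a : ℕ) + c + 1 = j
    · obtain ⟨rfl, h⟩ := h
      rw [form_incl_self _ _ _ h, form_incl_self _ _ _ (by omega), hφ, ← mul_assoc, ← pow_add,
        show (a : ℕ) + (i - 1) = c + (a + a) by omega, pow_add, Even.neg_one_pow ⟨(a : ℕ), rfl⟩,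
        mul_one]
    · rw [form_incl_of_ne h, form_incl_of_ne]
      rintro ⟨rfl, h'⟩
      exact h ⟨rfl, by omega⟩
  exact congrArg (fun b => b x y) this

theorem form_shift (x y : StringSpace F m S) : form φ (shift x) y = -form φ x (shift y) := by
  have : (form φ).compl₁₂ shift LinearMap.id =
      -(form φ).compl₁₂ (LinearMap.id (M := StringSpace F m S)) shift := by
    refine ext_incl fun i a u => ext_incl fun j c v => ?_
    change form φ (shift (incl i a u)) (incl j c v) = -form φ (incl i a u) (shift (incl j c v))
    rw [shift_incl, shift_incl]
    by_cases h : i = j ∧ (a : ℕ) + c + 2 = j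
    · obtain ⟨rfl, h⟩ := h
      rw [dif_pos (by omega), dif_pos (by omega), form_incl_self, form_incl_self, pow_succ]
      · ring
      · dsimp only; omega
      · dsimp only; omega
    · have h1 : ∀ h', form φ (incl i ⟨a + 1, h'⟩ u) (incl j c v) = 0 := fun h' =>
        form_incl_of_ne (fun hc => h ⟨hc.1, by have := hc.2; dsimp only at this; omega⟩) _ _
      have h3 : ∀ h', form φ (incl i a u) (incl j ⟨c + 1, h'⟩ v) = 0 := fun h' =>
        form_incl_of_ne (fun hc => h ⟨hc.1, by have := hc.2; dsimp only at this; omega⟩) _ _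
      split_ifs <;> simp [h1, h3]
  exact congrArg (fun b => b x y) this

/-- The inclusion of the heads of the strings. -/
def heads (j : ℕ) : (Fin (m j) → F) →ₗ[F] StringSpace F m S :=
  if h : j ∈ S ∧ 0 < j then incl ⟨j, h.1⟩ ⟨0, h.2⟩ else 0

theorem shift_pow_heads {j : ℕ} (hj : j ∈ S) (c : ℕ) (w : Fin (m j) → F) :
    (shift ^ c) (heads (S := S) j w) = if h : c < j then incl ⟨j, hj⟩ ⟨c, h⟩ w else 0 := by
  rw [heads]
  split_ifs with h h' h'
  · rw [shift_pow_incl, dif_pos (by simpa using h')]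
    congr 2
    simp
  · rw [shift_pow_incl, dif_neg (by simpa using h')]
  · exact absurd ⟨hj, by omega⟩ h
  · simp

theorem headForm_eq {j : ℕ} (hj : j ∈ S) (h0 : 0 < j) (u v : Fin (m j) → F) :
    StringFrame.headForm (form φ) (shift (S := S)) heads j u v = φ j u v := by
  have h1 : heads (S := S) j u = incl ⟨j, hj⟩ ⟨0, h0⟩ u := by
    rw [heads, dif_pos ⟨hj, h0⟩]
  rw [StringFrame.headForm_apply, shift_pow_heads hj, dif_pos (by omega), h1, form_incl_self]
  · simp
  · dsimp only; omega

/-- In the model, the heads frame the strings of `shift`, and by `headForm_eq` any nondegenerate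
forms of the right symmetry occur on them. -/
theorem stringFrame (hm : ∀ j, 0 < m j → j ∈ S) (hm0 : m 0 = 0)
    (hφ : ∀ j u, (∀ v, φ j u v = 0) → u = 0) :
    StringFrame (form φ) (shift (S := S)) heads where
  pow_eq_zero j w := by
    by_cases hj : j ∈ S
    · rw [shift_pow_heads hj, dif_neg (lt_irrefl j)]
    · rw [heads, dif_neg (fun h => hj h.1), LinearMap.zero_apply, map_zero]
  orth i j a hij u v := by
    by_cases hi : i ∈ S ∧ 0 < i
    · by_cases hj : j ∈ S
      · rw [shift_pow_heads hj, heads, dif_pos hi]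
        split_ifs with ha
        · refine form_incl_of_ne (fun hc => hij ?_) _ _
          have h1 := congrArg Subtype.val hc.1
          have h3 := hc.2
          dsimp only at h1 h3
          omega
        · rw [map_zero]
      · rw [heads.eq_1 j, dif_neg (fun h => hj h.1), LinearMap.zero_apply, map_zero, map_zero]
    · rw [heads, dif_neg hi]
      simp
  nondeg j u hu := by
    by_cases hj : 0 < m j
    · refine hφ j u fun v => ?_
      have h0 : 0 < j := Nat.pos_of_ne_zero fun h => by subst h; omega
      rw [← headForm_eq (hm j hj) h0]
      exact hu v
    · funext i
      exact absurd i.pos hj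
  span W hW := by
    refine eq_top_of_incl_mem fun j a w => ?_
    have := hW j w a
    rwa [shift_pow_heads j.2, dif_pos a.2] at this

end StringSpace

end Model


/-! ### Conjugacy of endomorphisms with the same strings -/

section Conjugacy

variable {F : Type*} [Field F] {V V' : Type*} [AddCommGroup V] [Module F V]
  [AddCommGroup V'] [Module F V']

theorem mem_skewAdjointLieSubalgebra_iff {B : LinearMap.BilinForm F V} {X : Module.End F V} :
    X ∈ skewAdjointLieSubalgebra B ↔ ∀ x y, B (X x) y = -B x (X y) := by
  refine (LinearMap.mem_skewAdjointSubmodule (B := B) X).trans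
    ⟨fun h x y => (h x y).trans (map_neg _ _), fun h x y => (h x y).trans (map_neg _ _).symm⟩

theorem eq_conj_iff {g : V ≃ₗ[F] V} {X Y : Module.End F V} :
    Y = g.conj X ↔ ∀ x, g (X x) = Y (g x) := by
  constructor
  · rintro rfl x
    rw [LinearEquiv.conj_apply_apply, LinearEquiv.symm_apply_apply]
  · intro h
    ext x
    rw [LinearEquiv.conj_apply_apply, h, LinearEquiv.apply_symm_apply]

theorem adjointOrbit_eq_iff {G : Subgroup (V ≃ₗ[F] V)} {X Y : Module.End F V} :
    adjointOrbit G X = adjointOrbit G Y ↔ ∃ g ∈ G, Y = g.conj X := by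
  constructor
  · intro h
    have : Y ∈ adjointOrbit G Y := ⟨1, G.one_mem, rfl⟩
    rwa [← h] at this
  · rintro ⟨g, hg, rfl⟩
    ext Z
    constructor
    · rintro ⟨g', hg', rfl⟩
      refine ⟨g' * g⁻¹, G.mul_mem hg' (G.inv_mem hg), ?_⟩
      ext x
      change g' (X (g'.symm x)) = g' (g.symm (g (X (g.symm (g (g'.symm x))))))
      rw [LinearEquiv.symm_apply_apply, LinearEquiv.symm_apply_apply]
    · rintro ⟨g', hg', rfl⟩
      exact ⟨g' * g, G.mul_mem hg' hg, rfl⟩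

theorem conj_skew {B : LinearMap.BilinForm F V} {B' : LinearMap.BilinForm F V'} {g : V ≃ₗ[F] V'}
    (hg : ∀ u v, B' (g u) (g v) = B u v) {X : Module.End F V}
    (hX : ∀ x y, B (X x) y = -B x (X y)) (x y : V') :
    B' (g.conj X x) y = -B' x (g.conj X y) := by
  obtain ⟨x, rfl⟩ := g.surjective x
  obtain ⟨y, rfl⟩ := g.surjective y
  simp only [LinearEquiv.conj_apply_apply, LinearEquiv.symm_apply_apply, hg, hX]

theorem conj_pow_apply (g : V ≃ₗ[F] V') (X : Module.End F V) (a : ℕ) (x : V) :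
    ((g.conj X) ^ a) (g x) = g ((X ^ a) x) := by
  induction a generalizing x with
  | zero => rfl
  | succ a ih =>
    rw [pow_succ, Module.End.mul_apply, LinearEquiv.conj_apply_apply, LinearEquiv.symm_apply_apply,
      ih, pow_succ, Module.End.mul_apply]

theorem StringFrame.map {B : LinearMap.BilinForm F V} {B' : LinearMap.BilinForm F V'}
    {X : Module.End F V} {m : ℕ → ℕ} {e : ∀ j, (Fin (m j) → F) →ₗ[F] V} (h : StringFrame B X e)
    {g : V ≃ₗ[F] V'} (hg : ∀ u v, B' (g u) (g v) = B u v) :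
    StringFrame B' (g.conj X) fun j => g.toLinearMap ∘ₗ e j where
  pow_eq_zero j w := by
    rw [LinearMap.comp_apply, LinearEquiv.coe_coe, conj_pow_apply, h.pow_eq_zero, map_zero]
  orth i j a hij u v := by
    rw [LinearMap.comp_apply, LinearMap.comp_apply, LinearEquiv.coe_coe, conj_pow_apply, hg,
      h.orth i j a hij]
  nondeg j u hu := h.nondeg j u fun v => by
    rw [← hu v, LinearMap.comp_apply, LinearMap.comp_apply, LinearEquiv.coe_coe, conj_pow_apply, hg]
  span W hW := by
    have := h.span (W.comap g.toLinearMap) fun j u a => by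
      have := hW j u a
      rwa [LinearMap.comp_apply, LinearEquiv.coe_coe, conj_pow_apply] at this
    refine Submodule.eq_top_iff'.2 fun x => ?_
    obtain ⟨x, rfl⟩ := g.surjective x
    exact (Submodule.eq_top_iff'.1 this) x

theorem quadraticForm_ext_polar (h2 : (2 : F) ≠ 0) {Q Q' : QuadraticForm F V}
    (h : ∀ x y, QuadraticMap.polar Q x y = QuadraticMap.polar Q' x y) : Q = Q' := by
  ext x
  have := h x x
  rw [QuadraticMap.polar_self, QuadraticMap.polar_self, two_smul, two_smul, ← two_mul,
    ← two_mul] at this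
  exact mul_left_cancel₀ h2 this

/-- Endomorphisms with the same numbers of strings are conjugate under an isometry if and only if
the forms on the middles of the strings of each odd length are equivalent. -/
theorem StringFrame.exists_isometry_iff (h2 : (2 : F) ≠ 0) {Q : QuadraticForm F V}
    {Q' : QuadraticForm F V'} {X : Module.End F V} {X' : Module.End F V'} {m : ℕ → ℕ}
    {e : ∀ j, (Fin (m j) → F) →ₗ[F] V} {e' : ∀ j, (Fin (m j) → F) →ₗ[F] V'}
    (h : StringFrame Q.polarBilin X e) (h' : StringFrame Q'.polarBilin X' e')
    (hX : ∀ x y, Q.polarBilin (X x) y = -Q.polarBilin x (X y))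
    (hX' : ∀ x y, Q'.polarBilin (X' x) y = -Q'.polarBilin x (X' y)) :
    (∃ g : V ≃ₗ[F] V', (∀ x y, Q'.polarBilin (g x) (g y) = Q.polarBilin x y) ∧
      ∀ x, g (X x) = X' (g x)) ↔
    ∀ j, Odd j → 0 < m j → (midForm Q X e j).Equivalent (midForm Q' X' e' j) := by
  have hs : ∀ x y, Q.polarBilin x y = Q.polarBilin y x := QuadraticMap.polar_comm Q
  have hs' : ∀ x y, Q'.polarBilin x y = Q'.polarBilin y x := QuadraticMap.polar_comm Q'
  constructor
  · rintro ⟨g, hg, hgX⟩ j hj -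
    obtain ⟨T, hT⟩ := h.exists_headForm_isometry h' hX' hs' (g := g.toLinearMap) hg hgX j
    have : midForm Q X e j = (midForm Q' X' e' j).comp T.toLinearMap :=
      quadraticForm_ext_polar h2 fun u v => by
        rw [polar_midForm hX hj, ← hT, ← polar_midForm hX' hj]
        exact polar_of_isometry (Q := (midForm Q' X' e' j).comp T.toLinearMap) T.toLinearMap
          (fun _ => rfl) u v
    rw [this]
    exact (equivalent_comp_equiv _ T).symm
  · intro H
    have hT : ∀ j, ∃ T : (Fin (m j) → F) ≃ₗ[F] (Fin (m j) → F),
        ∀ u v, headForm Q'.polarBilin X' e' j (T u) (T v) = headForm Q.polarBilin X e j u v := by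
      intro j
      rcases Nat.even_or_odd j with hj | hj
      · exact h.exists_headForm_isometry_of_even h2 h' hs hX hs' hX' hj
      · rcases Nat.eq_zero_or_pos (m j) with h0 | h0
        · have : IsEmpty (Fin (m j)) := by rw [h0]; infer_instance
          refine ⟨LinearEquiv.refl _ _, fun u v => ?_⟩
          rw [Subsingleton.elim u 0, map_zero, map_zero, map_zero]
          rfl
        · obtain ⟨T⟩ := H j hj h0
          refine ⟨T.toLinearEquiv, fun u v => ?_⟩
          have := polar_of_isometry T.toLinearEquiv.toLinearMap T.map_app u v
          rw [polar_midForm hX hj, polar_midForm hX' hj] at this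
          exact mul_left_cancel₀ (pow_ne_zero _ (by simp)) this
    choose T hT using hT
    obtain ⟨g, hg, hgX, -⟩ := h.exists_isometry h' hX hX' T hT
    exact ⟨g, hg, hgX⟩

end Conjugacy

/-! ### Existence of endomorphisms with given forms -/

theorem finrank_stringSpace (F : Type*) [Field F] {n : ℕ} (lam : n.Partition) :
    Module.finrank F (StringSpace F (fun j => lam.parts.count j) lam.parts.toFinset) = n := by
  rw [Module.finrank_pi_fintype]
  simp only [Module.finrank_pi_fintype, Module.finrank_self, Finset.sum_const, Finset.card_univ,
    Fintype.card_fin, smul_eq_mul, mul_one]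
  rw [Finset.sum_coe_sort lam.parts.toFinset fun j => j * lam.parts.count j]
  conv_rhs => rw [← lam.parts_sum, Finset.sum_multiset_count]
  exact Finset.sum_congr rfl fun j _ => by rw [smul_eq_mul, mul_comm]

section Existence

variable {F : Type*} [Field F] [NeZero (2 : F)]

/-- The quadratic form with a given polar form. -/
def quadOfPolar {V : Type*} [AddCommGroup V] [Module F V] (B : LinearMap.BilinForm F V) :
    QuadraticForm F V :=
  LinearMap.BilinMap.toQuadraticMap ((2 : F)⁻¹ • B)

theorem polarBilin_quadOfPolar {V : Type*} [AddCommGroup V] [Module F V]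
    {B : LinearMap.BilinForm F V} (hs : ∀ x y, B x y = B y x) :
    (quadOfPolar B).polarBilin = B := by
  ext x y
  change QuadraticMap.polar (LinearMap.BilinMap.toQuadraticMap ((2 : F)⁻¹ • B)) x y = _
  rw [LinearMap.BilinMap.polar_toQuadraticMap]
  simp only [LinearMap.smul_apply, smul_eq_mul, hs y x]
  field_simp
  ring

theorem count_zero {n : ℕ} (lam : n.Partition) : lam.parts.count 0 = 0 :=
  Multiset.count_eq_zero.2 fun h => lt_irrefl 0 (lam.parts_pos h)

theorem mem_oddParts_iff {n : ℕ} {lam : n.Partition} {j : ℕ} :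
    j ∈ oddParts lam ↔ Odd j ∧ 0 < lam.parts.count j := by
  rw [oddParts, Finset.mem_filter, Multiset.mem_toFinset, Multiset.count_pos, and_comm]

/-- Any nondegenerate forms of the right dimensions arise on the middles of the strings of some
skew-adjoint endomorphism. -/
theorem exists_stringFrame_model {n : ℕ} {lam : n.Partition} (hlam : lam ∈ orthogonalPartitions n)
    (f : (j : oddParts lam) → NondegForm F (lam.parts.count (j : ℕ))) :
    ∃ (Q : QuadraticForm F (StringSpace F (fun j => lam.parts.count j) lam.parts.toFinset))
      (X : Module.End F (StringSpace F (fun j => lam.parts.count j) lam.parts.toFinset))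
      (e : ∀ j, (Fin (lam.parts.count j) → F) →ₗ[F] _),
      (∀ x y, Q.polarBilin (X x) y = -Q.polarBilin x (X y)) ∧ StringFrame Q.polarBilin X e ∧
      ∀ j : oddParts lam, midForm Q X e j = (f j).1 := by
  have hφ : ∀ j, ∃ φ : LinearMap.BilinForm F (Fin (lam.parts.count j) → F),
      (∀ u v, φ u v = (-1) ^ (j - 1) * φ v u) ∧ (∀ u, (∀ v, φ u v = 0) → u = 0) ∧
      ∀ hj : j ∈ oddParts lam, ∀ u v,
        φ u v = (-1) ^ ((j - 1) / 2) * QuadraticMap.polar (f ⟨j, hj⟩).1 u v := by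
    intro j
    by_cases h0 : 0 < lam.parts.count j
    swap
    · have : IsEmpty (Fin (lam.parts.count j)) := by
        rw [Nat.eq_zero_of_not_pos h0]; infer_instance
      exact ⟨0, fun u v => by simp, fun u _ => Subsingleton.elim _ _,
        fun hj => absurd (mem_oddParts_iff.1 hj).2 h0⟩
    rcases Nat.even_or_odd j with hj | hj
    · obtain ⟨φ, hs, hnd⟩ := exists_skew_form (F := F) (hlam j (Multiset.count_pos.1 h0) hj)
      have hpos : 0 < j := lam.parts_pos (Multiset.count_pos.1 h0)
      have hodd : (-1 : F) ^ (j - 1) = -1 := Odd.neg_one_pow (Nat.Even.sub_odd hpos hj odd_one)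
      refine ⟨φ, fun u v => by rw [hodd, neg_one_mul, hs], hnd, fun hj' => ?_⟩
      exact absurd (mem_oddParts_iff.1 hj').1 (Nat.not_odd_iff_even.2 hj)
    · have hmem := mem_oddParts_iff.2 ⟨hj, h0⟩
      have heven : (-1 : F) ^ (j - 1) = 1 := Even.neg_one_pow (Nat.Odd.sub_odd hj odd_one)
      refine ⟨(-1 : F) ^ ((j - 1) / 2) • (f ⟨j, hmem⟩).1.polarBilin, fun u v => ?_, fun u hu => ?_,
        fun _ u v => rfl⟩
      · rw [heven, one_mul]
        exact congrArg _ (QuadraticMap.polar_comm _ u v)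
      · exact (f ⟨j, hmem⟩).2.1 u fun v => (mul_eq_zero.1 (hu v)).resolve_left (by simp)
  choose φ hφs hφn hφf using hφ
  have hp := polarBilin_quadOfPolar (StringSpace.form_comm (S := lam.parts.toFinset) hφs)
  have hX : ∀ x y, (quadOfPolar (StringSpace.form φ)).polarBilin
      (StringSpace.shift (S := lam.parts.toFinset) x) y =
      -(quadOfPolar (StringSpace.form φ)).polarBilin x (StringSpace.shift y) := by
    rw [hp]
    exact StringSpace.form_shift
  refine ⟨quadOfPolar (StringSpace.form φ), StringSpace.shift, StringSpace.heads, hX, ?_, ?_⟩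
  · rw [hp]
    exact StringSpace.stringFrame (fun j hj => Multiset.mem_toFinset.2 (Multiset.count_pos.1 hj))
      (count_zero lam) hφn
  · intro j
    have hj := mem_oddParts_iff.1 j.2
    refine quadraticForm_ext_polar two_ne_zero fun u v => ?_
    rw [polar_midForm hX hj.1, hp, StringSpace.headForm_eq (φ := φ)
      (Multiset.mem_toFinset.2 (Multiset.count_pos.1 hj.2)) hj.1.pos, hφf j j.2, ← mul_assoc,
      ← mul_pow]
    simp

/-- The endomorphism of prescribed type on a given space, as soon as the forms are equivalent. -/
theorem exists_stringFrame_of_equivalent {n : ℕ} {lam : n.Partition}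
    (hlam : lam ∈ orthogonalPartitions n)
    (f : (j : oddParts lam) → NondegForm F (lam.parts.count (j : ℕ)))
    {V : Type*} [AddCommGroup V] [Module F V] (Q : QuadraticForm F V)
    (hQ : ∀ Q' : QuadraticForm F (StringSpace F (fun j => lam.parts.count j) lam.parts.toFinset),
      Q'.polarBilin.Nondegenerate → wittClass Q' = ∑ j, wittClass (f j).1 → Q'.Equivalent Q) :
    ∃ (X : Module.End F V) (e : ∀ j, (Fin (lam.parts.count j) → F) →ₗ[F] V),
      (∀ x y, Q.polarBilin (X x) y = -Q.polarBilin x (X y)) ∧ StringFrame Q.polarBilin X e ∧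
      ∀ j : oddParts lam, midForm Q X e j = (f j).1 := by
  obtain ⟨Q', X, e, hX, he, hmid⟩ := exists_stringFrame_model hlam f
  have hnd : Q'.polarBilin.Nondegenerate :=
    (QuadraticMap.nondegenerate_iff Q').2 fun x hx => he.eq_zero_of_forall hX hx
  obtain ⟨g⟩ := hQ Q' hnd (by
    rw [he.wittClass_eq_sum hnd hX (oddParts lam) (fun j hj => (mem_oddParts_iff.1 hj).1)
      fun j hj h0 => mem_oddParts_iff.2 ⟨hj, h0⟩]
    exact Finset.sum_congr rfl fun j _ => by rw [hmid])
  have hg : ∀ u v, Q.polarBilin (g.toLinearEquiv u) (g.toLinearEquiv v) = Q'.polarBilin u v :=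
    polar_of_isometry (Q := Q') (Q' := Q) g.toLinearEquiv.toLinearMap g.map_app
  refine ⟨g.toLinearEquiv.conj X, fun j => g.toLinearEquiv.toLinearMap ∘ₗ e j,
    conj_skew hg hX, he.map hg, fun j => ?_⟩
  rw [← hmid]
  ext w
  change Q (((g.toLinearEquiv.conj X) ^ _) (g.toLinearEquiv (e j w))) = _
  rw [conj_pow_apply]
  exact g.map_app _

end Existence


/-! ### Extension of scalars -/

section BaseChange

variable {F : Type*} [Field F] {V : Type*} [AddCommGroup V] [Module F V]

theorem baseChange_skew (K : Type*) [Field K] [Algebra F K] {B : LinearMap.BilinForm F V}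
    {X : Module.End F V} (hX : ∀ x y, B (X x) y = -B x (X y)) (x y : K ⊗[F] V) :
    LinearMap.BilinForm.baseChange K B (LinearMap.baseChange K X x) y =
      -LinearMap.BilinForm.baseChange K B x (LinearMap.baseChange K X y) := by
  induction x with
  | zero => simp
  | add x x' h h' => simp only [map_add, LinearMap.add_apply, h, h', neg_add]
  | tmul a x =>
    induction y with
    | zero => simp
    | add y y' h h' => simp only [map_add, h, h', neg_add]
    | tmul b y =>
      rw [LinearMap.baseChange_tmul, LinearMap.baseChange_tmul,
        LinearMap.BilinForm.baseChange_tmul, LinearMap.BilinForm.baseChange_tmul, hX, neg_smul]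

theorem baseChange_comm (K : Type*) [Field K] [Algebra F K] {B : LinearMap.BilinForm F V}
    (hs : ∀ x y, B x y = B y x) (x y : K ⊗[F] V) :
    LinearMap.BilinForm.baseChange K B x y = LinearMap.BilinForm.baseChange K B y x := by
  induction x with
  | zero => simp
  | add x x' h h' => simp only [map_add, LinearMap.add_apply, h, h']
  | tmul a x =>
    induction y with
    | zero => simp
    | add y y' h h' => simp only [map_add, LinearMap.add_apply, h, h']
    | tmul b y =>
      rw [LinearMap.BilinForm.baseChange_tmul, LinearMap.BilinForm.baseChange_tmul, hs, mul_comm]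

theorem baseChange_eq_zero_of_forall (K : Type*) [Field K] [Algebra F K] [FiniteDimensional F V]
    {B : LinearMap.BilinForm F V} (hB : B.Nondegenerate) {x : K ⊗[F] V}
    (hx : ∀ y, LinearMap.BilinForm.baseChange K B x y = 0) : x = 0 := by
  classical
  let b := Module.finBasis F V
  let d := B.dualBasis hB b
  refine (d.baseChange K).ext_elem fun i => ?_
  have h1 : (LinearMap.BilinForm.baseChange K B).flip (1 ⊗ₜ b i) = (d.baseChange K).coord i :=
    (d.baseChange K).ext fun j => by
      rw [LinearMap.BilinForm.flip_apply, Module.Basis.coord_apply, Module.Basis.repr_self,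
        Module.Basis.baseChange_apply, LinearMap.BilinForm.baseChange_tmul,
        LinearMap.BilinForm.apply_dualBasis_left, Finsupp.single_apply]
      by_cases hij : i = j
      · simp [hij]
      · simp [hij, Ne.symm hij]
  have h2 := congrArg (fun f => f x) h1
  rw [LinearMap.BilinForm.flip_apply, hx] at h2
  rw [map_zero]
  exact h2.symm

theorem eq_zero_of_one_tmul (K : Type*) [Field K] [Algebra F K] {x : V}
    (hx : (1 : K) ⊗ₜ[F] x = 0) : x = 0 := by
  refine (Module.Basis.ofVectorSpace F V).ext_elem fun i => ?_
  have h := congrArg (fun z => ((Module.Basis.ofVectorSpace F V).baseChange K).repr z i) hx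
  simp only [Module.Basis.baseChange_repr_tmul, map_zero, Finsupp.zero_apply, smul_eq_zero,
    one_ne_zero, or_false] at h
  rw [h, map_zero, Finsupp.zero_apply]

theorem isNilpotent_of_baseChange (K : Type*) [Field K] [Algebra F K] {X : Module.End F V}
    (h : IsNilpotent (LinearMap.baseChange K X)) : IsNilpotent X := by
  obtain ⟨N, hN⟩ := h
  refine ⟨N, LinearMap.ext fun x => eq_zero_of_one_tmul (F := F) K ?_⟩
  rw [← LinearMap.baseChange_tmul, LinearMap.baseChange_pow, hN]
  rfl

end BaseChange

/-! ### Orbits and tuples of forms -/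

section Tuples

variable {F : Type*} [Field F] {V : Type*} [AddCommGroup V] [Module F V]

/-- The tuple `t` consists of the classes of the forms on the middles of the strings of odd length
of `X`, for some decomposition of type `lam`. -/
def HasTuple (Q : QuadraticForm F V) (X : Module.End F V) {n : ℕ} {lam : n.Partition}
    (t : FormTuples F lam) : Prop :=
  ∃ e : ∀ j, (Fin (lam.parts.count j) → F) →ₗ[F] V, StringFrame Q.polarBilin X e ∧
    ∀ j : oddParts lam, ∃ h, t j = Quotient.mk (isometrySetoid F _) ⟨midForm Q X e j, h⟩

variable {Q : QuadraticForm F V} {X X' : Module.End F V} {n : ℕ} {lam : n.Partition}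

theorem StringFrame.exists_hasTuple {e : ∀ j, (Fin (lam.parts.count j) → F) →ₗ[F] V}
    (h : StringFrame Q.polarBilin X e)
    (hX : ∀ x y, Q.polarBilin (X x) y = -Q.polarBilin x (X y)) :
    ∃ t : FormTuples F lam, HasTuple Q X t :=
  ⟨fun j => Quotient.mk (isometrySetoid F _)
    ⟨midForm Q X e j, h.midForm_nondegenerate hX (mem_oddParts_iff.1 j.2).1⟩, e, h,
    fun _ => ⟨_, rfl⟩⟩

/-- The tuple of forms is a complete invariant of conjugacy under the orthogonal group. -/
theorem HasTuple.exists_conj_iff (h2 : (2 : F) ≠ 0)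
    (hX : ∀ x y, Q.polarBilin (X x) y = -Q.polarBilin x (X y))
    (hX' : ∀ x y, Q.polarBilin (X' x) y = -Q.polarBilin x (X' y)) {t t' : FormTuples F lam}
    (h : HasTuple Q X t) (h' : HasTuple Q X' t') :
    (∃ g ∈ orthGroup Q.polarBilin, X' = g.conj X) ↔ t = t' := by
  obtain ⟨e, he, ht⟩ := h
  obtain ⟨e', he', ht'⟩ := h'
  have h1 : (∃ g ∈ orthGroup Q.polarBilin, X' = g.conj X) ↔
      ∃ g : V ≃ₗ[F] V, (∀ x y, Q.polarBilin (g x) (g y) = Q.polarBilin x y) ∧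
        ∀ x, g (X x) = X' (g x) :=
    exists_congr fun g => and_congr Iff.rfl eq_conj_iff
  have h3 : t = t' ↔ ∀ j, t j = t' j := funext_iff
  rw [h1, he.exists_isometry_iff h2 he' hX hX', h3]
  constructor
  · intro H j
    obtain ⟨_, hj⟩ := ht j
    obtain ⟨_, hj'⟩ := ht' j
    rw [hj, hj']
    have := mem_oddParts_iff.1 j.2
    exact Quotient.sound (H j this.1 this.2)
  · intro H j hj h0
    obtain ⟨_, hj1⟩ := ht ⟨j, mem_oddParts_iff.2 ⟨hj, h0⟩⟩
    obtain ⟨_, hj2⟩ := ht' ⟨j, mem_oddParts_iff.2 ⟨hj, h0⟩⟩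
    have h4 := H ⟨j, mem_oddParts_iff.2 ⟨hj, h0⟩⟩
    rw [hj1, hj2] at h4
    exact Quotient.exact h4

/-- The forms on the middles of the strings have the Witt class of the whole space as their sum. -/
theorem HasTuple.mem_representingTuples [NeZero (2 : F)] [FiniteDimensional F V]
    (hQ : Q.polarBilin.Nondegenerate)
    (hX : ∀ x y, Q.polarBilin (X x) y = -Q.polarBilin x (X y)) {t : FormTuples F lam}
    (h : HasTuple Q X t) : t ∈ representingTuples Q lam := by
  obtain ⟨e, he, ht⟩ := h
  rw [mem_representingTuples_iff, he.wittClass_eq_sum hQ hX (oddParts lam)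
    (fun j hj => (mem_oddParts_iff.1 hj).1) fun j hj h0 => mem_oddParts_iff.2 ⟨hj, h0⟩]
  refine Finset.sum_congr rfl fun j _ => ?_
  obtain ⟨_, hj⟩ := ht j
  rw [hj]
  rfl

/-- The model with forms `t` has the Witt class and the dimension of `Q`, so by Witt cancellation it
is isometric to `Q`. -/
theorem exists_hasTuple_of_mem [NeZero (2 : F)] [FiniteDimensional F V]
    (hn : Module.finrank F V = n)
    (hlam : lam ∈ orthogonalPartitions n) {t : FormTuples F lam}
    (ht : t ∈ representingTuples Q lam) :
    ∃ X : Module.End F V, (∀ x y, Q.polarBilin (X x) y = -Q.polarBilin x (X y)) ∧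
      HasTuple Q X t := by
  obtain ⟨f, hf, hQf⟩ := ht
  obtain ⟨X, e, hX, he, hmid⟩ := exists_stringFrame_of_equivalent hlam f Q fun _ _ hw =>
    (wittClass_eq_iff.1 (hw.trans ((wittClass_pi _).symm.trans
      (wittClass_eq_iff.2 hQf)))).equivalent two_ne_zero ((finrank_stringSpace F lam).trans hn.symm)
  refine ⟨X, hX, e, he, fun j => ⟨by rw [hmid]; exact (f j).2, ?_⟩⟩
  rw [← hf j]
  congr 1
  exact Subtype.ext (hmid j).symm

/-- Elements of Jordan type `lam` decompose into strings of this type. -/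
theorem exists_frame_of_hasJordanType (h2 : (2 : F) ≠ 0) [FiniteDimensional F V]
    (hQ : Q.polarBilin.Nondegenerate)
    (hX : ∀ x y, Q.polarBilin (X x) y = -Q.polarBilin x (X y)) (h : HasJordanType X lam) :
    ∃ e : ∀ j, (Fin (lam.parts.count j) → F) →ₗ[F] V, StringFrame Q.polarBilin X e := by
  obtain ⟨b, hb⟩ := hasJordanType_iff.1 h
  exact exists_stringFrame h2 (QuadraticMap.polar_comm Q) (fun x hx => hQ.1 x hx) hX
    (count_zero lam) hb.exists_pow_eq_zero fun m' b' hb' j hj => hb'.eq_of_pos hb hj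

theorem StringFrame.hasJordanType {e : ∀ j, (Fin (lam.parts.count j) → F) →ₗ[F] V}
    (h : StringFrame Q.polarBilin X e)
    (hX : ∀ x y, Q.polarBilin (X x) y = -Q.polarBilin x (X y)) : HasJordanType X lam :=
  hasJordanType_iff.2 ⟨h.basis hX, h.isStringBasis hX⟩

/-- The rational points are the skew-adjoint elements of Jordan type `lam`, since the lengths of
the strings do not change under extension of scalars. -/
theorem mem_rationalPoints_iff (h2 : (2 : F) ≠ 0) [FiniteDimensional F V]
    (hQ : Q.polarBilin.Nondegenerate) : X ∈ rationalPoints Q lam ↔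
      (∀ x y, Q.polarBilin (X x) y = -Q.polarBilin x (X y)) ∧
        ∃ t : FormTuples F lam, HasTuple Q X t := by
  rw [rationalPoints, Set.mem_ofPred_eq, mem_skewAdjointLieSubalgebra_iff]
  refine and_congr_right fun hX => ⟨fun h => ?_, fun ⟨t, e, he, ht⟩ => ⟨?_, ?_⟩⟩
  · obtain ⟨b, hb⟩ := hasJordanType_iff.1 h.2
    obtain ⟨e, he⟩ := exists_stringFrame h2 (QuadraticMap.polar_comm Q) (fun x hx => hQ.1 x hx) hX
      (count_zero lam) (isNilpotent_of_baseChange _ hb.exists_pow_eq_zero)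
      fun m' b' hb' j hj => (hb'.baseChange (AlgebraicClosure F)).eq_of_pos hb hj
    exact he.exists_hasTuple hX
  · exact mem_skewAdjointLieSubalgebra_iff.2 (baseChange_skew _ hX)
  · exact hasJordanType_iff.2 ⟨_, (he.isStringBasis hX).baseChange _⟩

/-- Two maps identifying the same pairs of elements of `s` have equally many values on `s`. -/
theorem ncard_image_eq_of_kernel_eq {α β γ : Type*} {s : Set α} {f : α → β} {g : α → γ}
    (h : ∀ a ∈ s, ∀ b ∈ s, f a = f b ↔ g a = g b) (hfin : (g '' s).Finite) :
    (f '' s).Finite ∧ (f '' s).ncard = (g '' s).ncard := by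
  rcases s.eq_empty_or_nonempty with rfl | ⟨a, -⟩
  · simp
  have : Nonempty α := ⟨a⟩
  have hinv : ∀ y ∈ g '' s, Function.invFunOn g s y ∈ s ∧ g (Function.invFunOn g s y) = y :=
    fun y hy => ⟨Function.invFunOn_mem hy, Function.invFunOn_eq hy⟩
  have himg : (fun y => f (Function.invFunOn g s y)) '' (g '' s) = f '' s := by
    ext z
    constructor
    · rintro ⟨y, hy, rfl⟩
      exact ⟨_, (hinv y hy).1, rfl⟩
    · rintro ⟨a, ha, rfl⟩
      have := hinv (g a) ⟨a, ha, rfl⟩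
      exact ⟨g a, ⟨a, ha, rfl⟩, (h _ this.1 _ ha).2 this.2⟩
  have hinj : Set.InjOn (fun y => f (Function.invFunOn g s y)) (g '' s) := by
    intro y hy z hz hyz
    rw [← (hinv y hy).2, ← (hinv z hz).2]
    exact (h _ (hinv y hy).1 _ (hinv z hz).1).1 hyz
  exact ⟨himg ▸ hfin.image _, by rw [← himg, hinj.ncard_image]⟩

theorem nonempty_nondegForm (F : Type*) [Field F] [NeZero (2 : F)] (m : ℕ) :
    Nonempty (NondegForm F m) :=
  ⟨⟨QuadraticMap.pi fun _ : Fin m => unaryForm (1 : F),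
    nondegenerate_pi fun _ => unaryForm_nondegenerate one_ne_zero⟩⟩

/-- The orbits of the orthogonal group are classified by the tuples of forms. -/
theorem ncard_adjointOrbits [NeZero (2 : F)] [FiniteDimensional F V]
    (hQ : Q.polarBilin.Nondegenerate) (hn : Module.finrank F V = n)
    (hlam : lam ∈ orthogonalPartitions n) (hfin : (representingTuples Q lam).Finite) :
    (adjointOrbits (orthGroup Q.polarBilin) (rationalPoints Q lam)).Finite ∧
    (adjointOrbits (orthGroup Q.polarBilin) (rationalPoints Q lam)).ncard =
      (representingTuples Q lam).ncard := by
  have h2 : (2 : F) ≠ 0 := two_ne_zero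
  have hex : ∀ X : Module.End F V, ∃ t : FormTuples F lam,
      X ∈ rationalPoints Q lam → HasTuple Q X t := fun X => by
    by_cases hX : X ∈ rationalPoints Q lam
    · obtain ⟨t, ht⟩ := ((mem_rationalPoints_iff h2 hQ).1 hX).2
      exact ⟨t, fun _ => ht⟩
    · exact ⟨fun j => Quotient.mk _ (Classical.choice (nonempty_nondegForm F _)),
        fun h => absurd h hX⟩
  choose τ hτ using hex
  have himg : τ '' rationalPoints Q lam = representingTuples Q lam := by
    ext t
    constructor
    · rintro ⟨X, hX, rfl⟩
      exact (hτ X hX).mem_representingTuples hQ ((mem_rationalPoints_iff h2 hQ).1 hX).1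
    · intro ht
      obtain ⟨X, hX, hXt⟩ := exists_hasTuple_of_mem hn hlam ht
      have hmem := (mem_rationalPoints_iff h2 hQ).2 ⟨hX, t, hXt⟩
      refine ⟨X, hmem, ?_⟩
      exact ((hτ X hmem).exists_conj_iff h2 hX hX hXt).1 ⟨1, Subgroup.one_mem _, rfl⟩
  rw [← himg] at hfin ⊢
  refine ncard_image_eq_of_kernel_eq (fun X hX X' hX' => ?_) hfin
  rw [adjointOrbit_eq_iff]
  exact (hτ X hX).exists_conj_iff h2 ((mem_rationalPoints_iff h2 hQ).1 hX).1
    ((mem_rationalPoints_iff h2 hQ).1 hX').1 (hτ X' hX')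

end Tuples

/-! ### The orbit over the algebraic closure -/

section AlgClosed

variable {K : Type*} [Field K] [IsAlgClosed K] [NeZero (2 : K)]

theorem equivalent_of_isAlgClosed {V W : Type*} [AddCommGroup V] [Module K V]
    [FiniteDimensional K V] [AddCommGroup W] [Module K W] [FiniteDimensional K W]
    {Q : QuadraticForm K V} {Q' : QuadraticForm K W} (hQ : Q.polarBilin.Nondegenerate)
    (hQ' : Q'.polarBilin.Nondegenerate) (hd : Module.finrank K V = Module.finrank K W) :
    Q.Equivalent Q' := by
  have : Invertible (2 : K) := invertibleOfNonzero two_ne_zero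
  have hsep : ∀ {R : QuadraticForm K V}, R.polarBilin.Nondegenerate →
      (QuadraticMap.associated (R := K) R).SeparatingLeft := fun {R} hR x hx =>
    hR.1 x fun y => by
      have h := congrArg (fun b => b x y) (QuadraticMap.two_nsmul_associated K R)
      simp only [LinearMap.smul_apply] at h
      rw [← h]
      erw [hx y]
      simp
  have h1 := equivalent_comp_equiv Q' (LinearEquiv.ofFinrankEq V W hd)
  exact (QuadraticForm.equivalent_of_isAlgClosed _ _ (hsep hQ) (hsep (h1.nondegenerate hQ'))).trans
    h1.symm

/-- Over an algebraically closed field all forms on the middles of the strings are isometric, so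
only the Jordan type is left as an invariant. -/
theorem exists_eq_adjointOrbit {V : Type*} [AddCommGroup V] [Module K V] [FiniteDimensional K V]
    {Q : QuadraticForm K V} (hQ : Q.polarBilin.Nondegenerate) {n : ℕ}
    (hn : Module.finrank K V = n) {lam : n.Partition} (hlam : lam ∈ orthogonalPartitions n) :
    ∃ Z, {X | X ∈ skewAdjointLieSubalgebra Q.polarBilin ∧ HasJordanType X lam} =
      adjointOrbit (orthGroup Q.polarBilin) Z := by
  have h2 : (2 : K) ≠ 0 := two_ne_zero
  obtain ⟨Z, e, hZ, he, -⟩ := exists_stringFrame_of_equivalent hlam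
    (fun j => Classical.choice (nonempty_nondegForm K _)) Q fun Q' hQ' _ =>
      equivalent_of_isAlgClosed hQ' hQ ((finrank_stringSpace K lam).trans hn.symm)
  refine ⟨Z, Set.ext fun X => ⟨fun ⟨hX, hXt⟩ => ?_, ?_⟩⟩
  · rw [mem_skewAdjointLieSubalgebra_iff] at hX
    obtain ⟨e', he'⟩ := exists_frame_of_hasJordanType h2 hQ hX hXt
    obtain ⟨g, hg, hgX⟩ := (he.exists_isometry_iff h2 he' hZ hX).2 fun j hj _ =>
      equivalent_of_isAlgClosed (he.midForm_nondegenerate hZ hj)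
        (he'.midForm_nondegenerate hX hj) rfl
    exact ⟨g, hg, eq_conj_iff.2 hgX⟩
  · rintro ⟨g, hg, rfl⟩
    have hX := conj_skew hg hZ
    exact ⟨mem_skewAdjointLieSubalgebra_iff.2 hX, (he.map hg).hasJordanType hX⟩

end AlgClosed

theorem exists_geometricOrbit_eq {k V : Type*} [Field k] [NeZero (2 : k)] [AddCommGroup V]
    [Module k V] [FiniteDimensional k V] {q : QuadraticForm k V}
    (hq : q.polarBilin.Nondegenerate) {n : ℕ} (hn : Module.finrank k V = n) {lam : n.Partition}
    (hlam : lam ∈ orthogonalPartitions n) :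
    ∃ Z, geometricOrbit q lam = adjointOrbit (orthGroup (geometricForm q)) Z := by
  have : NeZero (2 : AlgebraicClosure k) := ⟨by
    rw [← map_ofNat (algebraMap k (AlgebraicClosure k)), Ne, FaithfulSMul.algebraMap_eq_zero_iff]
    exact two_ne_zero⟩
  have hs : ∀ x y, geometricForm q x y = geometricForm q y x :=
    baseChange_comm _ (QuadraticMap.polar_comm q)
  have hp := polarBilin_quadOfPolar hs
  have h := exists_eq_adjointOrbit (Q := quadOfPolar (geometricForm q))
    (by rw [hp]; exact nondegenerate_of_symm hs fun x => baseChange_eq_zero_of_forall _ hq)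
    ((Module.finrank_baseChange).trans hn) hlam
  rwa [hp] at h


/-! ### Determinants of isometries -/

section Determinants

variable {F : Type*} [Field F] {V : Type*} [AddCommGroup V] [Module F V]

/-- Without strings of odd length, the kernel of `X` meets the ranges of `X ^ (2 j)` and `X ^ (2 j +
1)` in the same subspace. -/
theorem StringFrame.mem_range_of_even {B : LinearMap.BilinForm F V} {X : Module.End F V}
    {m : ℕ → ℕ} {e : ∀ j, (Fin (m j) → F) →ₗ[F] V} (h : StringFrame B X e)
    (hX : ∀ x y, B (X x) y = -B x (X y)) (hm : ∀ j, Odd j → m j = 0) (j : ℕ) (x : V)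
    (hx : X x = 0) (hxj : x ∈ LinearMap.range (X ^ (2 * j))) :
    x ∈ LinearMap.range (X ^ (2 * j + 1)) := by
  have hb := h.isStringBasis hX
  have hrange : ∀ i, LinearMap.range (X ^ i) =
      Submodule.span F (h.basis hX '' {x | i ≤ (x.2 : ℕ)}) := fun i => by
    rw [hb.range_pow, Set.image_eq_range]
    rfl
  have h1 := hb.ker_pow_le 1 (by rw [pow_one]; exact hx)
  rw [hrange, Module.Basis.mem_span_image] at hxj ⊢
  rw [Module.Basis.mem_span_image] at h1
  rintro ⟨⟨i, s⟩, a⟩ hy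
  have h3 : i ≤ a + 1 := h1 hy
  have h4 : 2 * j ≤ (a : ℕ) := hxj hy
  have h5 : (a : ℕ) < i := a.2
  have h6 : Even i := by
    by_contra hodd
    have := hm i (Nat.not_even_iff_odd.1 hodd)
    have := s.pos
    omega
  obtain ⟨r, hr⟩ := h6
  change 2 * j + 1 ≤ (a : ℕ)
  omega

theorem det_eq_prod_of_basis {ι : Type*} [Fintype ι] (b : Module.Basis ι F V) {g : V →ₗ[F] V}
    {c : ι → F} (h : ∀ i, g (b i) = c i • b i) : LinearMap.det g = ∏ i, c i := by
  classical
  rw [← LinearMap.det_toMatrix b, show LinearMap.toMatrix b b g = Matrix.diagonal c from ?_,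
    Matrix.det_diagonal]
  ext i j
  rw [LinearMap.toMatrix_apply, h, map_smul, Module.Basis.repr_self, Matrix.diagonal_apply]
  by_cases hij : i = j
  · subst hij; simp
  · simp [hij]

variable [FiniteDimensional F V]

theorem det_eq_of_adjoint {B : LinearMap.BilinForm F V} (hB : B.Nondegenerate)
    {f f' : V →ₗ[F] V} (h : ∀ x y, B (f x) y = B x (f' y)) :
    LinearMap.det f = LinearMap.det f' := by
  have h1 : f'.dualMap = (B.toDual hB).toLinearMap ∘ₗ f ∘ₗ (B.toDual hB).symm.toLinearMap := by
    refine LinearMap.ext fun ξ => ?_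
    obtain ⟨x, rfl⟩ := (B.toDual hB).surjective ξ
    ext y
    simp only [LinearMap.comp_apply, LinearEquiv.coe_coe, LinearEquiv.symm_apply_apply,
      LinearMap.dualMap_apply, LinearMap.BilinForm.toDual_def, h]
  rw [← LinearMap.det_dualMap f', h1, LinearMap.det_conj]

theorem det_eq_det_mul_det_of_isCompl {U R : Submodule F V} (hc : IsCompl U R) {g : V →ₗ[F] V}
    (hU : ∀ x ∈ U, g x ∈ U) (hR : ∀ x ∈ R, g x ∈ R) :
    LinearMap.det g = LinearMap.det (g.restrict hU) * LinearMap.det (g.restrict hR) := by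
  rw [← LinearMap.det_prodMap, ← LinearMap.det_conj _ (U.prodEquivOfIsCompl R hc)]
  congr 1
  refine LinearMap.ext fun x => ?_
  obtain ⟨⟨u, r⟩, rfl⟩ := (U.prodEquivOfIsCompl R hc).surjective x
  simp

/-- The Cayley argument: `1 + g` and `1 + g⁻¹ = g⁻¹ (1 + g)` are adjoint to each other. -/
theorem det_eq_one_of_isometry {B : LinearMap.BilinForm F V} (hB : B.Nondegenerate)
    {g : V →ₗ[F] V} (hg : ∀ x y, B (g x) (g y) = B x y) (h1 : ∀ x, g x + x = 0 → x = 0) :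
    LinearMap.det g = 1 := by
  have hinj : Function.Injective g := (injective_iff_map_eq_zero g).2 fun x hx =>
    hB.1 x fun y => by rw [← hg, hx]; simp
  let e := LinearEquiv.ofInjectiveEndo g hinj
  have he : ∀ x, g (e.symm x) = x := fun x => e.apply_symm_apply x
  have hadj : LinearMap.det (g + 1) = LinearMap.det (e.symm.toLinearMap + 1) :=
    det_eq_of_adjoint hB fun x y => by
      change B (g x + x) y = B x (e.symm y + y)
      rw [map_add, map_add, LinearMap.add_apply, ← hg x (e.symm y), he]
  have hmul : g ∘ₗ (e.symm.toLinearMap + 1) = g + 1 := by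
    ext x
    change g (e.symm x + x) = g x + x
    rw [map_add, he, add_comm]
  have hne : LinearMap.det (g + 1) ≠ 0 := by
    intro h0
    have hlt := LinearMap.bot_lt_ker_of_det_eq_zero h0
    refine hlt.ne' ((LinearMap.ker_eq_bot').2 fun x hx => h1 x hx)
  have h3 := LinearMap.det_comp g (e.symm.toLinearMap + 1)
  rw [hmul, ← hadj] at h3
  exact (mul_right_cancel₀ hne ((one_mul _).trans h3)).symm

/-- A map with `-1` as its only eigenvalue has determinant `(-1) ^ dim V`. -/
theorem det_eq_of_add_one_pow_eq_zero {g : V →ₗ[F] V} {N : ℕ} (h : (g + 1) ^ N = 0) :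
    LinearMap.det g = (-1) ^ Module.finrank F V := by
  have h1 := LinearMap.eval_charpoly (g + 1) (1 : F)
  rw [IsNilpotent.charpoly_eq_X_pow_finrank ⟨N, h⟩] at h1
  have h3 : algebraMap F (Module.End F V) 1 - (g + 1) = (-1 : F) • g := by
    rw [map_one, neg_one_smul]
    abel
  rw [h3, LinearMap.det_smul] at h1
  simp only [Polynomial.eval_pow, Polynomial.eval_X, one_pow] at h1
  have h4 : ((-1 : F) ^ Module.finrank F V) * (-1) ^ Module.finrank F V = 1 := by
    rw [← mul_pow]; simp
  linear_combination (-(-1 : F) ^ Module.finrank F V) * h1 + LinearMap.det g * (-h4)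

theorem isometry_det {B : LinearMap.BilinForm F V} (hB : B.Nondegenerate) {g : V ≃ₗ[F] V}
    (hg : ∀ x y, B (g x) (g y) = B x y) :
    LinearMap.det g.toLinearMap = 1 ∨ LinearMap.det g.toLinearMap = -1 := by
  have h := det_eq_of_adjoint hB (f := g.toLinearMap) (f' := g.symm.toLinearMap) fun x y => by
    rw [LinearEquiv.coe_coe, LinearEquiv.coe_coe, ← hg x, LinearEquiv.apply_symm_apply]
  have h1 : g.toLinearMap ∘ₗ g.symm.toLinearMap = LinearMap.id := by ext x; simp
  have h3 := LinearMap.det_comp g.toLinearMap g.symm.toLinearMap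
  rw [h1, LinearMap.det_id, ← h] at h3
  exact mul_self_eq_one_iff.1 h3.symm

/-- If every string of a nilpotent `X` has even length, that is, if the members of `ker X` at an
even height lie one step higher, then the dimension is even. -/
theorem even_finrank_of_ker_le {X : Module.End F V} (hX : IsNilpotent X)
    (h : ∀ j x, X x = 0 → x ∈ LinearMap.range (X ^ (2 * j)) →
      x ∈ LinearMap.range (X ^ (2 * j + 1))) : Even (Module.finrank F V) := by
  have hstep : ∀ i, Module.finrank F (LinearMap.range (X ^ i)) =
      Module.finrank F (LinearMap.range (X ^ (i + 1))) +
        Module.finrank F ↥(LinearMap.range (X ^ i) ⊓ LinearMap.ker X) := fun i => by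
    have h1 := LinearMap.finrank_range_add_finrank_ker (X.domRestrict (LinearMap.range (X ^ i)))
    rw [LinearMap.range_domRestrict, LinearMap.ker_domRestrict,
      ← Submodule.finrank_map_subtype_eq, Submodule.map_comap_subtype, ← LinearMap.range_comp] at h1
    rw [← h1, pow_succ']
    rfl
  have heq : ∀ j, LinearMap.range (X ^ (2 * j)) ⊓ LinearMap.ker X =
      LinearMap.range (X ^ (2 * j + 1)) ⊓ LinearMap.ker X := fun j => by
    refine le_antisymm (fun x hx => ⟨h j x hx.2 hx.1, hx.2⟩) (inf_le_inf_right _ ?_)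
    rw [pow_succ]
    exact LinearMap.range_comp_le_range _ _
  have hpar : ∀ j, Even (Module.finrank F V) ↔
      Even (Module.finrank F (LinearMap.range (X ^ (2 * j)))) := by
    intro j
    induction j with
    | zero =>
      rw [mul_zero, pow_zero, Module.End.one_eq_id, LinearMap.range_id, finrank_top]
    | succ j ih =>
      have h1 := hstep (2 * j)
      have h3 := hstep (2 * j + 1)
      rw [heq j] at h1
      rw [ih, show 2 * (j + 1) = 2 * j + 1 + 1 by ring]
      simp only [Nat.even_iff]
      omega
  obtain ⟨N, hN⟩ := hX
  rw [hpar N, pow_eq_zero_of_le (by omega : N ≤ 2 * N) hN, LinearMap.range_zero, finrank_bot]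
  exact Even.zero

/-- If every string of `X` has even length, then an isometry that commutes with `X` has
determinant one: its determinant is given by the dimension of its generalized eigenspace for the
eigenvalue `-1`, which is stable under `X` and hence even-dimensional. -/
theorem det_eq_one_of_even_strings {B : LinearMap.BilinForm F V}
    (hB : B.Nondegenerate) (hsymm : ∀ x y, B x y = B y x) {g : V →ₗ[F] V}
    (hg : ∀ x y, B (g x) (g y) = B x y) {X : Module.End F V} (hX : IsNilpotent X)
    (hgX : ∀ x, g (X x) = X (g x))
    (h : ∀ j x, X x = 0 → x ∈ LinearMap.range (X ^ (2 * j)) →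
      x ∈ LinearMap.range (X ^ (2 * j + 1))) : LinearMap.det g = 1 := by
  have hinj : ∀ x, g x = 0 → x = 0 := fun x hx => hB.1 x fun y => by rw [← hg, hx]; simp
  have hsurj : Function.Surjective g :=
    LinearMap.surjective_of_injective ((injective_iff_map_eq_zero g).2 hinj)
  let s : Module.End F V := g + 1
  have hs : ∀ x, s x = g x + x := fun x => rfl
  have hsg : ∀ N x, (s ^ N) (g x) = g ((s ^ N) x) := fun N x => by
    have : Commute s g := (Commute.refl g).add_left (Commute.one_left g)
    exact congrArg (fun f : Module.End F V => f x) (this.pow_left N).eq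
  have hsX : ∀ N x, (s ^ N) (X x) = X ((s ^ N) x) := fun N x => by
    have h1 : Commute g X := LinearMap.ext hgX
    have : Commute s X := h1.add_left (Commute.one_left X)
    exact congrArg (fun f : Module.End F V => f x) (this.pow_left N).eq
  -- the generalized eigenspace is orthogonal to its complement
  have horth : ∀ N x y, (s ^ N) x = 0 → B x ((s ^ N) y) = 0 := by
    intro N
    induction N with
    | zero =>
      intro x y hx
      rw [pow_zero, Module.End.one_apply] at hx
      rw [hx]; simp
    | succ N ih =>
      intro x y hx
      obtain ⟨x', hx'⟩ := hsurj (s x)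
      have h1 : (s ^ N) x' = 0 := hinj _ (by
        rw [← hsg, hx', ← Module.End.mul_apply, ← pow_succ, hx])
      rw [pow_succ', Module.End.mul_apply, hs, map_add, ← ih x' y h1, ← hg x', hx', hs, map_add,
        LinearMap.add_apply, hg, add_comm]
  obtain ⟨N, hN, hN1⟩ := ((LinearMap.eventually_isCompl_ker_pow_range_pow s).and
    (Filter.eventually_ge_atTop 1)).exists
  have hker : ∀ x ∈ LinearMap.range (s ^ N), (s ^ N) x = 0 → x = 0 := fun x hx hx0 =>
    (Submodule.disjoint_def.1 hN.disjoint) x hx0 hx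
  have hUg : ∀ x ∈ LinearMap.ker (s ^ N), g x ∈ LinearMap.ker (s ^ N) := fun x hx => by
    rw [LinearMap.mem_ker] at hx ⊢
    rw [hsg, hx, map_zero]
  have hRg : ∀ x ∈ LinearMap.range (s ^ N), g x ∈ LinearMap.range (s ^ N) := by
    rintro _ ⟨y, rfl⟩
    exact ⟨g y, hsg N y⟩
  have hUX : ∀ x ∈ LinearMap.ker (s ^ N), X x ∈ LinearMap.ker (s ^ N) := fun x hx => by
    rw [LinearMap.mem_ker] at hx ⊢
    rw [hsX, hx, map_zero]
  have hRX : ∀ a, ∀ x ∈ LinearMap.range (s ^ N), (X ^ a) x ∈ LinearMap.range (s ^ N) := by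
    intro a
    induction a with
    | zero => exact fun x hx => hx
    | succ a ih =>
      rintro _ ⟨y, rfl⟩
      rw [pow_succ, Module.End.mul_apply, ← hsX]
      exact ih _ ⟨_, rfl⟩
  rw [det_eq_det_mul_det_of_isCompl hN hUg hRg]
  have hdetR : LinearMap.det (g.restrict hRg) = 1 := by
    refine det_eq_one_of_isometry (B := B.restrict (LinearMap.range (s ^ N)))
      (nondegenerate_of_symm (fun x y => hsymm x y) fun x hx => Subtype.ext (hB.1 x fun y => ?_))
      (fun x y => hg x y) fun x hx => Subtype.ext (hker x x.2 ?_)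
    · obtain ⟨u, r, hu, hr, rfl⟩ := Submodule.codisjoint_iff_exists_add_eq.1 hN.codisjoint y
      obtain ⟨z, hz⟩ := x.2
      have h1 : B x u = 0 := by rw [hsymm, ← hz, horth N u z hu]
      rw [map_add, h1, zero_add]
      exact hx ⟨r, hr⟩
    · have h1 : s x = 0 := congrArg Subtype.val hx
      exact pow_apply_eq_zero_of_le ((pow_one s).symm ▸ h1) hN1
  have hdetU : LinearMap.det (g.restrict hUg) = 1 := by
    have hpow : ∀ a (x : LinearMap.ker (s ^ N)), (((X.restrict hUX) ^ a) x : V) = (X ^ a) x :=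
      fun a x => by rw [Module.End.pow_restrict, LinearMap.coe_restrict_apply]
    rw [det_eq_of_add_one_pow_eq_zero (N := N), Even.neg_one_pow]
    · refine even_finrank_of_ker_le (X := X.restrict hUX) ?_ fun j x hx hxj => ?_
      · obtain ⟨M, hM⟩ := hX
        exact ⟨M, LinearMap.ext fun x => Subtype.ext (by rw [hpow, hM]; rfl)⟩
      · obtain ⟨y, hy⟩ := hxj
        have hy' : (X ^ (2 * j)) (y : V) = x := by rw [← hpow, hy]
        obtain ⟨z, hz⟩ := h j x (congrArg Subtype.val hx) ⟨y, hy'⟩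
        obtain ⟨u, r, hu, hr, rfl⟩ := Submodule.codisjoint_iff_exists_add_eq.1 hN.codisjoint z
        refine ⟨⟨u, hu⟩, Subtype.ext ?_⟩
        have h1 : (X ^ (2 * j + 1)) r = x - (X ^ (2 * j + 1)) u := by
          rw [← hz, map_add, add_sub_cancel_left]
        have h3 := hRX (2 * j + 1) r hr
        rw [h1] at h3
        have hu' := hpow (2 * j + 1) ⟨u, hu⟩
        rw [hpow, ← sub_eq_zero, ← neg_sub, neg_eq_zero]
        refine hker _ h3 ?_
        rw [← hu']
        exact (Submodule.sub_mem _ x.2 (Subtype.property _) :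
          (x : V) - ((X.restrict hUX ^ (2 * j + 1)) ⟨u, hu⟩ : LinearMap.ker (s ^ N)) ∈
            LinearMap.ker (s ^ N))
    · have hpow' : ∀ a (x : LinearMap.ker (s ^ N)),
          (((g.restrict hUg + 1) ^ a) x : V) = (s ^ a) x := fun a => by
        induction a with
        | zero => exact fun x => rfl
        | succ a ih =>
          intro x
          rw [pow_succ, Module.End.mul_apply, ih, pow_succ, Module.End.mul_apply]
          rfl
      exact LinearMap.ext fun x => Subtype.ext ((hpow' N x).trans x.2)
  rw [hdetR, hdetU, one_mul]

theorem exists_comp_eq_sum_sq [NeZero (2 : F)] {m : ℕ} (Q : QuadraticForm F (Fin m → F)) :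
    ∃ (D : (Fin m → F) ≃ₗ[F] (Fin m → F)) (w : Fin m → F),
      ∀ x, Q (D x) = ∑ i, w i * (x i * x i) := by
  have : Invertible (2 : F) := invertibleOfNonzero two_ne_zero
  have h := QuadraticForm.equivalent_weightedSumSquares Q
  rw [Module.finrank_fin_fun] at h
  obtain ⟨w, ⟨D⟩⟩ := h
  refine ⟨D.toLinearEquiv.symm, w, fun x => ?_⟩
  rw [← D.map_app]
  have h1 : D (D.toLinearEquiv.symm x) = x := D.toLinearEquiv.apply_symm_apply x
  rw [h1, QuadraticMap.weightedSumSquares_apply]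
  simp

/-- The sign change of one coordinate. -/
def flipCoord (F : Type*) [Field F] {m : ℕ} (i₀ : Fin m) : (Fin m → F) ≃ₗ[F] (Fin m → F) :=
  LinearEquiv.piCongrRight fun i => if i = i₀ then LinearEquiv.neg F else LinearEquiv.refl F F

theorem flipCoord_apply {m : ℕ} (i₀ : Fin m) (x : Fin m → F) (i : Fin m) :
    flipCoord F i₀ x i = if i = i₀ then -x i else x i := by
  rw [flipCoord, LinearEquiv.piCongrRight_apply]
  split_ifs <;> rfl

theorem flipCoord_single {m : ℕ} (i₀ i : Fin m) :
    flipCoord F i₀ (Pi.single i 1) = (if i = i₀ then (-1 : F) else 1) • Pi.single i (1 : F) := by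
  funext t
  rw [flipCoord_apply, Pi.smul_apply]
  by_cases ht : t = i
  · subst ht
    split_ifs <;> simp
  · simp [ht]

/-- The centralizer of an endomorphism with strings of some odd length contains an isometry of
determinant `-1`, which changes the signs of all members of one string. -/
theorem StringFrame.exists_commuting_isometry [NeZero (2 : F)] {Q : QuadraticForm F V}
    {X : Module.End F V} {m : ℕ → ℕ} {e : ∀ j, (Fin (m j) → F) →ₗ[F] V}
    (h : StringFrame Q.polarBilin X e)
    (hX : ∀ x y, Q.polarBilin (X x) y = -Q.polarBilin x (X y)) {j : ℕ} (hj : Odd j)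
    (hm : 0 < m j) :
    ∃ g : V ≃ₗ[F] V, (∀ x y, Q.polarBilin (g x) (g y) = Q.polarBilin x y) ∧
      (∀ x, g (X x) = X (g x)) ∧ LinearMap.det g.toLinearMap = -1 := by
  classical
  obtain ⟨D, w, hD⟩ := exists_comp_eq_sum_sq (midForm Q X e j)
  let i₀ : Fin (m j) := ⟨0, hm⟩
  -- coordinates on the heads in which the form attached to `j` is diagonal
  have h' := h.comp_equiv (Function.update (fun _ => LinearEquiv.refl F _) j D)
  obtain ⟨e', he'⟩ : ∃ e' : ∀ j, (Fin (m j) → F) →ₗ[F] V, e' = fun i => e i ∘ₗ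
    (Function.update (β := fun i => (Fin (m i) → F) ≃ₗ[F] (Fin (m i) → F))
      (fun _ => LinearEquiv.refl F _) j D i).toLinearMap := ⟨_, rfl⟩
  rw [← he'] at h'
  have hmid : ∀ x, midForm Q X e' j x = ∑ i, w i * (x i * x i) := fun x => by
    rw [← hD, he']
    change Q _ = Q _
    simp
  let T : ∀ i, (Fin (m i) → F) ≃ₗ[F] (Fin (m i) → F) :=
    Function.update (fun _ => LinearEquiv.refl F _) j (flipCoord F i₀)
  have hTj : T j = flipCoord F i₀ := Function.update_self ..
  have hTi : ∀ i, i ≠ j → T i = LinearEquiv.refl F _ := fun i hi => Function.update_of_ne hi ..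
  obtain ⟨g, hg, hgX, hgb⟩ := h'.exists_isometry h' hX hX T fun i u v => by
    by_cases hi : i = j
    · subst hi
      have h1 : ∀ x, midForm Q X e' i (T i x) = midForm Q X e' i x := fun x => by
        rw [hmid, hmid, hTj]
        refine Finset.sum_congr rfl fun t _ => ?_
        rw [flipCoord_apply]
        split_ifs <;> ring
      have h3 := polar_of_isometry (T i).toLinearMap h1 u v
      rw [LinearEquiv.coe_coe, polar_midForm hX hj, polar_midForm hX hj] at h3
      exact mul_left_cancel₀ (pow_ne_zero _ (by simp)) h3
    · rw [hTi i hi]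
      rfl
  refine ⟨g, hg, hgX, ?_⟩
  have := Module.Finite.finite_basis (h'.basis hX)
  have := Fintype.ofFinite (StringIndex m)
  have hc : ∀ x : StringIndex m, g.toLinearMap (h'.basis hX x) =
      (if x.1 = ⟨j, i₀⟩ then (-1 : F) else 1) • h'.basis hX x := by
    rintro ⟨⟨i, s⟩, a⟩
    rw [LinearEquiv.coe_coe, hgb, basis_apply, vec, vec, LinearMap.comp_apply, LinearEquiv.coe_coe]
    dsimp only
    by_cases hi : i = j
    · subst hi
      rw [hTj, flipCoord_single, map_smul, map_smul]
      congr 1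
      simp
    · rw [hTi i hi, if_neg (fun hc => hi (congrArg Sigma.fst hc)), one_smul]
      rfl
  rw [det_eq_prod_of_basis (h'.basis hX) hc, Finset.prod_ite, Finset.prod_const_one, mul_one,
    Finset.prod_const]
  have hcard : (Finset.univ.filter fun x : StringIndex m => x.1 = ⟨j, i₀⟩).card = j := by
    rw [← Fintype.card_subtype]
    refine (Fintype.card_congr (β := Fin j) ⟨fun x => Fin.cast (congrArg Sigma.fst x.2) x.1.2,
      fun a => ⟨⟨⟨j, i₀⟩, a⟩, rfl⟩, ?_, fun a => rfl⟩).trans (Fintype.card_fin j)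
    rintro ⟨⟨p, a⟩, h⟩
    dsimp only at h
    subst h
    rfl
  rw [hcard, hj.neg_one_pow]

end Determinants


/-! ### Orbits of the special orthogonal group -/

section SpecialOrthogonal

variable {F : Type*} [Field F] {V : Type*} [AddCommGroup V] [Module F V]

theorem mem_specialOrthGroup_iff {B : LinearMap.BilinForm F V} {g : V ≃ₗ[F] V} :
    g ∈ specialOrthGroup B ↔
      (∀ u v, B (g u) (g v) = B u v) ∧ LinearMap.det g.toLinearMap = 1 := by
  rw [specialOrthGroup, Subgroup.mem_inf, MonoidHom.mem_ker, ← Units.val_inj,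
    LinearEquiv.coe_det]
  rfl

theorem det_mul_apply (g h : V ≃ₗ[F] V) : LinearMap.det (g * h).toLinearMap =
    LinearMap.det g.toLinearMap * LinearMap.det h.toLinearMap :=
  LinearMap.det_comp g.toLinearMap h.toLinearMap

variable [FiniteDimensional F V] {Q : QuadraticForm F V}

/-- If some isometry of determinant `-1` commutes with `X`, then the two orbits of `X` agree. -/
theorem adjointOrbit_specialOrthGroup_eq (hQ : Q.polarBilin.Nondegenerate)
    {X : Module.End F V} {s : V ≃ₗ[F] V} (hs : s ∈ orthGroup Q.polarBilin)
    (hsX : ∀ x, s (X x) = X (s x)) (hdet : LinearMap.det s.toLinearMap = -1) :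
    adjointOrbit (specialOrthGroup Q.polarBilin) X = adjointOrbit (orthGroup Q.polarBilin) X := by
  ext Y
  constructor
  · rintro ⟨g, hg, rfl⟩
    exact ⟨g, hg.1, rfl⟩
  · rintro ⟨g, hg, hY⟩
    rcases isometry_det hQ hg with h1 | h1
    · exact ⟨g, mem_specialOrthGroup_iff.2 ⟨hg, h1⟩, hY⟩
    · refine ⟨g * s, mem_specialOrthGroup_iff.2 ⟨(orthGroup Q.polarBilin).mul_mem hg hs, ?_⟩, ?_⟩
      · rw [det_mul_apply, h1, hdet]
        ring
      · rw [eq_conj_iff] at hY ⊢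
        intro x
        change g (s (X x)) = Y (g (s x))
        rw [hsX, hY]

variable [NeZero (2 : F)]

/-- The reflection in the first vector of an orthogonal basis. -/
theorem exists_isometry_det_eq_neg_one (Q : QuadraticForm F V) (hV : 0 < Module.finrank F V) :
    ∃ g ∈ orthGroup Q.polarBilin, LinearMap.det g.toLinearMap = -1 := by
  let f := (Module.finBasis F V).equivFun.symm
  obtain ⟨D, w, hD⟩ := exists_comp_eq_sum_sq (Q.comp f.toLinearMap)
  let i₀ : Fin (Module.finrank F V) := ⟨0, hV⟩
  let p := D.trans f
  have hp : ∀ x, Q (p x) = ∑ i, w i * (x i * x i) := hD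
  let g := (p.symm.trans (flipCoord F i₀)).trans p
  have hQ : ∀ x, Q (g x) = Q x := fun x => by
    obtain ⟨y, rfl⟩ := p.surjective x
    have h1 : g (p y) = p (flipCoord F i₀ y) := by
      change p (flipCoord F i₀ (p.symm (p y))) = _
      rw [LinearEquiv.symm_apply_apply]
    rw [h1, hp, hp]
    refine Finset.sum_congr rfl fun i _ => ?_
    rw [flipCoord_apply]
    split_ifs <;> ring
  refine ⟨g, fun u v => polar_of_isometry g.toLinearMap hQ u v, ?_⟩
  have h2 : g.toLinearMap = p.toLinearMap ∘ₗ (flipCoord F i₀).toLinearMap ∘ₗ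
      p.symm.toLinearMap := rfl
  rw [h2, LinearMap.det_conj, det_eq_prod_of_basis (Pi.basisFun F _)
    (c := fun i => if i = i₀ then -1 else 1) fun i => by
      rw [Pi.basisFun_apply]
      exact flipCoord_single i₀ i]
  simp

variable {n : ℕ} {lam : n.Partition}

theorem adjointOrbits_specialOrthGroup_of_nonempty (hQ : Q.polarBilin.Nondegenerate)
    (hlam : (oddParts lam).Nonempty) :
    adjointOrbits (specialOrthGroup Q.polarBilin) (rationalPoints Q lam) =
      adjointOrbits (orthGroup Q.polarBilin) (rationalPoints Q lam) := by
  obtain ⟨j, hj⟩ := hlam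
  rw [mem_oddParts_iff] at hj
  refine Set.image_congr fun X hX => ?_
  obtain ⟨hX, t, e, he, -⟩ := (mem_rationalPoints_iff two_ne_zero hQ).1 hX
  obtain ⟨s, hs, hsX, hdet⟩ := he.exists_commuting_isometry hX hj.1 hj.2
  exact adjointOrbit_specialOrthGroup_eq hQ hs hsX hdet

/-- If all parts are even, then the only orbit of the orthogonal group splits into two orbits of
the special orthogonal group. -/
theorem ncard_adjointOrbits_specialOrthGroup_of_empty (hQ : Q.polarBilin.Nondegenerate)
    (hV : 0 < Module.finrank F V) (hlam : oddParts lam = ∅)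
    (hne : (rationalPoints Q lam).Nonempty) :
    (adjointOrbits (specialOrthGroup Q.polarBilin) (rationalPoints Q lam)).ncard = 2 := by
  obtain ⟨X, hXr⟩ := hne
  obtain ⟨hX, t, ht⟩ := (mem_rationalPoints_iff two_ne_zero hQ).1 hXr
  obtain ⟨s, hs, hdet⟩ := exists_isometry_det_eq_neg_one Q hV
  have hsub : ∀ t t' : FormTuples F lam, t = t' := fun t t' => funext fun j => by
    have := j.2
    simp [hlam] at this
  have hconj : ∀ Y ∈ rationalPoints Q lam, ∃ g ∈ orthGroup Q.polarBilin, Y = g.conj X :=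
    fun Y hY => by
      obtain ⟨hY, t', ht'⟩ := (mem_rationalPoints_iff two_ne_zero hQ).1 hY
      exact (ht.exists_conj_iff two_ne_zero hX hY ht').2 (hsub _ _)
  have hsX : s.conj X ∈ rationalPoints Q lam := by
    obtain ⟨e, he, -⟩ := ht
    exact (mem_rationalPoints_iff two_ne_zero hQ).2
      ⟨conj_skew hs hX, (he.map hs).exists_hasTuple (conj_skew hs hX)⟩
  have heq : adjointOrbits (specialOrthGroup Q.polarBilin) (rationalPoints Q lam) =
      {adjointOrbit (specialOrthGroup Q.polarBilin) X,
        adjointOrbit (specialOrthGroup Q.polarBilin) (s.conj X)} := by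
    ext O
    constructor
    · rintro ⟨Y, hY, rfl⟩
      obtain ⟨g, hg, rfl⟩ := hconj Y hY
      rcases isometry_det hQ hg with h1 | h1
      · exact Or.inl (adjointOrbit_eq_iff.2 ⟨g, mem_specialOrthGroup_iff.2 ⟨hg, h1⟩, rfl⟩).symm
      · refine Or.inr (adjointOrbit_eq_iff.2 ⟨g * s⁻¹, mem_specialOrthGroup_iff.2
          ⟨(orthGroup Q.polarBilin).mul_mem hg ((orthGroup Q.polarBilin).inv_mem hs), ?_⟩,
          ?_⟩).symm
        · have h3 : LinearMap.det (s⁻¹ : V ≃ₗ[F] V).toLinearMap = -1 := by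
            have h4 := det_mul_apply s s⁻¹
            rw [mul_inv_cancel, hdet] at h4
            have h5 : LinearMap.det (1 : V ≃ₗ[F] V).toLinearMap = 1 := LinearMap.det_id
            rw [h5] at h4
            linear_combination h4
          rw [det_mul_apply, h1, h3]
          ring
        · ext x
          change _ = g (s.symm (s (X (s.symm (s (g.symm x))))))
          rw [LinearEquiv.symm_apply_apply, LinearEquiv.symm_apply_apply]
          rfl
    · rintro (rfl | rfl)
      · exact ⟨X, hXr, rfl⟩
      · exact ⟨_, hsX, rfl⟩
  rw [heq, Set.ncard_pair]
  rw [Ne, adjointOrbit_eq_iff]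
  rintro ⟨g, hg, hgX⟩
  rw [mem_specialOrthGroup_iff] at hg
  obtain ⟨e, he, -⟩ := ht
  -- otherwise an isometry of determinant `-1` would commute with `X`
  have hc : ∀ x, (s⁻¹ * g) (X x) = X ((s⁻¹ * g) x) := fun x => by
    have h1 := eq_conj_iff.1 hgX x
    change s.symm (g (X x)) = X (s.symm (g x))
    rw [h1, LinearEquiv.conj_apply_apply, LinearEquiv.symm_apply_apply]
  have hmem : s⁻¹ * g ∈ orthGroup Q.polarBilin :=
    (orthGroup Q.polarBilin).mul_mem ((orthGroup Q.polarBilin).inv_mem hs) hg.1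
  have hm : ∀ j, Odd j → lam.parts.count j = 0 := fun j hj => by
    by_contra h0
    have := mem_oddParts_iff.2 ⟨hj, Nat.pos_of_ne_zero h0⟩
    simp [hlam] at this
  have h1 := det_eq_one_of_even_strings hQ (QuadraticMap.polar_comm Q)
    (g := (s⁻¹ * g).toLinearMap) hmem (he.isStringBasis hX).exists_pow_eq_zero hc
    (he.mem_range_of_even hX hm)
  have h3 := det_mul_apply s (s⁻¹ * g)
  rw [mul_inv_cancel_left, hg.2, hdet, h1] at h3
  apply NeZero.ne (2 : F)
  linear_combination h3

theorem numOddParts_eq_zero_iff :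
    (numOddParts lam 1 = 0 ∧ numOddParts lam 2 = 0 ∧
      ∑ i ∈ Finset.Icc 3 n, numOddParts lam i = 0) ↔ oddParts lam = ∅ := by
  constructor
  · rintro ⟨h1, h2, h3⟩
    rw [sum_numOddParts] at h3
    by_contra hne
    obtain ⟨j, hj⟩ := Finset.nonempty_iff_ne_empty.2 hne
    have h0 := (mem_oddParts_iff.1 hj).2
    have hcase : lam.parts.count j = 1 ∨ lam.parts.count j = 2 ∨ 3 ≤ lam.parts.count j := by omega
    rcases hcase with h | h | h
    · exact Finset.card_ne_zero.2 ⟨j, Finset.mem_filter.2 ⟨hj, h⟩⟩ h1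
    · exact Finset.card_ne_zero.2 ⟨j, Finset.mem_filter.2 ⟨hj, h⟩⟩ h2
    · exact Finset.card_ne_zero.2 ⟨j, Finset.mem_filter.2 ⟨hj, h⟩⟩ h3
  · intro h
    simp [numOddParts, h]

end SpecialOrthogonal

end

theorem mainTheorem2 {k : Type*} [Field k] [ValuativeRel k] [TopologicalSpace k]
    [IsNonarchimedeanLocalField k] (hp : ringChar 𝓀[k] ≠ 2)
    {V : Type*} [AddCommGroup V] [Module k V] [FiniteDimensional k V]
    (q : QuadraticForm k V) (hq : q.polarBilin.Nondegenerate)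
    (n : ℕ) (hn : Module.finrank k V = n)
    (hchar : ringChar k = 0 ∨ orthCoxeterNumber n < ringChar k)
    (lam : n.Partition) (hlam : lam ∈ orthogonalPartitions n)
    (a b c d : ℕ) (ha : a = numOddParts lam 1) (hb : b = numOddParts lam 2)
    (hc : c = ∑ i ∈ Finset.Icc 3 n, numOddParts lam i) (hd : d = anisotropicDim q) :
    -- the Jordan type `lam` cuts out exactly one orbit over the algebraic closure
    (∃ Z, geometricOrbit q lam = adjointOrbit (orthGroup (geometricForm q)) Z) ∧
    -- the number of orbits of the orthogonal group
    (adjointOrbits (orthGroup q.polarBilin) (rationalPoints q lam)).Finite ∧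
    (representingTuples q lam).Finite ∧
    (adjointOrbits (orthGroup q.polarBilin) (rationalPoints q lam)).ncard =
      (representingTuples q lam).ncard ∧
    ((representingTuples q lam).ncard : ℚ) = orbitCount a b c d ∧
    -- the number of orbits of the special orthogonal group
    (0 < n →
      (adjointOrbits (specialOrthGroup q.polarBilin) (rationalPoints q lam)).Finite ∧
      ((adjointOrbits (specialOrthGroup q.polarBilin) (rationalPoints q lam)).ncard : ℚ) =
        if a = 0 ∧ b = 0 ∧ c = 0 ∧ d = 0 then 2 else orbitCount a b c d) := by
  have h2 : NeZero (2 : k) := ⟨two_ne_zero_of_residue k hp⟩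
  obtain ⟨G, _, _, d', φ, hφ⟩ := exists_isWittGroupOf_localField k hp
  obtain ⟨hfin, hcard⟩ := hφ.ncard_representingTuples hq hn lam
  obtain ⟨hOfin, hOcard⟩ := ncard_adjointOrbits hq hn hlam hfin
  rw [← ha, ← hb, ← hc, ← hd] at hcard
  refine ⟨exists_geometricOrbit_eq hq hn hlam, hOfin, hfin, hOcard, hcard, fun hpos => ?_⟩
  have hiff := numOddParts_eq_zero_iff (lam := lam)
  rw [← ha, ← hb, ← hc] at hiff
  rcases (oddParts lam).eq_empty_or_nonempty with hodd | hodd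
  swap
  · rw [adjointOrbits_specialOrthGroup_of_nonempty hq hodd, hOcard, hcard, if_neg]
    · exact ⟨hOfin, rfl⟩
    · rintro ⟨h1, h3, h4, -⟩
      exact hodd.ne_empty (hiff.1 ⟨h1, h3, h4⟩)
  obtain ⟨h1, h3, h4⟩ := hiff.2 hodd
  rcases (rationalPoints q lam).eq_empty_or_nonempty with hemp | hne
  · -- the count of orbits of the orthogonal group vanishes, so `d` does not
    have h0 : orbitCount a b c d = 0 := by
      rw [← hcard, ← hOcard, hemp, adjointOrbits, Set.image_empty]
      simp
    have hd0 : d ≠ 0 := fun hd0 => by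
      rw [h1, h3, h4, hd0] at h0
      norm_num [orbitCount, orbitEpsilon, round_eq] at h0
    rw [hemp, adjointOrbits, Set.image_empty, if_neg (fun h => hd0 h.2.2.2), h0]
    simp
  · have hso := ncard_adjointOrbits_specialOrthGroup_of_empty hq (hn ▸ hpos) hodd hne
    have hd0 : d = 0 := by
      by_contra hd0
      have h0 : orbitCount a b c d = 0 := by
        rw [h1, h3, h4]
        norm_num [orbitCount, orbitEpsilon, round_eq, hd0]
      rw [← hcard, ← hOcard, Nat.cast_eq_zero, Set.ncard_eq_zero hOfin] at h0
      exact (hne.image _).ne_empty h0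
    rw [hso, if_pos ⟨h1, h3, h4, hd0⟩]
    exact ⟨Set.finite_of_ncard_ne_zero (by rw [hso]; norm_num), by norm_num⟩
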